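/- Let $d$ be a dimension, let $0<\lambda<\infty$, and let $p$ be a probability distribution on $\mathbb{Z}^d$ whose support is contained in $\{\pm e_1,\dots,\pm e_d\}$ and generates the group $\mathbb{Z}^d$. A configuration is an element $\eta$ of $(\mathbb{N}_{\mathfrak{s}})^{\mathbb{Z}^d}$, $\mathbb{N}_{\mathfrak{s}}=\{0,1,2,\dots\}\cup\{\mathfrak{s}\}$: $\eta(x)=n$ means $n$ active particles at $x$, and $\eta(x)=\mathfrak{s}$ means one sleeping particle; $|n|=n$ and $|\mathfrak{s}|=1$. Let $\mathfrak{s}+1=2$, $1\cdot\mathfrak{s}=\mathfrak{s}$ and $n\cdot\mathfrak{s}=n$ for $n\ge 2$. A site $x$ is stable for $\eta$ if $\eta(x)\in\{0,\mathfrak{s}\}$, and unstable otherwise. At an unstable site $x$, the operation $\mathfrak{t}_{x\mathfrak{s}}$ replaces $\eta(x)$ by $\eta(x)\cdot\mathfrak{s}$, and $\mathfrak{t}_{xy}$ replaces $\eta(x)$ by $\eta(x)-1$ and $\eta(y)$ by $\eta(y)+1$. Let $\nu$ be a translation-ergodic probability measure on $(\mathbb{N}_{\mathfrak{s}})^{\mathbb{Z}^d}$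 with $\int|\eta(\mathbf 0)|\,\nu(\mathrm{d}\eta)<\infty$. **Continuous-time process.** From a configuration with finitely many particles, the activated random walk (ARW) is the continuous-time Markov chain that, for each unstable $x$, makes the transition $\eta\to\mathfrak{t}_{x\mathfrak{s}}\eta$ at rate $\lambda\,\eta(x)$ and the transitions $\eta\to\mathfrak{t}_{xy}\eta$ at rates $p(y-x)\,\eta(x)$. An ARW with initial law $\nu$ is a process $(\eta_t)_{t\ge0}$ with right-continuous paths, with $\eta_0$ of law $\nu$, whose finite-dimensional distributions (the probabilities of events that depend on finitely many sites and finitely many times) are the limits, as the finite set $V$ increases to $\mathbb{Z}^d$, of those of the chain started from $\eta\cdot\mathbb{1}_V$ with $\eta$ of law $\nu$. Write $\mathbf{P}^\nu$ for the underlying probability. The process fixates if for each site there is a (random) time after which the site is always stable. **Site-wise representation.** Under $\mathbb{P}^\nu$, let $\eta_0$ have law $\nu$ and, independently of $\eta_0$, let $(\mathfrak{t}^{x,j})_{x\in\mathbb{Z}^d,\,j\ge1}$ be independent instructions with $\mathfrak{t}^{x,j}=\mathfrak{t}_{x\mathfrak{s}}$ with probability $\frac{\lambda}{1+\lambda}$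 and $\mathfrak{t}^{x,j}=\mathfrak{t}_{xy}$ with probability $\frac{p(y-x)}{1+\lambda}$. Toppling a site $x$ for the $j$-th time means applying $\mathfrak{t}^{x,j}$ to the configuration. A finite sequence of topplings is legal for $\eta$ if, performed one after the other starting from $\eta$, each of them takes place at a site that is unstable at that moment. For finite $V\subseteq\mathbb{Z}^d$ let $m_{V,\eta}(x)$ be the supremum of the number of topplings at $x$ over the legal sequences for $\eta$ contained in $V$, and let $m_\eta(x)=\sup_V m_{V,\eta}(x)=\lim_{V\uparrow\mathbb{Z}^d}m_{V,\eta}(x)\in[0,\infty]$. **Theorem.** An ARW $(\eta_t)_{t\ge0}$ with initial law $\nu$ exists, and for every such process $$\mathbf{P}^\nu\big((\eta_t)_{t\ge0}\text{ fixates}\big)=\mathbb{P}^\nu\big(m_{\eta_0}(\mathbf 0)<\infty\big).$$ Moreover, this common value is $0$ or $1$. -/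

import Mathlib

open scoped NNReal ENNReal

noncomputable section

namespace ARW

/-- Sites of the lattice `ℤ^d`. -/
abbrev Site (d : ℕ) : Type := Fin d → ℤ

/-- What a site may contain: `active n` stands for `n` active particles (so `active 0` is a vacant
site), and `sleeping` stands for exactly one sleeping particle. -/
inductive Occ : Type
  | active (n : ℕ)
  | sleeping

namespace Occ

instance : MeasurableSpace Occ := ⊤

/-- The number of active particles. -/
def activeCount : Occ → ℕ
  | active n => n
  | sleeping => 0

/-- The number of particles, regardless of their state. -/
def count : Occ → ℕ
  | active n => n
  | sleeping => 1

/-- A particle arrives; a sleeping particle is woken up (`A + S → 2A`). -/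
def addOne : Occ → Occ
  | active n => active (n + 1)
  | sleeping => active 2

/-- A particle leaves (only used when an active particle is present). -/
def subOne : Occ → Occ
  | active n => active (n - 1)
  | sleeping => active 0

/-- A particle tries to fall asleep; it succeeds only if it is alone. -/
def trySleep : Occ → Occ
  | active 1 => sleeping
  | active n => active n
  | sleeping => sleeping

/-- A site is stable if it is vacant or holds one sleeping particle. -/
def Stable (o : Occ) : Prop := o = active 0 ∨ o = sleeping

end Occ

/-- Particle configurations on `ℤ^d`, with the product σ-algebra. -/
abbrev Config (d : ℕ) : Type := Site d → Occ

variable {d : ℕ}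

/-- The transition `𝔱_{x𝔰}`: a particle at `x` tries to fall asleep. -/
def sleepAt (x : Site d) (ξ : Config d) : Config d :=
  Function.update ξ x (ξ x).trySleep

/-- The transition `𝔱_{xy}` with `y = x + z`: a particle jumps from `x` to `x + z`. -/
def jumpAt (x z : Site d) (ξ : Config d) : Config d :=
  let ξ' := Function.update ξ x (ξ x).subOne
  Function.update ξ' (x + z) (ξ' (x + z)).addOne

/-- The nearest neighbours `±e₁, …, ±e_d` of the origin. -/
def neighbors (d : ℕ) : Set (Site d) :=
  {z | ∃ i : Fin d, z = Pi.single i 1 ∨ z = Pi.single i (-1)}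

/-! ### Translation-ergodic initial laws -/

/-- Translation of a configuration by `z`. -/
def shift (z : Site d) (ξ : Config d) : Config d := fun x => ξ (x + z)

/-- The law `ν` is invariant under all translations of `ℤ^d`, and every translation-invariant event
has probability `0` or `1`. -/
structure TranslationErgodic (ν : MeasureTheory.Measure (Config d)) : Prop where
  invariant : ∀ z : Site d, MeasureTheory.MeasurePreserving (shift z) ν ν
  zero_one : ∀ A : Set (Config d), MeasurableSet A → (∀ z : Site d, shift z ⁻¹' A = A) →
    ν A = 0 ∨ ν A = 1

/-! ### The site-wise representation -/

/-- An instruction: try to sleep, or jump by the displacement `z`. -/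
inductive Instr (d : ℕ) : Type
  | sleep
  | jump (z : Site d)

instance : MeasurableSpace (Instr d) := ⊤

/-- Apply an instruction at the site `x`. -/
def Instr.applyAt (x : Site d) : Instr d → Config d → Config d
  | sleep => sleepAt x
  | jump z => jumpAt x z

/-- A field of instructions: `I (x, j)` is the instruction number `j + 1` of the stack at `x`. -/
abbrev InstrField (d : ℕ) : Type := Site d × ℕ → Instr d

/-- The toppling `Φ_x` of a pair (configuration, odometer field): apply the first unused
instruction of the stack at `x`, and increase the odometer at `x` by one. -/
def topple (I : InstrField d) (x : Site d) (s : Config d × (Site d → ℕ)) :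
    Config d × (Site d → ℕ) :=
  ((I (x, s.2 x)).applyAt x s.1, Function.update s.2 x (s.2 x + 1))

/-- A finite sequence of topplings is legal if each site is unstable, that is, holds at least one
active particle, at the moment when it is toppled. -/
def Legal (I : InstrField d) : Config d × (Site d → ℕ) → List (Site d) → Prop
  | _, [] => True
  | s, x :: α => 1 ≤ (s.1 x).activeCount ∧ Legal I (topple I x s) α

/-- The odometer `m_{V,η}(x)` of `η` in the finite set `V`: the supremum, over the toppling
sequences contained in `V` that are legal for `η`, of the number of topplings at `x`. -/
def odometerIn (I : InstrField d) (V : Finset (Site d)) (η : Config d) (x : Site d) : ℕ∞ :=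
  ⨆ (α : List (Site d)) (_ : Legal I (η, fun _ => 0) α) (_ : ∀ y ∈ α, y ∈ V),
    ((α.count x : ℕ) : ℕ∞)

/-- The odometer `m_η(x)`, the increasing limit of `m_{V,η}(x)` as `V ↑ ℤ^d`. -/
def odometer (I : InstrField d) (η : Config d) (x : Site d) : ℕ∞ :=
  ⨆ V : Finset (Site d), odometerIn I V η x

/-- The weights of the instructions: sleep with probability `lam / (1 + lam)`, and jump by `z` with
probability `p z / (1 + lam)`. -/
def instrWeight (lam : ℝ≥0) (p : PMF (Site d)) : Instr d → ℝ≥0∞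
  | .sleep => (lam : ℝ≥0∞) / (1 + lam)
  | .jump z => p z / (1 + lam)

theorem tsum_instrWeight (lam : ℝ≥0) (p : PMF (Site d)) : ∑' i, instrWeight lam p i = 1 := by
  let e : Unit ⊕ Site d ≃ Instr d :=
    { toFun := fun o => o.elim (fun _ => Instr.sleep) Instr.jump
      invFun := fun i => match i with
        | .sleep => Sum.inl ()
        | .jump z => Sum.inr z
      left_inv := by rintro (_ | _) <;> rfl
      right_inv := by rintro (_ | _) <;> rfl }
  have h0 : (1 + lam : ℝ≥0∞) ≠ 0 := by simp
  have h1 : (1 + lam : ℝ≥0∞) ≠ ⊤ := by simp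
  rw [← e.tsum_eq, Summable.tsum_sum ENNReal.summable ENNReal.summable, tsum_fintype]
  simp only [Finset.univ_unique, Finset.sum_singleton]
  have h2 : ∑' z : Site d, instrWeight lam p (e (Sum.inr z)) = 1 / (1 + lam) := by
    change ∑' z : Site d, p z / (1 + lam) = 1 / (1 + lam)
    simp_rw [div_eq_mul_inv]
    rw [ENNReal.tsum_mul_right, p.tsum_coe]
  rw [h2]
  change (lam : ℝ≥0∞) / (1 + lam) + 1 / (1 + lam) = 1
  rw [← ENNReal.add_div, add_comm, ENNReal.div_self h0 h1]

/-- The law of a single instruction. -/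
def instrPMF (lam : ℝ≥0) (p : PMF (Site d)) : PMF (Instr d) :=
  ⟨instrWeight lam p, ENNReal.summable.hasSum_iff.2 (tsum_instrWeight lam p)⟩

/-- The site-wise measure `ℙ^ν`: the initial configuration has law `ν`, the instructions are
i.i.d., and the two are independent. -/
def sitewise (lam : ℝ≥0) (p : PMF (Site d)) (ν : MeasureTheory.Measure (Config d)) :
    MeasureTheory.Measure (Config d × InstrField d) :=
  ν.prod (MeasureTheory.Measure.infinitePi fun _ : Site d × ℕ => (instrPMF lam p).toMeasure)

/-! ### The continuous-time process -/

/-- The generator of the dynamics. At each site `x`, at rate `lam` per active particle, a particle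
tries to fall asleep, and at rate `p z` per active particle, a particle jumps from `x` to `x + z`.
It is only used at configurations with finitely many particles, where the sum over `x` is finite. -/
def generator (lam : ℝ≥0) (p : PMF (Site d)) (f : Config d → ℝ) (ξ : Config d) : ℝ :=
  ∑' x : Site d, ((ξ x).activeCount : ℝ) *
    ((lam : ℝ) * (f (sleepAt x ξ) - f ξ) +
      ∑' z : Site d, (p z).toReal * (f (jumpAt x z ξ) - f ξ))

/-- The transition semigroup `e^{tL}` of the continuous-time Markov chain with generator `L` on
the countable set of configurations with finitely many particles: `semigroup lam p t f ξ` is the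
expectation of `f (ξ_t)` for the evolution started from `ξ`. As the number of particles is
preserved, the jump rates along an evolution are bounded and the exponential series converges
absolutely for bounded `f`. -/
def semigroup (lam : ℝ≥0) (p : PMF (Site d)) (t : ℝ≥0) (f : Config d → ℝ) (ξ : Config d) : ℝ :=
  ∑' k : ℕ, (t : ℝ) ^ k / (k.factorial : ℝ) * ((generator lam p)^[k] f) ξ

/-- Finite-dimensional distributions of the evolution started from a configuration with finitely
many particles: for the list `(s₁, A₁), (s₂, A₂), …`, the probability that the configuration is
in `A₁` at time `s₁`, in `A₂` at time `s₁ + s₂`, and so on. -/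
def finiteProb (lam : ℝ≥0) (p : PMF (Site d)) : List (ℝ≥0 × Set (Config d)) → Config d → ℝ
  | [] => fun _ => 1
  | e :: l => semigroup lam p e.1 (e.2.indicator (finiteProb lam p l))

/-- The truncation `η · 𝟙_V`. -/
def truncate (V : Finset (Site d)) (η : Config d) : Config d :=
  fun x => if x ∈ V then η x else Occ.active 0

/-- A set of configurations is local if it only depends on finitely many sites. -/
def IsLocal (A : Set (Config d)) : Prop :=
  ∃ B : Finset (Site d), DependsOn (fun ξ : Config d => ξ ∈ A) (B : Set (Site d))

/-- The path `γ`, from time `t` on, is in `A₁` at time `t + s₁`, in `A₂` at time `t + s₁ + s₂`, and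
so on, where `(s₁, A₁), (s₂, A₂), …` is the given list. -/
def Follows (γ : ℝ≥0 → Config d) : ℝ≥0 → List (ℝ≥0 × Set (Config d)) → Prop
  | _, [] => True
  | t, e :: l => γ (t + e.1) ∈ e.2 ∧ Follows γ (t + e.1) l

/-- `(η_t)_{t ≥ 0}` is an activated random walk process on `ℤ^d` with sleep rate `lam`, jump
distribution `p` and initial law `ν`, under the probability measure `P`: it has right-continuous
paths, and its law is the limit, as `V ↑ ℤ^d`, of the laws of the processes started from the
truncations `η₀ · 𝟙_V` of a configuration `η₀` with law `ν`. (Here `Occ` is discrete.) -/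
structure IsProcess {Ω : Type*} [MeasurableSpace Ω] (lam : ℝ≥0) (p : PMF (Site d))
    (ν : MeasureTheory.Measure (Config d)) (P : MeasureTheory.Measure Ω)
    (η : ℝ≥0 → Ω → Config d) : Prop where
  measurable : ∀ t, Measurable (η t)
  rightCont : ∀ᵐ ω ∂P, ∀ (x : Site d) (t : ℝ≥0), ∀ᶠ s in nhdsWithin t (Set.Ioi t),
    η s ω x = η t ω x
  initial : P.map (η 0) = ν
  approx : ∀ l : List (ℝ≥0 × Set (Config d)), (∀ e ∈ l, IsLocal e.2) →
    Filter.Tendsto (fun V : Finset (Site d) => ∫ ξ, finiteProb lam p l (truncate V ξ) ∂ν)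
      Filter.atTop (nhds (P.real {ω | Follows (fun t => η t ω) 0 l}))

/-- The path `γ` fixates if each site is eventually stable. -/
def Fixates (γ : ℝ≥0 → Config d) : Prop :=
  ∀ x : Site d, ∃ T : ℝ≥0, ∀ t ≥ T, (γ t x).Stable

end ARW

end

/-! The continuous-time process and the site-wise representation are built on one probability space,
where both use the same stacks of instructions. The state reached when each site `x` has used its
first `h x` instructions is given by a closed formula, `cfg η I h`, in which all particles sent to
`x` arrive before the instructions of `x` are used. For a legal `h` nothing is lost by this
reordering, because an arrival commutes with an instruction used at an unstable site
(`Instr.own_addOne`). This is the abelian property (`cfg_add`, `LegalSeq.foldl_eq`). Combined with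
monotonicity in the state and in the neighbours' odometers (`rank_cfg_mono`), it yields every
comparison between odometers that is needed.

Existence. Time is cut into steps of length `2⁻ⁿ`; in each step a site topples once if one of the
clocks attached to its active particles rings. The clocks of level `n + 1` are obtained by splitting
the rings of level `n`, so that odometers increase with `n` (`chain_le_of_refines`); their supremum
is `height`. From a configuration with at most `N` particles, one step acts on functions as `1 + ε L
+ O(ε²)`, with `L` the generator, hence the chains converge to the semigroup `e^{tL}`
(`norm_stepOp_sub_le`, `tendsto_pow_exp`). In infinite volume a first-moment bound keeps `height`
finite (`ae_height_lt_top`), and since each level has finite range, `height` is the limit of its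
truncated versions. The right-continuous version `procAt` is therefore an ARW. Any other ARW has the
same finite-dimensional distributions, and fixation is visible at rational times, so it suffices to
study `procAt`.

Fixation. Almost surely the limit of `height` as time tends to infinity is the site-wise odometer:
no chain topples more than legal sequences can (`chain_le_odometer`), and since the clocks ring
forever no site stays unstable without toppling (`odometer_le_total`). Finiteness of the odometer at
one site is almost surely the same as finiteness at all sites (`ae_odometer_eq_top_iff`). If it is
finite, the configuration near each site is eventually frozen and stable. If it is infinite, the
origin topples at arbitrarily late times; a stable site topples within time `δ` only with
probability `O(δ²)`, as it must first be reached by a particle, so by a fine time grid the origin is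
also observed unstable at late times (`measure_stable_grid`).

Zero-one law. The law `ν` is only ergodic, but the instructions are independent. The conditional
probability of an invariant event given `η` is a constant `c` by ergodicity, and independence of
instructions at distant sites gives `c ≤ c²` (`sitewise_zero_one`). -/

noncomputable section

namespace ARW

variable {d : ℕ}

/-! ### The states of a single site: order and particle counts. -/

namespace Occ

/-- The position of a site state in the chain `0 < 𝔰 < 1 < 2 < ⋯`. -/
def rank : Occ → ℕ
  | active 0 => 0
  | sleeping => 1
  | active (n + 1) => n + 2

theorem activeCount_mono {o o' : Occ} (h : o.rank ≤ o'.rank) : o.activeCount ≤ o'.activeCount := by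
  rcases o with (_ | n) | _ <;> rcases o' with (_ | m) | _ <;> simp [rank, activeCount] at * <;> omega

/-- The place of `sleeping` between `active 0` and `active 1` is compatible with arrivals, since an
arrival turns both `sleeping` and `active 1` into `active 2`. -/
theorem rank_addOne_mono {o o' : Occ} (h : o.rank ≤ o'.rank) :
    o.addOne.rank ≤ o'.addOne.rank := by
  rcases o with (_ | n) | _ <;> rcases o' with (_ | m) | _ <;> simp [rank, addOne] at * <;> omega

theorem rank_le_addOne (o : Occ) : o.rank ≤ o.addOne.rank := by
  rcases o with (_ | n) | _ <;> simp [rank, addOne]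

theorem rank_addOne_iterate_mono {o o' : Occ} (h : o.rank ≤ o'.rank) {k k' : ℕ} (hk : k ≤ k') :
    (addOne^[k] o).rank ≤ (addOne^[k'] o').rank := by
  induction hk with
  | refl =>
    induction k with
    | zero => simpa using h
    | succ k ih =>
      rw [Function.iterate_succ_apply', Function.iterate_succ_apply']
      exact rank_addOne_mono ih
  | step _ ih =>
    rw [Function.iterate_succ_apply']
    exact ih.trans (rank_le_addOne _)

theorem activeCount_le_count (o : Occ) : o.activeCount ≤ o.count := by
  cases o <;> simp [activeCount, count]

@[simp] theorem count_addOne (o : Occ) : o.addOne.count = o.count + 1 := by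
  cases o <;> simp [addOne, count]

@[simp] theorem count_addOne_iterate (o : Occ) (k : ℕ) :
    (addOne^[k] o).count = o.count + k := by
  induction k with
  | zero => simp
  | succ k ih => rw [Function.iterate_succ_apply', count_addOne, ih]; omega

theorem stable_iff_activeCount (o : Occ) : o.Stable ↔ o.activeCount = 0 := by
  rcases o with (_ | n) | _ <;> simp [Stable, activeCount]

/-- The first arrival may wake up a sleeper and thus count twice, whence the factor `2`; with no
arrival there is no active particle. -/
theorem activeCount_addOne_iterate_le {o : Occ} (h : o.Stable) (k : ℕ) :
    (addOne^[k] o).activeCount ≤ 2 * k := by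
  have hc : o.count ≤ 1 := by rcases h with rfl | rfl <;> simp [count]
  rcases k with _ | k
  · simpa using (stable_iff_activeCount o).1 h
  · refine (activeCount_le_count _).trans ?_
    rw [count_addOne_iterate]
    omega

theorem rank_active_zero_le (o : Occ) : (active 0).rank ≤ o.rank := by simp [rank]

theorem two_le_count_activeCount {o : Occ} (h : 2 ≤ o.count) : 1 ≤ o.activeCount := by
  cases o <;> simp [activeCount, count] at * <;> omega

end Occ

/-! ### A single site and its stack of instructions. -/

open Occ

/-- The effect of an instruction at `x` on the state of `x` itself. -/
def Instr.own : Instr d → Occ → Occ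
  | .sleep => trySleep
  | .jump _ => subOne

/-- The local form of the abelian property. The critical case is one active particle and a sleep
instruction: the particle falls asleep and is woken by the arrival, or it sees the arrival and stays
awake; both orders end in `active 2`. -/
theorem Instr.own_addOne (i : Instr d) {o : Occ} (h : 1 ≤ o.activeCount) :
    i.own o.addOne = (i.own o).addOne := by
  rcases i with _ | z <;> rcases o with (_ | _ | n) | _ <;>
    simp [Instr.own, addOne, subOne, trySleep, activeCount] at *

theorem Instr.own_mono (i : Instr d) {o o' : Occ} (h : 1 ≤ o.activeCount)
    (hr : o.rank ≤ o'.rank) : (i.own o).rank ≤ (i.own o').rank := by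
  rcases i with _ | z <;> rcases o with (_ | _ | n) | _ <;> rcases o' with (_ | _ | m) | _ <;>
    simp [Instr.own, subOne, trySleep, activeCount, rank] at * <;> omega

theorem Instr.count_own_le (i : Instr d) (o : Occ) : (i.own o).count ≤ o.count := by
  rcases i with _ | z <;> rcases o with (_ | _ | n) | _ <;>
    simp [Instr.own, subOne, trySleep, count]

theorem Instr.count_le_count_own (i : Instr d) (o : Occ) : o.count ≤ (i.own o).count + 1 := by
  rcases i with _ | z <;> rcases o with (_ | _ | n) | _ <;>
    simp [Instr.own, subOne, trySleep, count]

/-- Apply the first instructions of the stack `s` to the state `o` of its own site. -/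
def run (o : Occ) (s : ℕ → Instr d) : ℕ → Occ
  | 0 => o
  | k + 1 => (s k).own (run o s k)

theorem run_add (o : Occ) (s : ℕ → Instr d) (k l : ℕ) :
    run o s (k + l) = run (run o s k) (fun j => s (k + j)) l := by
  induction l with
  | zero => rfl
  | succ l ih => rw [← add_assoc, run, run, ih]

theorem run_congr {o : Occ} {s s' : ℕ → Instr d} {k : ℕ} (h : ∀ j < k, s j = s' j) :
    run o s k = run o s' k := by
  induction k with
  | zero => rfl
  | succ k ih => rw [run, run, ih fun j hj => h j (by omega), h k (by omega)]

/-- The first `k` instructions of `s` are used at an unstable site when started from `o`. -/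
def RunLegal (o : Occ) (s : ℕ → Instr d) (k : ℕ) : Prop :=
  ∀ j < k, 1 ≤ (run o s j).activeCount

theorem run_addOne {o : Occ} {s : ℕ → Instr d} {k : ℕ} (h : RunLegal o s k) :
    run o.addOne s k = (run o s k).addOne := by
  induction k with
  | zero => rfl
  | succ k ih =>
    rw [run, run, ih fun j hj => h j (by omega), Instr.own_addOne _ (h k (by omega))]

theorem run_mono {o o' : Occ} {s : ℕ → Instr d} {k : ℕ} (h : RunLegal o s k)
    (hr : o.rank ≤ o'.rank) : (run o s k).rank ≤ (run o' s k).rank := by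
  induction k with
  | zero => exact hr
  | succ k ih => exact Instr.own_mono _ (h k (by omega)) (ih fun j hj => h j (by omega))

theorem RunLegal.mono {o o' : Occ} {s : ℕ → Instr d} {k : ℕ} (h : RunLegal o s k)
    (hr : o.rank ≤ o'.rank) : RunLegal o' s k := fun j hj =>
  (h j hj).trans (activeCount_mono (run_mono (fun i hi => h i (hi.trans hj)) hr))

theorem run_addOne_iterate {o : Occ} {s : ℕ → Instr d} {k : ℕ} (h : RunLegal o s k) (n : ℕ) :
    run (addOne^[n] o) s k = addOne^[n] (run o s k) := by
  induction n with
  | zero => rfl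
  | succ n ih =>
    rw [Function.iterate_succ_apply', Function.iterate_succ_apply', run_addOne, ih]
    exact h.mono (rank_addOne_iterate_mono (k := 0) le_rfl (Nat.zero_le n))

theorem count_run_le (o : Occ) (s : ℕ → Instr d) (k : ℕ) : (run o s k).count ≤ o.count := by
  induction k with
  | zero => rfl
  | succ k ih => exact (Instr.count_own_le _ _).trans ih

theorem count_le_count_run (o : Occ) (s : ℕ → Instr d) (k : ℕ) :
    o.count ≤ (run o s k).count + k := by
  induction k with
  | zero => rfl
  | succ k ih =>
    have := Instr.count_le_count_own (s k) (run o s k)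
    rw [run]
    omega

/-! ### Odometer fields and the abelian property. -/

/-- The set `{±e₁, …, ±e_d}` as a finset. -/
def nbs (d : ℕ) : Finset (Site d) :=
  (Finset.univ.image fun i : Fin d => (Pi.single i 1 : Site d)) ∪
    Finset.univ.image fun i : Fin d => (Pi.single i (-1) : Site d)

theorem mem_nbs {z : Site d} : z ∈ nbs d ↔ z ∈ neighbors d := by
  simp only [nbs, neighbors, Finset.mem_union, Finset.mem_image, Finset.mem_univ, true_and,
    Set.mem_ofPred_eq, exists_or, eq_comm]

theorem ne_zero_of_mem_nbs {z : Site d} (hz : z ∈ nbs d) : z ≠ 0 := by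
  obtain ⟨i, rfl | rfl⟩ := mem_nbs.1 hz <;> simp

/-- All instructions are sleep instructions or jumps to a nearest neighbour. -/
def NbField (I : InstrField d) : Prop := ∀ q z, I q = .jump z → z ∈ nbs d

instance : DecidableEq (Instr d) := Classical.decEq _

/-- The number of particles sent from nearest neighbours to `x` when the odometer is `h`. -/
def arrivals (I : InstrField d) (h : Site d → ℕ) (x : Site d) : ℕ :=
  ∑ z ∈ nbs d, Nat.count (fun j => I (x - z, j) = .jump z) (h (x - z))

theorem arrivals_mono (I : InstrField d) {h h' : Site d → ℕ} (x : Site d)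
    (hh : ∀ z ∈ nbs d, h (x - z) ≤ h' (x - z)) : arrivals I h x ≤ arrivals I h' x :=
  Finset.sum_le_sum fun z hz => Nat.count_monotone _ (hh z hz)

theorem arrivals_congr (I : InstrField d) {h h' : Site d → ℕ} (x : Site d)
    (hh : ∀ z ∈ nbs d, h (x - z) = h' (x - z)) : arrivals I h x = arrivals I h' x :=
  Finset.sum_congr rfl fun z hz => by rw [hh z hz]

@[simp] theorem arrivals_zero (I : InstrField d) (x : Site d) : arrivals I 0 x = 0 := by
  simp [arrivals]

/-- The field of instructions that remain when the odometer is `h`. -/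
def shiftField (I : InstrField d) (h : Site d → ℕ) : InstrField d := fun q => I (q.1, h q.1 + q.2)

theorem arrivals_add (I : InstrField d) (h h' : Site d → ℕ) (x : Site d) :
    arrivals I (h + h') x = arrivals I h x + arrivals (shiftField I h) h' x := by
  simp only [arrivals, Pi.add_apply, Nat.count_add, Finset.sum_add_distrib, shiftField]
  congr!

theorem arrivals_add_le (I : InstrField d) (h h' : Site d → ℕ) (x : Site d) :
    arrivals I (h + h') x ≤ arrivals I h x + ∑ z ∈ nbs d, h' (x - z) := by
  rw [arrivals_add]
  exact Nat.add_le_add_left (Finset.sum_le_sum fun z _ => Nat.count_le _) _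

/-- The state of the site after the arrival of all particles that are sent to it, before its own
instructions are used. -/
def loaded (η : Config d) (I : InstrField d) (h : Site d → ℕ) (x : Site d) : Occ :=
  addOne^[arrivals I h x] (η x)

/-- The configuration obtained from `η` when each site `x` has used its first `h x` instructions. -/
def cfg (η : Config d) (I : InstrField d) (h : Site d → ℕ) : Config d := fun x =>
  run (loaded η I h x) (fun j => I (x, j)) (h x)

/-- The odometer `h` is legal at `x`. -/
def LegalAt (η : Config d) (I : InstrField d) (h : Site d → ℕ) (x : Site d) : Prop :=
  RunLegal (loaded η I h x) (fun j => I (x, j)) (h x)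

@[simp] theorem cfg_zero (η : Config d) (I : InstrField d) : cfg η I 0 = η := by
  ext x
  simp [cfg, loaded, run]

theorem cfg_congr {η : Config d} {I : InstrField d} {h h' : Site d → ℕ} {x : Site d}
    (hx : h x = h' x) (hh : ∀ z ∈ nbs d, h (x - z) = h' (x - z)) :
    cfg η I h x = cfg η I h' x := by
  rw [cfg, cfg, loaded, loaded, arrivals_congr I x hh, hx]

theorem cfg_congr_left {η η' : Config d} {I : InstrField d} {h : Site d → ℕ} {x : Site d}
    (hx : η x = η' x) : cfg η I h x = cfg η' I h x := by
  rw [cfg, cfg, loaded, loaded, hx]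

theorem loaded_add (η : Config d) (I : InstrField d) (h h' : Site d → ℕ) (x : Site d) :
    loaded η I (h + h') x = addOne^[arrivals (shiftField I h) h' x] (loaded η I h x) := by
  rw [loaded, arrivals_add, add_comm, Function.iterate_add_apply]
  rfl

theorem rank_loaded_mono {η η' : Config d} {I : InstrField d} {h h' : Site d → ℕ} {x : Site d}
    (hη : (η x).rank ≤ (η' x).rank) (hh : ∀ z ∈ nbs d, h (x - z) ≤ h' (x - z)) :
    (loaded η I h x).rank ≤ (loaded η' I h' x).rank :=
  rank_addOne_iterate_mono hη (arrivals_mono I x hh)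

/-- The particles sent by `h'` can be made to arrive after the first `h x` instructions of `x`,
because these are legal without them and so commute with arrivals (`run_addOne_iterate`). -/
theorem run_loaded_add {η : Config d} {I : InstrField d} {h : Site d → ℕ} {x : Site d}
    (hl : LegalAt η I h x) (h' : Site d → ℕ) (k : ℕ) :
    run (loaded η I (h + h') x) (fun j => I (x, j)) (h x + k) =
      run (loaded (cfg η I h) (shiftField I h) h' x) (fun j => shiftField I h (x, j)) k := by
  rw [run_add, loaded_add, run_addOne_iterate hl]
  rfl

/-- The abelian property: topplings can be performed in two batches, the second one starting afresh
from the new configuration and the unused instructions. -/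
theorem cfg_add {η : Config d} {I : InstrField d} {h : Site d → ℕ}
    (hl : ∀ x, LegalAt η I h x) (h' : Site d → ℕ) :
    cfg η I (h + h') = cfg (cfg η I h) (shiftField I h) h' :=
  funext fun x => run_loaded_add (hl x) h' (h' x)

theorem LegalAt.add {η : Config d} {I : InstrField d} {h h' : Site d → ℕ} {x : Site d}
    (hl : LegalAt η I h x) (hl' : LegalAt (cfg η I h) (shiftField I h) h' x) :
    LegalAt η I (h + h') x := by
  intro j hj
  rcases lt_or_ge j (h x) with hjx | hjx
  · refine RunLegal.mono hl ?_ j hjx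
    rw [loaded_add]
    exact rank_addOne_iterate_mono (k := 0) le_rfl (Nat.zero_le _)
  · obtain ⟨k, rfl⟩ := Nat.exists_eq_add_of_le hjx
    rw [run_loaded_add hl]
    exact hl' k (by simpa using hj)

theorem legalAt_zero (η : Config d) (I : InstrField d) (x : Site d) : LegalAt η I 0 x :=
  fun j hj => absurd hj (Nat.not_lt_zero j)

/-- A site that is already active may be toppled once, whatever the other sites do, since arrivals
can only raise its state. -/
theorem legalAt_of_le_one {η : Config d} {I : InstrField d} {h : Site d → ℕ} {x : Site d}
    (h1 : h x ≤ 1) (ha : h x = 1 → 1 ≤ (η x).activeCount) : LegalAt η I h x := by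
  intro j hj
  obtain rfl : j = 0 := by omega
  exact (ha (by omega)).trans
    (activeCount_mono (rank_addOne_iterate_mono (k := 0) le_rfl (Nat.zero_le _)))

/-- The engine of all comparisons: at equal own odometers, more topplings at the neighbours bring
more arrivals, and a legal run of the same instructions preserves the order. -/
theorem rank_cfg_mono {η η' : Config d} {I : InstrField d} {h h' : Site d → ℕ} {x : Site d}
    (hl : LegalAt η I h x) (hη : (η x).rank ≤ (η' x).rank) (hx : h x = h' x)
    (hh : ∀ z ∈ nbs d, h (x - z) ≤ h' (x - z)) :
    (cfg η I h x).rank ≤ (cfg η' I h' x).rank := by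
  rw [cfg, cfg, ← hx]
  exact run_mono hl (rank_loaded_mono hη hh)

/-- The instructions of `x` never create particles at `x`, and each toppling of a neighbour sends at
most one. -/
theorem count_cfg_add_le {η : Config d} {I : InstrField d} {h : Site d → ℕ}
    (hl : ∀ x, LegalAt η I h x) (h' : Site d → ℕ) (x : Site d) :
    (cfg η I (h + h') x).count ≤ (cfg η I h x).count + ∑ z ∈ nbs d, h' (x - z) := by
  rw [cfg_add hl]
  refine (count_run_le _ _ _).trans ?_
  rw [loaded, count_addOne_iterate]
  have := arrivals_add_le (shiftField I h) 0 h' x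
  simp only [zero_add, arrivals_zero] at this
  omega

/-! ### The discrete chains -/

/-- A site in state `o` topples if one of the first `o.activeCount` clocks rings. -/
def Rings (o : Occ) (b : ℕ → Bool) : Prop := ∃ m < o.activeCount, b m = true

/-- The clocks: `B (x, m, i)` tells whether the clock number `m` at `x` rings in the time step
number `i`. -/
abbrev Clocks (d : ℕ) : Type := Site d × ℕ × ℕ → Bool

theorem Rings.mono {o o' : Occ} {b : ℕ → Bool} (h : Rings o b) (ho : o.rank ≤ o'.rank) :
    Rings o' b := by
  obtain ⟨m, hm, hb⟩ := h
  exact ⟨m, hm.trans_le (activeCount_mono ho), hb⟩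

theorem Rings.active {o : Occ} {b : ℕ → Bool} (h : Rings o b) : 1 ≤ o.activeCount := by
  obtain ⟨m, hm, -⟩ := h
  omega

open Classical in
/-- The set of sites that topple in the configuration `ξ`, as an indicator. -/
def ringing (ξ : Config d) (b : Site d × ℕ → Bool) (x : Site d) : ℕ :=
  if Rings (ξ x) (fun m => b (x, m)) then 1 else 0

theorem ringing_le_one (ξ : Config d) (b : Site d × ℕ → Bool) (x : Site d) :
    ringing ξ b x ≤ 1 := by
  rw [ringing]; split_ifs <;> simp

theorem ringing_eq_one {ξ : Config d} {b : Site d × ℕ → Bool} {x : Site d} :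
    ringing ξ b x = 1 ↔ Rings (ξ x) (fun m => b (x, m)) := by
  rw [ringing]; split_ifs with h <;> simp [h]

theorem ringing_eq_zero {ξ : Config d} {b : Site d × ℕ → Bool} {x : Site d} :
    ringing ξ b x = 0 ↔ ¬ Rings (ξ x) (fun m => b (x, m)) := by
  rw [ringing]; split_ifs with h <;> simp [h]

/-- The odometer of the discrete parallel dynamics driven by the clocks `B`. -/
def chain (η : Config d) (I : InstrField d) (B : Clocks d) : ℕ → Site d → ℕ
  | 0 => 0
  | i + 1 => chain η I B i + ringing (cfg η I (chain η I B i)) (fun c => B (c.1, c.2, i))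

theorem legalAt_ringing (ξ : Config d) (I : InstrField d) (b : Site d × ℕ → Bool) (x : Site d) :
    LegalAt ξ I (ringing ξ b) x :=
  legalAt_of_le_one (ringing_le_one ξ b x) fun h => (ringing_eq_one.1 h).active

theorem legalAt_chain (η : Config d) (I : InstrField d) (B : Clocks d) (i : ℕ) (x : Site d) :
    LegalAt η I (chain η I B i) x := by
  induction i with
  | zero => exact legalAt_zero η I x
  | succ i ih => exact ih.add (legalAt_ringing _ _ _ _)

theorem chain_mono_step (η : Config d) (I : InstrField d) (B : Clocks d) (x : Site d) :
    Monotone fun i => chain η I B i x :=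
  monotone_nat_of_le_succ fun i => by rw [chain]; simp

theorem chain_add (η : Config d) (I : InstrField d) (B : Clocks d) (k i : ℕ) :
    chain η I B (k + i) = chain η I B k +
      chain (cfg η I (chain η I B k)) (shiftField I (chain η I B k))
        (fun c => B (c.1, c.2.1, k + c.2.2)) i := by
  induction i with
  | zero => simp [chain]
  | succ i ih =>
    rw [← add_assoc, chain, ih, chain, ← cfg_add (legalAt_chain η I B k), add_assoc]

/-- In one step a site topples at most once, so the order can only be broken where the two odometers
agree. There the larger system has the higher state (`rank_cfg_mono`), so it topples whenever the
smaller one does. -/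
theorem chain_mono_init {η η' : Config d} (hη : ∀ x, (η x).rank ≤ (η' x).rank)
    (I : InstrField d) (B : Clocks d) (i : ℕ) (x : Site d) :
    chain η I B i x ≤ chain η' I B i x := by
  induction i generalizing x with
  | zero => simp [chain]
  | succ i ih =>
    rw [chain, chain, Pi.add_apply, Pi.add_apply]
    rcases (ih x).lt_or_eq with h | h
    · have := ringing_le_one (cfg η I (chain η I B i)) (fun c => B (c.1, c.2, i)) x
      omega
    · rw [h]
      refine Nat.add_le_add_left ?_ _
      by_cases hr : ringing (cfg η I (chain η I B i)) (fun c => B (c.1, c.2, i)) x = 0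
      · omega
      · have h1 := ringing_eq_one.1
          ((ringing_le_one _ _ x).antisymm (Nat.one_le_iff_ne_zero.2 hr))
        exact (ringing_le_one _ _ _).trans (ringing_eq_one.2 (h1.mono
          (rank_cfg_mono (legalAt_chain _ _ _ _ _) (hη x) h fun z _ => ih _))).ge

/-- The clocks `B'` refine the clocks `B`, each time step being split into two. -/
def Refines (B' B : Clocks d) : Prop :=
  ∀ x m i, B (x, m, i) = (B' (x, m, 2 * i) || B' (x, m, 2 * i + 1))

theorem chain_succ_eq {η : Config d} {I : InstrField d} {B : Clocks d} {i : ℕ} {x : Site d}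
    (h : Rings (cfg η I (chain η I B i) x) fun m => B (x, m, i)) :
    chain η I B (i + 1) x = chain η I B i x + 1 := by
  rw [chain, Pi.add_apply, ringing_eq_one.2 h]

theorem chain_succ_le (η : Config d) (I : InstrField d) (B : Clocks d) (i : ℕ) (x : Site d) :
    chain η I B (i + 1) x ≤ chain η I B i x + 1 :=
  Nat.add_le_add_left (ringing_le_one _ _ _) _

theorem rings_of_chain_lt {η : Config d} {I : InstrField d} {B : Clocks d} {i : ℕ} {x : Site d}
    (h : chain η I B i x < chain η I B (i + 1) x) :
    Rings (cfg η I (chain η I B i) x) fun m => B (x, m, i) := by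
  refine (ringing_eq_one (b := fun c => B (c.1, c.2, i))).1
    ((ringing_le_one _ _ _).antisymm (Nat.one_le_iff_ne_zero.2 fun h0 => ?_))
  rw [chain, Pi.add_apply, h0] at h
  exact lt_irrefl _ h

/-- The finer chain can be overtaken at `x` only if the odometers agree before the step and the fine
one does not move in either half. But the clock that makes the coarse chain topple rings in one of
the halves, and there the fine chain has at least as many active particles at `x`. -/
theorem chain_le_of_refines {B B' : Clocks d} (hB : Refines B' B) (η : Config d)
    (I : InstrField d) (i : ℕ) (x : Site d) :
    chain η I B i x ≤ chain η I B' (2 * i) x := by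
  induction i generalizing x with
  | zero => simp [chain]
  | succ i ih =>
    have hm1 : ∀ y, chain η I B' (2 * i) y ≤ chain η I B' (2 * i + 1) y := fun y =>
      chain_mono_step η I B' y (Nat.le_succ _)
    have hm2 : chain η I B' (2 * i + 1) x ≤ chain η I B' (2 * i + 1 + 1) x :=
      chain_mono_step η I B' x (Nat.le_succ (2 * i + 1))
    rw [show 2 * (i + 1) = 2 * i + 1 + 1 by ring]
    by_contra! hlt
    have hi := ih x
    have h1 := hm1 x
    have h2 := chain_succ_le η I B i x
    have h3 : chain η I B i x < chain η I B (i + 1) x := by omega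
    obtain ⟨m, hm, hb⟩ := rings_of_chain_lt h3
    simp only [hB x m i, Bool.or_eq_true] at hb
    rcases hb with hb | hb
    · have := chain_succ_eq (η := η) (I := I) (B := B') (i := 2 * i) (x := x)
        ⟨m, hm.trans_le (activeCount_mono (rank_cfg_mono (legalAt_chain _ _ _ _ _) le_rfl
          (by omega) fun z _ => ih _)), hb⟩
      omega
    · have := chain_succ_eq (η := η) (I := I) (B := B') (i := 2 * i + 1) (x := x)
        ⟨m, hm.trans_le (activeCount_mono (rank_cfg_mono (legalAt_chain _ _ _ _ _) le_rfl
          (by omega) fun z _ => (ih _).trans (hm1 _))), hb⟩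
      omega

/-- Information travels one lattice step per time step. The finite set is uniform in the
instructions and clocks, which is what passing to infinite volume requires. -/
theorem exists_finset_chain_congr (i : ℕ) (x : Site d) : ∃ F : Finset (Site d),
    ∀ (η η' : Config d) (I : InstrField d) (B : Clocks d), (∀ y ∈ F, η y = η' y) →
      chain η I B i x = chain η' I B i x := by
  induction i generalizing x with
  | zero => exact ⟨∅, fun _ _ _ _ _ => rfl⟩
  | succ i ih =>
    choose F hF using ih
    refine ⟨{x} ∪ F x ∪ (nbs d).biUnion fun z => F (x - z), fun η η' I B h => ?_⟩
    simp only [Finset.mem_union, Finset.mem_singleton, Finset.mem_biUnion] at h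
    have h1 : chain η I B i x = chain η' I B i x :=
      hF x η η' I B fun y hy => h y (.inl (.inr hy))
    have h2 : cfg η I (chain η I B i) x = cfg η' I (chain η' I B i) x :=
      (cfg_congr h1 fun z hz => hF _ η η' I B fun y hy => h y (.inr ⟨z, hz, hy⟩)).trans
        (cfg_congr_left (h x (.inl (.inl rfl))))
    rw [chain, chain, Pi.add_apply, Pi.add_apply, h1, ringing, ringing, h2]

/-- The chain at step `i` depends only on the clocks in the steps before `i`. -/
theorem chain_congr_clocks {B B' : Clocks d} {i : ℕ}
    (h : ∀ x m, ∀ k < i, B (x, m, k) = B' (x, m, k)) (η : Config d) (I : InstrField d) :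
    chain η I B i = chain η I B' i := by
  induction i with
  | zero => rfl
  | succ i ih =>
    have hb : (fun c : Site d × ℕ => B (c.1, c.2, i)) = fun c => B' (c.1, c.2, i) :=
      funext fun c => h _ _ i (by omega)
    rw [chain, chain, ih fun x m k hk => h x m k (by omega), hb]

/-! ### Legal sequences and odometers -/

theorem arrivals_single (I : InstrField d) (x y : Site d) :
    arrivals I (Pi.single x 1) y = if y - x ∈ nbs d ∧ I (x, 0) = .jump (y - x) then 1 else 0 := by
  have h : ∀ z ∈ nbs d, Nat.count (fun j => I (y - z, j) = .jump z)
      ((Pi.single x 1 : Site d → ℕ) (y - z)) =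
      if z = y - x then (if I (x, 0) = .jump (y - x) then 1 else 0) else 0 := by
    intro z _
    by_cases hz : z = y - x
    · subst hz
      simp [Nat.count_succ]
    · rw [if_neg hz, Pi.single_eq_of_ne (fun h => hz (by rw [← h]; abel)), Nat.count_zero]
  rw [arrivals, Finset.sum_congr rfl h, Finset.sum_ite_eq']
  split_ifs <;> simp_all

/-- Links the closed formula to the transitions that define the model. Jumps must be to nearest
neighbours, as `arrivals` counts no others; in particular no particle jumps to its own site. -/
theorem cfg_single {ξ : Config d} {I : InstrField d} {x : Site d}
    (hI : ∀ z, I (x, 0) = .jump z → z ∈ nbs d) :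
    cfg ξ I (Pi.single x 1) = (I (x, 0)).applyAt x ξ := by
  ext y
  rw [cfg, loaded, arrivals_single]
  by_cases hy : y = x
  · subst hy
    have h0 : ¬ (y - y ∈ nbs d ∧ I (y, 0) = .jump (y - y)) := fun h =>
      ne_zero_of_mem_nbs h.1 (sub_self y)
    rw [if_neg h0, Function.iterate_zero, id_eq, Pi.single_eq_same, run, run]
    cases hi : I (y, 0) with
    | sleep => simp [Instr.own, Instr.applyAt, sleepAt]
    | jump z =>
      have hz := ne_zero_of_mem_nbs (hI z hi)
      simp [Instr.own, Instr.applyAt, jumpAt, hz]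
  · rw [Pi.single_eq_of_ne hy, run]
    cases hi : I (x, 0) with
    | sleep => simp [Instr.applyAt, sleepAt, Function.update_of_ne hy]
    | jump z =>
      have hz := hI z hi
      simp only [Instr.applyAt, jumpAt, Instr.jump.injEq]
      by_cases hyz : z = y - x
      · subst hyz
        simp [hz, Function.update_of_ne hy]
      · have h1 : y ≠ x + z := fun h => hyz (by rw [h]; abel)
        rw [if_neg fun h => hyz h.2, Function.update_of_ne h1, Function.update_of_ne hy]
        rfl

/-- The odometer of a sequence of topplings. -/
def cnt (α : List (Site d)) : Site d → ℕ := fun x => α.count x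

/-- The sequence `α` is legal for `η`. -/
def LegalSeq (η : Config d) (I : InstrField d) (α : List (Site d)) : Prop :=
  Legal I (η, fun _ => 0) α

theorem legal_append (I : InstrField d) (s : Config d × (Site d → ℕ)) (α β : List (Site d)) :
    Legal I s (α ++ β) ↔ Legal I s α ∧ Legal I (α.foldl (fun s x => topple I x s) s) β := by
  induction α generalizing s with
  | nil => simp [Legal]
  | cons x α ih => simp [Legal, ih, and_assoc]

theorem cnt_concat (α : List (Site d)) (x : Site d) :
    cnt (α ++ [x]) = cnt α + Pi.single x 1 := by
  ext y
  by_cases h : y = x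
  · subst h; simp [cnt]
  · simp [cnt, List.count_append, h, Ne.symm h]

theorem topple_cfg {η : Config d} {I : InstrField d} (hI : NbField I) {h : Site d → ℕ}
    (hl : ∀ x, LegalAt η I h x) (x : Site d) :
    topple I x (cfg η I h, h) = (cfg η I (h + Pi.single x 1), h + Pi.single x 1) := by
  rw [topple, cfg_add hl,
    cfg_single (ξ := cfg η I h) (I := shiftField I h) (x := x) fun z => hI (x, h x + 0) z]
  refine Prod.ext rfl ?_
  ext y
  by_cases hy : y = x
  · subst hy; simp
  · simp [hy]

/-- The order of the topplings in a legal sequence is irrelevant: the final state is a function of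
how often each site was toppled. -/
theorem LegalSeq.foldl_eq {η : Config d} {I : InstrField d} (hI : NbField I) {α : List (Site d)}
    (hα : LegalSeq η I α) : (∀ x, LegalAt η I (cnt α) x) ∧
      α.foldl (fun s x => topple I x s) (η, fun _ => 0) = (cfg η I (cnt α), cnt α) := by
  induction α using List.reverseRecOn with
  | nil =>
    have h0 : cnt ([] : List (Site d)) = 0 := by ext; simp [cnt]
    rw [h0, cfg_zero]
    exact ⟨fun x => legalAt_zero η I x, rfl⟩
  | append_singleton α x ih =>
    obtain ⟨h1, h2⟩ := (legal_append I _ α [x]).1 hα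
    obtain ⟨h3, h4⟩ := ih h1
    rw [h4] at h2
    rw [cnt_concat]
    refine ⟨fun y => (h3 y).add ?_, ?_⟩
    · by_cases hy : y = x
      · subst hy
        exact legalAt_of_le_one (by simp) fun _ => h2.1
      · exact legalAt_of_le_one (by simp [hy]) (by simp [hy])
    · rw [List.foldl_append, h4, List.foldl_cons, List.foldl_nil, topple_cfg hI h3]

theorem legalSeq_concat {η : Config d} {I : InstrField d} (hI : NbField I) {α : List (Site d)}
    {x : Site d} : LegalSeq η I (α ++ [x]) ↔
      LegalSeq η I α ∧ 1 ≤ (cfg η I (cnt α) x).activeCount := by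
  rw [LegalSeq, legal_append]
  refine and_congr_right fun h => ?_
  rw [(LegalSeq.foldl_eq hI h).2]
  simp [Legal]

theorem legalSeq_nil (η : Config d) (I : InstrField d) : LegalSeq η I [] := trivial

/-- Odometers of legal sequences are directed. The topplings of `β` are appended to `α` one at a
time, skipping those already accounted for. -/
theorem LegalSeq.exists_ge {η : Config d} {I : InstrField d} (hI : NbField I)
    {α β : List (Site d)} (hα : LegalSeq η I α) (hβ : LegalSeq η I β) :
    ∃ γ, LegalSeq η I γ ∧ cnt α ≤ cnt γ ∧ cnt β ≤ cnt γ := by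
  induction β using List.reverseRecOn with
  | nil => exact ⟨α, hα, le_rfl, fun x => by simp [cnt]⟩
  | append_singleton β x ih =>
    obtain ⟨hβ', hx⟩ := (legalSeq_concat hI).1 hβ
    obtain ⟨γ, hγ, h1, h2⟩ := ih hβ'
    rcases (h2 x).lt_or_eq with hlt | heq
    · refine ⟨γ, hγ, h1, fun y => ?_⟩
      rw [cnt_concat]
      by_cases hy : y = x
      · subst hy; simpa using hlt
      · simpa [hy] using h2 y
    -- When the odometers at `x` agree, the state of `x` after `γ` is at least the one after `β`, so
    -- the next toppling of `β` is legal after `γ` too.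
    · refine ⟨γ ++ [x], (legalSeq_concat hI).2 ⟨hγ, hx.trans (activeCount_mono ?_)⟩, ?_, ?_⟩
      · exact rank_cfg_mono ((LegalSeq.foldl_eq hI hβ').1 x) le_rfl heq fun z _ => h2 _
      · rw [cnt_concat]; exact h1.trans le_self_add
      · rw [cnt_concat, cnt_concat]; exact add_le_add_left h2 _

/-- A sequence is finite, hence contained in its own finite set of sites; the restriction to a
volume disappears in the supremum. -/
theorem odometer_le_iff {I : InstrField d} {η : Config d} {x : Site d} {b : ℕ∞} :
    odometer I η x ≤ b ↔ ∀ α, LegalSeq η I α → (cnt α x : ℕ∞) ≤ b := by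
  simp only [odometer, odometerIn, iSup_le_iff]
  exact ⟨fun h α hα => h α.toFinset α hα fun y hy => List.mem_toFinset.2 hy,
    fun h V α hα _ => h α hα⟩

theorem LegalSeq.le_odometer {I : InstrField d} {η : Config d} {α : List (Site d)}
    (hα : LegalSeq η I α) (x : Site d) : (cnt α x : ℕ∞) ≤ odometer I η x :=
  odometer_le_iff.1 le_rfl α hα

theorem exists_legalSeq_ge {I : InstrField d} {η : Config d} {x : Site d} {n : ℕ}
    (h : (n : ℕ∞) ≤ odometer I η x) : ∃ α, LegalSeq η I α ∧ n ≤ cnt α x := by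
  by_contra! hc
  rcases n with _ | n
  · exact absurd (hc [] (legalSeq_nil η I)) (Nat.not_lt_zero _)
  · have h1 : odometer I η x ≤ n := odometer_le_iff.2 fun α hα =>
      Nat.cast_le.2 (Nat.lt_succ_iff.1 (hc α hα))
    exact absurd (Nat.cast_le.1 (h.trans h1)) (by omega)

/-- By directedness, finitely many odometer values can be reached by one and the same legal
sequence. -/
theorem exists_legalSeq_ge_on {I : InstrField d} (hI : NbField I) {η : Config d}
    {h : Site d → ℕ} (F : Finset (Site d)) (hF : ∀ x ∈ F, (h x : ℕ∞) ≤ odometer I η x) :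
    ∃ α, LegalSeq η I α ∧ ∀ x ∈ F, h x ≤ cnt α x := by
  induction F using Finset.induction_on with
  | empty => exact ⟨[], legalSeq_nil η I, by simp⟩
  | insert a F _ ih =>
    obtain ⟨α, hα, h1⟩ := ih fun x hx => hF x (Finset.mem_insert_of_mem hx)
    obtain ⟨β, hβ, h2⟩ := exists_legalSeq_ge (hF a (Finset.mem_insert_self a F))
    obtain ⟨γ, hγ, h3, h4⟩ := hα.exists_ge hI hβ
    refine ⟨γ, hγ, fun x hx => ?_⟩
    rcases Finset.mem_insert.1 hx with rfl | hx
    · exact h2.trans (h4 _)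
    · exact (h1 x hx).trans (h3 x)

/-- Otherwise one more toppling at `x` would be legal and exceed the supremum. -/
theorem LegalSeq.activeCount_eq_zero {I : InstrField d} (hI : NbField I) {η : Config d}
    {α : List (Site d)} (hα : LegalSeq η I α) {x : Site d} (h : odometer I η x ≤ cnt α x) :
    (cfg η I (cnt α) x).activeCount = 0 := by
  by_contra hne
  have h1 := ((legalSeq_concat hI).2 ⟨hα, Nat.one_le_iff_ne_zero.2 hne⟩).le_odometer x
  have h2 : cnt α x + 1 ≤ cnt α x := by
    have := h1.trans h
    rw [cnt_concat] at this
    simpa using Nat.cast_le.1 this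
  omega

/-- The chain may topple infinitely many sites at once, so it is not itself a legal sequence. It is
compared locally with one: at a first violation at `x`, some legal sequence has exhausted the
odometer of `x`, leaving `x` stable, while its neighbours have toppled at least as often as in the
chain, where `x` is unstable. -/
theorem chain_le_odometer {I : InstrField d} (hI : NbField I) (η : Config d) (B : Clocks d)
    (i : ℕ) (x : Site d) : (chain η I B i x : ℕ∞) ≤ odometer I η x := by
  induction i generalizing x with
  | zero => simp [chain]
  | succ i ih =>
    by_contra! hlt
    have h1 := chain_succ_le η I B i x
    have h2 : odometer I η x ≤ chain η I B i x := by
      have : (chain η I B (i + 1) x : ℕ∞) ≤ (chain η I B i x : ℕ∞) + 1 := by exact_mod_cast h1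
      exact ENat.lt_add_one_iff (ENat.natCast_ne_top _) |>.1 (hlt.trans_le this)
    have h3 : chain η I B i x < chain η I B (i + 1) x := by exact_mod_cast (ih x).trans_lt hlt
    obtain ⟨α, hα, hge⟩ := exists_legalSeq_ge_on hI (η := η) (h := chain η I B i)
      ({x} ∪ (nbs d).image fun z => x - z) fun y _ => ih y
    have hx : chain η I B i x = cnt α x := le_antisymm (hge x (by simp))
      (by exact_mod_cast (hα.le_odometer x).trans h2)
    have h4 := hα.activeCount_eq_zero hI (h2.trans (Nat.cast_le.2 hx.le))
    have h5 := (rings_of_chain_lt h3).active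
    have h6 := activeCount_mono (rank_cfg_mono (legalAt_chain η I B i x) (η' := η) le_rfl hx
      fun z hz => hge _ (Finset.mem_union_right _ (Finset.mem_image_of_mem _ hz)))
    omega

/-- The least action principle: a field at which no legal sequence below it can be stopped with an
unstable site bounds every legal sequence. The first toppling beyond `H` would take place at a site
that is stable by assumption. -/
theorem odometer_le_of_forall {I : InstrField d} (hI : NbField I) {η : Config d}
    {H : Site d → ℕ∞} (h : ∀ α, LegalSeq η I α → (∀ y, (cnt α y : ℕ∞) ≤ H y) → ∀ x,
      H x = cnt α x → (cfg η I (cnt α) x).activeCount = 0) (x : Site d) :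
    odometer I η x ≤ H x := by
  refine odometer_le_iff.2 fun α hα => ?_
  induction α using List.reverseRecOn generalizing x with
  | nil => simp [cnt]
  | append_singleton α y ih =>
    obtain ⟨hα', hy⟩ := (legalSeq_concat hI).1 hα
    have h1 := fun y => ih y hα'
    rw [cnt_concat]
    by_cases hxy : x = y
    · subst hxy
      rcases (h1 x).lt_or_eq with hlt | heq
      · simpa using Order.add_one_le_of_lt hlt
      · have := h α hα' h1 x heq.symm
        omega
    · simpa [hxy] using h1 x

/-- If `x + z` stopped after `K` topplings, then `K + 2` particles sent from `x` would leave at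
least two particles there, one more than a stable site can hold. -/
theorem odometer_eq_top_of_neighbor {I : InstrField d} (hI : NbField I) {η : Config d}
    {x z : Site d} (hz : z ∈ nbs d) (hinf : {j | I (x, j) = .jump z}.Infinite)
    (hx : odometer I η x = ⊤) : odometer I η (x + z) = ⊤ := by
  by_contra hne
  obtain ⟨K, hK⟩ := ENat.ne_top_iff_exists.1 hne
  have hN : K + 2 ≤ Nat.count (fun j => I (x, j) = .jump z)
      (Nat.nth (fun j => I (x, j) = .jump z) (K + 2)) := by
    rw [Nat.count_nth_of_infinite hinf]
  set N := Nat.nth (fun j => I (x, j) = .jump z) (K + 2)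
  have hxz : x ≠ x + z := fun h => ne_zero_of_mem_nbs hz (by simpa using h)
  obtain ⟨α, hα, hge⟩ := exists_legalSeq_ge_on hI (η := η)
    (h := fun y => if y = x then N else K) {x, x + z} (by
      intro y hy
      rcases Finset.mem_insert.1 hy with rfl | hy
      · simp [hx]
      · rw [Finset.mem_singleton] at hy
        subst hy
        simp [hxz.symm, hK])
  have h1 : N ≤ cnt α x := by simpa using hge x (by simp)
  have h2 : K ≤ cnt α (x + z) := by simpa [hxz.symm] using hge (x + z) (by simp)
  have h3 : cnt α (x + z) ≤ K := by exact_mod_cast (hα.le_odometer (x + z)).trans hK.ge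
  have h4 := hα.activeCount_eq_zero hI (x := x + z) (by rw [← hK]; exact_mod_cast h2)
  have h5 : K + 2 ≤ arrivals I (cnt α) (x + z) := by
    refine hN.trans ((Nat.count_monotone _ h1).trans ?_)
    have := Finset.single_le_sum (f := fun w => Nat.count (fun j => I (x + z - w, j) = .jump w)
      (cnt α (x + z - w))) (fun _ _ => Nat.zero_le _) hz
    simpa [arrivals] using this
  have h6 := count_le_count_run (loaded η I (cnt α) (x + z)) (fun j => I (x + z, j))
    (cnt α (x + z))
  rw [loaded, count_addOne_iterate] at h6
  have h7 := two_le_count_activeCount (o := cfg η I (cnt α) (x + z)) (by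
    rw [cfg, loaded]; omega)
  omega

/-! ### Translations -/

/-- Translation of a field of instructions. -/
def translate (z : Site d) (I : InstrField d) : InstrField d := fun q => I (q.1 + z, q.2)

theorem cfg_translate (z : Site d) (η : Config d) (I : InstrField d) (h : Site d → ℕ)
    (x : Site d) :
    cfg (shift z η) (translate z I) (fun y => h (y + z)) x = cfg η I h (x + z) := by
  simp only [cfg, loaded, arrivals, shift, translate, sub_add_eq_add_sub]

theorem NbField.translate {I : InstrField d} (hI : NbField I) (z : Site d) :
    NbField (translate z I) := fun q w h => hI (q.1 + z, q.2) w h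

theorem legalSeq_translate {I : InstrField d} (hI : NbField I) (z : Site d) (η : Config d)
    (α : List (Site d)) :
    LegalSeq (shift z η) (translate z I) α ↔ LegalSeq η I (α.map (· + z)) := by
  induction α using List.reverseRecOn with
  | nil => exact Iff.rfl
  | append_singleton α x ih =>
    have h : cnt α = fun y => cnt (α.map (· + z)) (y + z) := by
      ext y
      exact (List.count_map_of_injective α (· + z) (add_left_injective z) y).symm
    rw [legalSeq_concat (hI.translate z), ih, h, cfg_translate, List.map_append, List.map_cons,
      List.map_nil, legalSeq_concat hI]

theorem odometer_translate {I : InstrField d} (hI : NbField I) (z : Site d) (η : Config d)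
    (x : Site d) : odometer (translate z I) (shift z η) x = odometer I η (x + z) := by
  refine eq_of_forall_ge_iff fun b => ?_
  rw [odometer_le_iff, odometer_le_iff]
  constructor
  · intro h α hα
    have h1 : (α.map (· + -z)).map (· + z) = α := by simp
    have := h (α.map (· + -z)) ((legalSeq_translate hI z η _).2 (by rwa [h1]))
    convert this using 2
    have h2 := List.count_map_of_injective (α.map (· + -z)) (· + z) (add_left_injective z) x
    rwa [h1] at h2
  · intro h α hα
    have := h _ ((legalSeq_translate hI z η α).1 hα)
    rwa [cnt, List.count_map_of_injective α (· + z) (add_left_injective z)] at this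

open MeasureTheory

/-! ### Measurability -/

instance : DiscreteMeasurableSpace Occ := ⟨fun _ => trivial⟩

instance : DiscreteMeasurableSpace (Instr d) := ⟨fun _ => trivial⟩

instance : Countable Occ :=
  Function.Injective.countable (f := Occ.rank) fun o o' h => by
    rcases o with (_ | n) | _ <;> rcases o' with (_ | m) | _ <;> simp_all [rank]

instance : Countable (Instr d) :=
  Function.Injective.countable (β := Option (Site d))
    (f := fun i => match i with
      | .sleep => none
      | .jump z => some z)
    fun i j h => by cases i <;> cases j <;> simp_all

theorem _root_.Measurable.setOf_discrete {X E : Type*} [MeasurableSpace X] [MeasurableSpace E]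
    [DiscreteMeasurableSpace E] {f : X → E} (hf : Measurable f) (p : E → Prop) :
    MeasurableSet {x | p (f x)} :=
  hf (MeasurableSet.of_discrete (s := {e | p e}))

theorem measurable_run : Measurable fun p : Occ × (ℕ → Instr d) × ℕ => run p.1 p.2.1 p.2.2 := by
  have h : ∀ k, Measurable fun p : Occ × (ℕ → Instr d) => run p.1 p.2 k := by
    intro k
    induction k with
    | zero => exact measurable_fst
    | succ k ih =>
      exact (Measurable.of_discrete (f := fun q : Instr d × Occ => q.1.own q.2)).comp
        (((measurable_pi_apply k).comp measurable_snd).prodMk ih)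
  exact (measurable_from_prod_countable_left (f := fun p : (Occ × (ℕ → Instr d)) × ℕ =>
    run p.1.1 p.1.2 p.2) h).comp
      ((measurable_fst.prodMk (measurable_fst.comp measurable_snd)).prodMk
        (measurable_snd.comp measurable_snd))

theorem measurable_count (i : Instr d) :
    Measurable fun p : (ℕ → Instr d) × ℕ => Nat.count (fun j => p.1 j = i) p.2 := by
  refine measurable_from_prod_countable_left fun k => ?_
  induction k with
  | zero => simp
  | succ k ih =>
    simp only [Nat.count_succ]
    exact ih.add (Measurable.ite 
      (Measurable.setOf_discrete (f := fun s : ℕ → Instr d => s k) (measurable_pi_apply k) (· = i))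
      measurable_const measurable_const)

section

variable {X : Type*} [MeasurableSpace X] {η : X → Config d} {I : X → InstrField d}
  {h : X → Site d → ℕ} {B : X → Clocks d}

theorem measurable_arrivals (hI : Measurable I) (hh : Measurable h) (x : Site d) :
    Measurable fun ω => arrivals (I ω) (h ω) x := by
  unfold arrivals
  refine Finset.measurable_fun_sum _ fun z _ => ?_
  exact (measurable_count (.jump z)).comp (Measurable.prodMk
    (measurable_pi_lambda _ fun j => (measurable_pi_apply (x - z, j)).comp hI)
    ((measurable_pi_apply (x - z)).comp hh))

theorem measurable_cfg (hη : Measurable η) (hI : Measurable I) (hh : Measurable h) :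
    Measurable fun ω => cfg (η ω) (I ω) (h ω) := by
  refine measurable_pi_lambda _ fun x => ?_
  have h1 : Measurable fun ω => loaded (η ω) (I ω) (h ω) x :=
    (Measurable.of_discrete (f := fun q : ℕ × Occ => addOne^[q.1] q.2)).comp
      ((measurable_arrivals hI hh x).prodMk ((measurable_pi_apply x).comp hη))
  exact measurable_run.comp (h1.prodMk (Measurable.prodMk
    (measurable_pi_lambda _ fun j => (measurable_pi_apply (x, j)).comp hI)
    ((measurable_pi_apply x).comp hh)))

theorem measurableSet_rings {o : X → Occ} {b : X → ℕ → Bool} (ho : Measurable o)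
    (hb : Measurable b) : MeasurableSet {ω | Rings (o ω) (b ω)} := by
  have : {ω | Rings (o ω) (b ω)} = ⋃ m, {ω | m < (o ω).activeCount} ∩ {ω | b ω m = true} := by
    ext ω; simp [Rings]
  rw [this]
  exact MeasurableSet.iUnion fun m => (ho.setOf_discrete fun o => m < o.activeCount).inter
    (((measurable_pi_apply m).comp hb).setOf_discrete (· = true))

theorem measurable_ringing {b : X → Site d × ℕ → Bool} (hη : Measurable η) (hb : Measurable b) :
    Measurable fun ω => ringing (η ω) (b ω) := by
  refine measurable_pi_lambda _ fun x => ?_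
  unfold ringing
  exact Measurable.ite (measurableSet_rings ((measurable_pi_apply x).comp hη)
    (measurable_pi_lambda _ fun m => (measurable_pi_apply (x, m)).comp hb))
    measurable_const measurable_const

theorem measurable_chain (hη : Measurable η) (hI : Measurable I) (hB : Measurable B) (i : ℕ) :
    Measurable fun ω => chain (η ω) (I ω) (B ω) i := by
  induction i with
  | zero => exact measurable_const
  | succ i ih =>
    simp only [chain]
    exact ih.add (measurable_ringing (measurable_cfg hη hI ih)
      (measurable_pi_lambda _ fun c => (measurable_pi_apply (c.1, c.2, i)).comp hB))

end

theorem measurableSet_nbField : MeasurableSet {I : InstrField d | NbField I} := by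
  have : {I : InstrField d | NbField I} = ⋂ q, {I | ∀ z, I q = .jump z → z ∈ nbs d} := by
    ext I; simp [NbField]
  rw [this]
  exact MeasurableSet.iInter fun q => 
    Measurable.setOf_discrete (f := fun I : InstrField d => I q) (measurable_pi_apply q)
      fun i => ∀ z, i = .jump z → z ∈ nbs d

/-- Restricting to `NbField` allows legality of the last toppling to be read off the measurable
field `cfg`. -/
theorem measurableSet_legalSeq (α : List (Site d)) :
    MeasurableSet {q : Config d × InstrField d | NbField q.2 ∧ LegalSeq q.1 q.2 α} := by
  induction α using List.reverseRecOn with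
  | nil =>
    simpa [legalSeq_nil] using measurable_snd measurableSet_nbField
  | append_singleton α x ih =>
    have h : {q : Config d × InstrField d | NbField q.2 ∧ LegalSeq q.1 q.2 (α ++ [x])} =
        {q | NbField q.2 ∧ LegalSeq q.1 q.2 α} ∩ {q | 1 ≤ (cfg q.1 q.2 (cnt α) x).activeCount} := by
      ext q
      simp only [Set.mem_ofPred_eq, Set.mem_inter_iff, and_assoc]
      exact and_congr_right fun hq => legalSeq_concat hq
    rw [h]
    exact ih.inter (((measurable_pi_apply x).comp (measurable_cfg measurable_fst measurable_snd
      measurable_const)).setOf_discrete fun o => 1 ≤ o.activeCount)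

theorem measurableSet_odometer_le (x : Site d) (n : ℕ) :
    MeasurableSet {q : Config d × InstrField d | NbField q.2 ∧ odometer q.2 q.1 x ≤ n} := by
  have h : {q : Config d × InstrField d | NbField q.2 ∧ odometer q.2 q.1 x ≤ n} =
      {q | NbField q.2} ∩ ⋂ α : {α : List (Site d) // ¬ cnt α x ≤ n},
        {q | NbField q.2 ∧ LegalSeq q.1 q.2 α}ᶜ := by
    ext q
    simp only [Set.mem_ofPred_eq, Set.mem_inter_iff, Set.mem_iInter, Set.mem_compl_iff]
    refine and_congr_right fun hq => ?_
    rw [odometer_le_iff]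
    exact ⟨fun h α hα => α.2 (by exact_mod_cast h α hα.2), fun h α hα => by
      by_contra hc
      exact h ⟨α, fun h' => hc (by exact_mod_cast h')⟩ ⟨hq, hα⟩⟩
  rw [h]
  exact (measurable_snd measurableSet_nbField).inter
    (MeasurableSet.iInter fun α => (measurableSet_legalSeq _).compl)

theorem measurableSet_odometer_lt_top (x : Site d) :
    MeasurableSet {q : Config d × InstrField d | NbField q.2 ∧ odometer q.2 q.1 x < ⊤} := by
  have h : {q : Config d × InstrField d | NbField q.2 ∧ odometer q.2 q.1 x < ⊤} =
      ⋃ n : ℕ, {q | NbField q.2 ∧ odometer q.2 q.1 x ≤ n} := by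
    ext q
    simp only [Set.mem_ofPred_eq, Set.mem_iUnion, exists_and_left]
    refine and_congr_right fun _ => ⟨fun h => ?_, fun ⟨n, hn⟩ => hn.trans_lt (ENat.natCast_lt_top n)⟩
    obtain ⟨n, hn⟩ := ENat.ne_top_iff_exists.1 h.ne
    exact ⟨n, hn.ge⟩
  rw [h]
  exact MeasurableSet.iUnion fun n => measurableSet_odometer_le x n

/-! ### Product measures -/

section Mix

variable {ι κ l X : Type*} [MeasurableSpace X]

theorem infinitePi_forall_mem (μ : κ → Measure X) [∀ i, IsProbabilityMeasure (μ i)]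
    {a : ι → κ} {s : Finset ι} (ha : Set.InjOn a s) {t : ι → Set X}
    (ht : ∀ i, MeasurableSet (t i)) :
    Measure.infinitePi μ {ω | ∀ i ∈ s, ω (a i) ∈ t i} = ∏ i ∈ s, μ (a i) (t i) := by
  have h := Measure.map_infinitePi_infinitePi_of_inj (P := μ) (f := fun i : s => a i)
    fun i j hij => Subtype.ext (ha i.2 j.2 hij)
  have h2 : {ω : κ → X | ∀ i ∈ s, ω (a i) ∈ t i} =
      (fun ω (i : s) => ω (a i)) ⁻¹' Set.pi ((Finset.univ : Finset s) : Set s) fun i => t i := by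
    ext ω; simp
  have hm : Measurable fun (ω : κ → X) (i : s) => ω (a i) := by fun_prop
  have hs : MeasurableSet (Set.pi ((Finset.univ : Finset s) : Set s) fun i => t i) :=
    MeasurableSet.pi (Finset.countable_toSet _) fun i _ => ht i
  rw [h2, ← Measure.map_apply hm hs, h,
    Measure.infinitePi_pi (fun i : s => μ (a i)) (t := fun i : s => t i) fun i _ => ht i]
  exact Finset.prod_coe_sort s fun i => μ (a i) (t i)

/-- Two independent families of independent variables, used through injective reindexings on
complementary sets of indices, give a family of independent variables. -/
theorem map_mix (μ : κ → Measure X) (ν : l → Measure X) (ρ : ι → Measure X)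
    [∀ i, IsProbabilityMeasure (μ i)] [∀ i, IsProbabilityMeasure (ν i)]
    [∀ i, IsProbabilityMeasure (ρ i)] (p : ι → Prop) [DecidablePred p] {a : ι → κ} {b : ι → l}
    (ha : Set.InjOn a {i | p i}) (hb : Set.InjOn b {i | ¬ p i})
    (hμ : ∀ i, p i → μ (a i) = ρ i) (hν : ∀ i, ¬ p i → ν (b i) = ρ i) :
    MeasurePreserving (fun w : (κ → X) × (l → X) => fun i => if p i then w.1 (a i) else w.2 (b i))
      ((Measure.infinitePi μ).prod (Measure.infinitePi ν)) (Measure.infinitePi ρ) := by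
  have hm : Measurable (fun w : (κ → X) × (l → X) => fun i =>
      if p i then w.1 (a i) else w.2 (b i)) := by
    refine measurable_pi_lambda _ fun i => ?_
    split_ifs
    · exact (measurable_pi_apply _).comp measurable_fst
    · exact (measurable_pi_apply _).comp measurable_snd
  refine ⟨hm, Measure.eq_infinitePi _ fun s t ht => ?_⟩
  rw [Measure.map_apply hm (MeasurableSet.pi s.countable_toSet fun i _ => ht i)]
  have h : (fun w : (κ → X) × (l → X) => fun i => if p i then w.1 (a i) else w.2 (b i)) ⁻¹'
      Set.pi s t = {ω | ∀ i ∈ s.filter p, ω (a i) ∈ t i} ×ˢ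
        {ω | ∀ i ∈ s.filter (¬ p ·), ω (b i) ∈ t i} := by
    ext w
    simp only [Set.mem_preimage, Set.mem_pi, Finset.mem_coe, Set.mem_prod, Set.mem_ofPred_eq,
      Finset.mem_filter, and_imp]
    constructor
    · intro h
      exact ⟨fun i hi hp => by simpa [hp] using h i hi, fun i hi hp => by simpa [hp] using h i hi⟩
    · rintro ⟨h1, h2⟩ i hi
      split_ifs with hp
      · exact h1 i hi hp
      · exact h2 i hi hp
  have ha' : Set.InjOn a (s.filter p) := ha.mono fun i hi => (Finset.mem_filter.1 hi).2
  have hb' : Set.InjOn b (s.filter (¬ p ·)) := hb.mono fun i hi => (Finset.mem_filter.1 hi).2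
  rw [h, Measure.prod_prod, infinitePi_forall_mem μ ha' ht, infinitePi_forall_mem ν hb' ht,
    ← Finset.prod_filter_mul_prod_filter_not s p]
  congr 1
  · exact Finset.prod_congr rfl fun i hi => by rw [hμ i (Finset.mem_filter.1 hi).2]
  · exact Finset.prod_congr rfl fun i hi => by rw [hν i (Finset.mem_filter.1 hi).2]

/-- An event that does not depend on the coordinate `c` is independent of that coordinate. -/
theorem infinitePi_inter_coord (μ : ι → Measure X) [∀ i, IsProbabilityMeasure (μ i)]
    {E : Set (ι → X)} (hE : MeasurableSet E) (c : ι)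
    (hc : ∀ ω ω' : ι → X, (∀ i ≠ c, ω i = ω' i) → (ω ∈ E ↔ ω' ∈ E)) {S : Set X}
    (hS : MeasurableSet S) :
    Measure.infinitePi μ (E ∩ {ω | ω c ∈ S}) = Measure.infinitePi μ E * μ c S := by
  classical
  -- Coordinate `c` is resampled from an independent copy; the law is unchanged and the event
  -- becomes a rectangle.
  have h := map_mix μ μ μ (fun i => i ≠ c) (a := id) (b := id) Function.injective_id.injOn
    Function.injective_id.injOn (fun _ _ => rfl) fun _ _ => rfl
  have hcS : MeasurableSet {ω : ι → X | ω c ∈ S} := measurable_pi_apply c hS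
  rw [← h.measure_preimage (hE.inter hcS).nullMeasurableSet]
  have h2 : (fun w : (ι → X) × (ι → X) => fun i => if i ≠ c then w.1 (id i) else w.2 (id i)) ⁻¹'
      (E ∩ {ω | ω c ∈ S}) = E ×ˢ {ω | ω c ∈ S} := by
    ext w
    simp only [Set.mem_preimage, Set.mem_inter_iff, Set.mem_prod, Set.mem_ofPred_eq]
    refine and_congr (hc _ _ fun i hi => by simp [hi]) (by simp)
  rw [h2, Measure.prod_prod]
  congr 1
  exact (measurePreserving_eval_infinitePi μ c).measure_preimage hS.nullMeasurableSet

end Mix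

/-! ### Clocks at all dyadic scales -/

/-- The law of a bit that is `true` with probability `q`. -/
abbrev bern (q : unitInterval) : Measure Bool := ProbabilityTheory.bernoulliMeasure true false q

theorem bern_true (q : unitInterval) : bern q {true} = ENNReal.ofReal q := by
  rw [ProbabilityTheory.bernoulliMeasure_apply_of_mem_of_notMem q (by simp) (by simp) (by simp),
    ENNReal.ofReal_eq_coe_nnreal q.2.1]
  rfl

theorem bern_false (q : unitInterval) : bern q {false} = ENNReal.ofReal (1 - q) := by
  rw [ProbabilityTheory.bernoulliMeasure_apply_of_notMem_of_mem q (by simp) (by simp) (by simp),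
    ENNReal.ofReal_eq_coe_nnreal (sub_nonneg.2 q.2.2)]
  rfl

/-- The law of the clocks in one time step, when each clock rings with probability `q`. -/
abbrev clockLaw (d : ℕ) (q : unitInterval) : Measure (Clocks d) :=
  Measure.infinitePi fun _ => bern q

/-- The probability that a clock of rate `θ` rings during a time step of length `2⁻ⁿ`. -/
def ringProb (θ : ℝ≥0) (n : ℕ) : unitInterval :=
  ⟨1 - Real.exp (-(θ / 2 ^ n)), by
    constructor
    · have : Real.exp (-(θ / 2 ^ n)) ≤ 1 := Real.exp_le_one_iff.2 (by
        rw [neg_nonpos]; positivity)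
      linarith
    · have := Real.exp_pos (-(θ / 2 ^ n : ℝ))
      linarith⟩

/-- No ring in a step means no ring in either half: `1 - q = (1 - q')²`. -/
theorem ringProb_succ (θ : ℝ≥0) (n : ℕ) : (ringProb θ n : ℝ) =
    2 * ringProb θ (n + 1) - (ringProb θ (n + 1) : ℝ) ^ 2 := by
  have h : Real.exp (-(θ / 2 ^ n)) = Real.exp (-(θ / 2 ^ (n + 1))) ^ 2 := by
    rw [← Real.exp_nat_mul]
    congr 1
    field_simp
    ring
  simp only [ringProb, h]
  ring

/-- The conditional probability that a clock rings in the first half of a time step, given that it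
rings. -/
def splitProb (θ : ℝ≥0) (n : ℕ) : unitInterval :=
  ⟨ringProb θ (n + 1) / ringProb θ n, by
    have h0 := (ringProb θ (n + 1)).2
    have h1 := (ringProb θ n).2
    constructor
    · exact div_nonneg h0.1 h1.1
    · refine div_le_one_of_le₀ ?_ h1.1
      rw [ringProb_succ θ n]
      nlinarith [h0.1, h0.2]⟩

theorem ringProb_mul_splitProb (θ : ℝ≥0) (n : ℕ) :
    (ringProb θ n : ℝ) * splitProb θ n = ringProb θ (n + 1) := by
  -- When the denominator vanishes the quotient has the default value `0`, and the probability at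
  -- the finer level vanishes as well.
  rcases eq_or_ne (ringProb θ n : ℝ) 0 with h | h
  · have h0 := (ringProb θ (n + 1)).2
    have h1 := ringProb_succ θ n
    have : (ringProb θ (n + 1) : ℝ) = 0 := by nlinarith [h0.1, h0.2]
    rw [h, this, zero_mul]
  · rw [splitProb]
    field_simp

/-- The rings in the two halves of a time step: the bit `none` tells whether there is a ring at
all, the other two bits are auxiliary randomness. -/
def splitBits (w : Option Bool → Bool) : Bool → Bool
  | false => w none && w (some false)
  | true => w none && (!w (some false) || w (some true))

theorem splitBits_or (w : Option Bool → Bool) :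
    (splitBits w false || splitBits w true) = w none := by
  simp only [splitBits]
  cases w none <;> cases w (some false) <;> simp

/-- The laws of the bits used by `splitBits`. -/
def splitLaw (θ : ℝ≥0) (n : ℕ) : Option Bool → Measure Bool
  | none => bern (ringProb θ n)
  | some false => bern (splitProb θ n)
  | some true => bern (ringProb θ (n + 1))

instance (θ : ℝ≥0) (n : ℕ) (o : Option Bool) : IsProbabilityMeasure (splitLaw θ n o) := by
  rcases o with _ | _ | _ <;> exact inferInstanceAs (IsProbabilityMeasure (bern _))

/-- Given a ring, the first half rings with probability `q'/q`. If it does, the second half rings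
independently with probability `q'`; if not, the second half must ring. The four atoms then have the
product weights: for instance, a ring in the second half only has weight `q (1 - q'/q) = q - q' = q'
(1 - q')`. -/
theorem map_splitBits (θ : ℝ≥0) (n : ℕ) :
    (Measure.infinitePi (splitLaw θ n)).map splitBits =
      Measure.infinitePi fun _ : Bool => bern (ringProb θ (n + 1)) := by
  have hq := ringProb_mul_splitProb θ n
  have hs := ringProb_succ θ n
  have h0 := (ringProb θ (n + 1)).2
  have h1 := (ringProb θ n).2
  have h2 := (splitProb θ n).2
  refine Measure.ext_of_singleton fun φ => ?_
  rw [Measure.map_apply .of_discrete (measurableSet_singleton φ),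
    Measure.infinitePi_singleton_of_fintype, Fintype.prod_bool]
  rcases hf : φ false <;> rcases ht : φ true
  · have h : splitBits ⁻¹' {φ} = Set.pi ({none} : Finset (Option Bool)) fun _ => {false} := by
      ext w
      simp only [Set.mem_preimage, Set.mem_singleton_iff, funext_iff, Bool.forall_bool, hf, ht,
        splitBits, Set.mem_pi, Finset.mem_coe, Finset.mem_singleton, forall_eq]
      cases w none <;> cases w (some false) <;> simp
    rw [h, Measure.infinitePi_pi _ fun i _ => measurableSet_singleton _]
    simp only [Finset.prod_singleton, splitLaw, bern_false]
    rw [← ENNReal.ofReal_mul (by linarith [h0.2])]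
    congr 1
    rw [hs]; ring
  · have h : splitBits ⁻¹' {φ} = Set.pi ({none, some false} : Finset (Option Bool))
        fun i => if i = none then {true} else {false} := by
      ext w
      simp only [Set.mem_preimage, Set.mem_singleton_iff, funext_iff, Bool.forall_bool, hf, ht,
        splitBits, Set.mem_pi, Finset.coe_insert, Finset.coe_singleton, Set.mem_insert_iff,
        forall_eq_or_imp, forall_eq]
      cases w none <;> cases w (some false) <;> simp
    rw [h, Measure.infinitePi_pi _ fun i _ => .of_discrete]
    rw [Finset.prod_pair (by simp)]
    simp only [splitLaw, if_true, reduceCtorEq, if_false, bern_false, bern_true]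
    rw [← ENNReal.ofReal_mul h1.1, ← ENNReal.ofReal_mul h0.1]
    congr 1
    linear_combination hs - hq
  · have h : splitBits ⁻¹' {φ} = Set.pi ({none, some false, some true} : Finset (Option Bool))
        fun i => if i = some true then {false} else {true} := by
      ext w
      simp only [Set.mem_preimage, Set.mem_singleton_iff, funext_iff, Bool.forall_bool, hf, ht,
        splitBits, Set.mem_pi, Finset.coe_insert, Finset.coe_singleton, Set.mem_insert_iff,
        forall_eq_or_imp, forall_eq]
      cases w none <;> cases w (some false) <;> simp
    rw [h, Measure.infinitePi_pi _ fun i _ => .of_discrete]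
    rw [Finset.prod_insert (by simp), Finset.prod_pair (by simp)]
    simp only [splitLaw, if_true, reduceCtorEq, if_false, bern_false, bern_true, Option.some.injEq,
      Bool.false_eq_true]
    rw [← mul_assoc, ← ENNReal.ofReal_mul h1.1, hq, mul_comm]
  · have h : splitBits ⁻¹' {φ} = Set.pi ({none, some false, some true} : Finset (Option Bool))
        fun _ => {true} := by
      ext w
      simp only [Set.mem_preimage, Set.mem_singleton_iff, funext_iff, Bool.forall_bool, hf, ht,
        splitBits, Set.mem_pi, Finset.coe_insert, Finset.coe_singleton, Set.mem_insert_iff,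
        forall_eq_or_imp, forall_eq]
      cases w none <;> cases w (some false) <;> simp
    rw [h, Measure.infinitePi_pi _ fun i _ => .of_discrete]
    rw [Finset.prod_insert (by simp), Finset.prod_pair (by simp)]
    simp only [splitLaw, bern_true]
    rw [← mul_assoc, ← ENNReal.ofReal_mul h1.1, hq]

/-- Auxiliary bits for splitting all the time steps of one dyadic scale. -/
abbrev SplitField (d : ℕ) : Type := (Site d × ℕ × ℕ) × Bool → Bool

/-- The clocks at the next dyadic scale. -/
def refine (C : Clocks d) (u : SplitField d) : Clocks d := fun c =>
  splitBits (fun o => match o with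
    | none => C (c.1, c.2.1, c.2.2 / 2)
    | some b => u ((c.1, c.2.1, c.2.2 / 2), b)) (decide (c.2.2 % 2 = 1))

theorem refine_refines (C : Clocks d) (u : SplitField d) : Refines (refine C u) C := by
  intro x m i
  have h1 : (2 * i + 1) / 2 = i := by omega
  simp only [refine, Nat.mul_mod_right, Nat.mul_div_cancel_left i two_pos, h1, Nat.mul_add_mod]
  simpa using (splitBits_or fun o => match o with
    | none => C (x, m, i)
    | some b => u ((x, m, i), b)).symm

/-- The law of the auxiliary bits. -/
abbrev splitFieldLaw (d : ℕ) (θ : ℝ≥0) (n : ℕ) : Measure (SplitField d) :=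
  Measure.infinitePi fun q => splitLaw θ n (some q.2)

/-- Each time step receives its three bits, the steps are split independently of each other, and the
pairs (step, half) are renumbered as the time steps `2 i` and `2 i + 1`. -/
theorem measurePreserving_refine (θ : ℝ≥0) (n : ℕ) :
    MeasurePreserving (fun w : Clocks d × SplitField d => refine w.1 w.2)
      ((clockLaw d (ringProb θ n)).prod (splitFieldLaw d θ n))
      (clockLaw d (ringProb θ (n + 1))) := by
  have h1 := map_mix (ι := (Site d × ℕ × ℕ) × Option Bool)
    (fun _ : Site d × ℕ × ℕ => bern (ringProb θ n))
    (fun q : (Site d × ℕ × ℕ) × Bool => splitLaw θ n (some q.2))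
    (fun q => splitLaw θ n q.2) (fun q => q.2 = none)
    (a := Prod.fst) (b := fun q => (q.1, q.2.getD false))
    (fun q hq r hr h => Prod.ext h (hq.trans hr.symm))
    (fun q hq r hr h => by
      obtain ⟨q1, _ | q2⟩ := q
      · exact absurd rfl hq
      obtain ⟨r1, _ | r2⟩ := r
      · exact absurd rfl hr
      simpa using h)
    (fun q hq => by rw [hq]; rfl)
    (fun q hq => by
      obtain ⟨q1, _ | q2⟩ := q
      · exact absurd rfl hq
      · rfl)
  have h2 : MeasurePreserving (MeasurableEquiv.curry (Site d × ℕ × ℕ) (Option Bool) Bool)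
      (Measure.infinitePi fun q : (Site d × ℕ × ℕ) × Option Bool => splitLaw θ n q.2)
      (Measure.infinitePi fun _ => Measure.infinitePi (splitLaw θ n)) :=
    ⟨MeasurableEquiv.measurable _, Measure.infinitePi_map_curry fun _ => splitLaw θ n⟩
  have h3 : MeasurePreserving (fun (w : Site d × ℕ × ℕ → Option Bool → Bool) c => splitBits (w c))
      (Measure.infinitePi fun _ => Measure.infinitePi (splitLaw θ n))
      (Measure.infinitePi fun _ => Measure.infinitePi fun _ => bern (ringProb θ (n + 1))) := by
    refine ⟨measurable_pi_lambda _ fun c => 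
      (Measurable.of_discrete (f := splitBits)).comp (measurable_pi_apply c), ?_⟩
    rw [Measure.infinitePi_map_pi (fun _ : Site d × ℕ × ℕ => Measure.infinitePi (splitLaw θ n))
      (f := fun _ => splitBits) fun _ => .of_discrete]
    simp only [map_splitBits]
  have h4 : MeasurePreserving (MeasurableEquiv.curry (Site d × ℕ × ℕ) Bool Bool).symm
      (Measure.infinitePi fun _ => Measure.infinitePi fun _ => bern (ringProb θ (n + 1)))
      (Measure.infinitePi fun _ => bern (ringProb θ (n + 1))) :=
    ⟨MeasurableEquiv.measurable _,
      Measure.infinitePi_map_curry_symm fun _ _ => bern (ringProb θ (n + 1))⟩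
  have h5 : MeasurePreserving (fun (w : (Site d × ℕ × ℕ) × Bool → Bool) (c : Site d × ℕ × ℕ) =>
      w ((c.1, c.2.1, c.2.2 / 2), decide (c.2.2 % 2 = 1)))
      (Measure.infinitePi fun _ => bern (ringProb θ (n + 1)))
      (clockLaw d (ringProb θ (n + 1))) := by
    refine ⟨by fun_prop, Measure.map_infinitePi_infinitePi_of_inj
      (P := fun _ => bern (ringProb θ (n + 1)))
      (f := fun c : Site d × ℕ × ℕ => ((c.1, c.2.1, c.2.2 / 2), decide (c.2.2 % 2 = 1))) ?_⟩
    rintro ⟨x, m, i⟩ ⟨y, k, j⟩ h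
    simp only [Prod.mk.injEq, decide_eq_decide] at h
    obtain ⟨⟨rfl, rfl, h1⟩, h2⟩ := h
    have : i = j := by omega
    rw [this]
  convert h5.comp (h4.comp (h3.comp (h2.comp h1))) using 1
  ext w c
  simp only [refine, Function.comp]
  congr 1
  ext o
  cases o <;> simp [MeasurableEquiv.curry, Function.curry]

/-- The randomness from which the clocks at all dyadic scales are built. -/
abbrev Noise (d : ℕ) : Type := Clocks d × (ℕ → SplitField d)

/-- The clocks for time steps of length `2⁻ⁿ`. -/
def clocks (w : Noise d) : ℕ → Clocks d
  | 0 => w.1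
  | n + 1 => refine (clocks w n) (w.2 n)

theorem clocks_refines (w : Noise d) (n : ℕ) : Refines (clocks w (n + 1)) (clocks w n) :=
  refine_refines _ _

/-- The law of the noise, for clocks of rate `θ`. -/
abbrev noiseLaw (d : ℕ) (θ : ℝ≥0) : Measure (Noise d) :=
  (clockLaw d (ringProb θ 0)).prod (Measure.infinitePi fun n => splitFieldLaw d θ n)

theorem measurable_refine : Measurable fun w : Clocks d × SplitField d => refine w.1 w.2 :=
  (measurePreserving_refine 0 0).measurable

theorem measurable_clocks (n : ℕ) : Measurable fun w : Noise d => clocks w n := by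
  induction n with
  | zero => exact measurable_fst
  | succ n ih =>
    exact measurable_refine.comp (ih.prodMk ((measurable_pi_apply n).comp measurable_snd))

theorem infinitePi_nat_cons {X : Type*} [MeasurableSpace X] (μ : ℕ → Measure X)
    [∀ i, IsProbabilityMeasure (μ i)] :
    MeasurePreserving (fun u : ℕ → X => (u 0, fun k => u (k + 1))) (Measure.infinitePi μ)
      ((μ 0).prod (Measure.infinitePi fun k => μ (k + 1))) := by
  have h := map_mix (ι := ℕ) (fun _ : Unit => μ 0) (fun k => μ (k + 1)) μ (fun i => i = 0)
    (a := fun _ => ()) (b := fun i => i - 1)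
    (fun i hi j hj _ => hi.trans hj.symm)
    (fun i hi j hj h => by simp only [Set.mem_ofPred_eq] at *; omega)
    (fun i hi => by rw [hi]) (fun i hi => by congr 1; omega)
  have hm : Measurable fun u : ℕ → X => (u 0, fun k => u (k + 1)) := by fun_prop
  refine ⟨hm, ?_⟩
  rw [← h.map_eq, Measure.map_map hm h.measurable]
  have h1 := (measurePreserving_eval_infinitePi (fun _ : Unit => μ 0) ()).prod
    (MeasurePreserving.id (Measure.infinitePi fun k => μ (k + 1)))
  rw [← h1.map_eq]
  congr 1

theorem measurePreserving_clocks (θ : ℝ≥0) (n : ℕ) :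
    MeasurePreserving (fun w : Noise d => clocks w n) (noiseLaw d θ)
      (clockLaw d (ringProb θ n)) := by
  -- The induction carries along the auxiliary bits not used yet, since the next splitting needs
  -- them to be independent of the current clocks.
  have h : MeasurePreserving (fun w : Noise d => (clocks w n, fun k => w.2 (n + k)))
      (noiseLaw d θ) ((clockLaw d (ringProb θ n)).prod
        (Measure.infinitePi fun k => splitFieldLaw d θ (n + k))) := by
    induction n with
    | zero =>
      convert MeasurePreserving.id (noiseLaw d θ) using 1
      · ext w : 1
        simp [clocks]
      · simp
    | succ n ih =>
      have h1 := (MeasurePreserving.id (clockLaw d (ringProb θ n))).prod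
        (infinitePi_nat_cons fun k => splitFieldLaw d θ (n + k))
      have h2 := (measurePreserving_prodAssoc (clockLaw d (ringProb θ n)) (splitFieldLaw d θ n)
        (Measure.infinitePi fun k => splitFieldLaw d θ (n + (k + 1)))).symm
      have h3 := (measurePreserving_refine (d := d) θ n).prod
        (MeasurePreserving.id (Measure.infinitePi fun k => splitFieldLaw d θ (n + (k + 1))))
      convert h3.comp (h2.comp (h1.comp ih)) using 1
      · ext w : 1
        simp [clocks, MeasurableEquiv.prodAssoc, add_comm, add_left_comm]
      · simp only [add_assoc, add_comm 1]
  exact measurePreserving_fst.comp h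

open Filter Topology

/-! ### Product formula for exponentials -/

section Trotter

variable {E : Type*} [NormedAddCommGroup E] [NormedSpace ℝ E]

/-- Telescoping: one factor is exchanged at a time, with contractions `P` on the left and powers of
`Q` on the right. -/
theorem norm_pow_sub_pow_le {P Q : E →L[ℝ] E} {M : ℝ} (hP : ‖P‖ ≤ 1) (k : ℕ)
    (hQ : ∀ j ≤ k, ‖Q ^ j‖ ≤ M) : ‖P ^ k - Q ^ k‖ ≤ k * (‖P - Q‖ * M) := by
  induction k with
  | zero => simp
  | succ k ih =>
    have h : P ^ (k + 1) - Q ^ (k + 1) = P * (P ^ k - Q ^ k) + (P - Q) * Q ^ k := by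
      rw [pow_succ', pow_succ']; noncomm_ring
    rw [h]
    refine (norm_add_le _ _).trans ?_
    have h1 : ‖P * (P ^ k - Q ^ k)‖ ≤ k * (‖P - Q‖ * M) :=
      (norm_mul_le _ _).trans ((mul_le_of_le_one_left (norm_nonneg _) hP).trans
        (ih fun j hj => hQ j (by omega)))
    have h2 : ‖(P - Q) * Q ^ k‖ ≤ ‖P - Q‖ * M :=
      (norm_mul_le _ _).trans (mul_le_mul_of_nonneg_left (hQ k (by omega)) (norm_nonneg _))
    push_cast
    linarith

theorem norm_exp_le_exp_norm (A : E →L[ℝ] E) :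
    ‖NormedSpace.exp A‖ ≤ max 1 (Real.exp ‖A‖) := by
  rcases subsingleton_or_nontrivial E with h | h
  · have : NormedSpace.exp A = 0 := by
      ext x; exact Subsingleton.elim _ _
    rw [this]; simp
  · refine le_max_of_le_right ?_
    rw [NormedSpace.exp_eq_tsum ℝ, Real.exp_eq_exp_ℝ, NormedSpace.exp_eq_tsum ℝ]
    refine tsum_of_norm_bounded (NormedSpace.expSeries_summable' (𝕂 := ℝ) ‖A‖).hasSum fun n => ?_
    rw [norm_smul, smul_eq_mul, Real.norm_of_nonneg (by positivity)]
    exact mul_le_mul_of_nonneg_left (norm_pow_le A n) (by positivity)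

/-- A Chernoff product formula. The powers of `P n` are compared with those of `exp (ε n • L)`,
which are explicit; `k n` of order `1/ε n` single-step errors of size `o(ε n)` add up to `o(1)`. -/
theorem tendsto_pow_exp [CompleteSpace E] (L : E →L[ℝ] E) {P : ℕ → E →L[ℝ] E} {ε : ℕ → ℝ} {k : ℕ → ℕ} {s C : ℝ}
    (hε : ∀ n, 0 < ε n) (hε0 : Tendsto ε atTop (𝓝 0)) (hP : ∀ n, ‖P n‖ ≤ 1)
    (hPL : ∀ n, ‖P n - 1 - ε n • L‖ ≤ C * ε n ^ 2)
    (hk : Tendsto (fun n => k n * ε n) atTop (𝓝 s)) :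
    Tendsto (fun n => P n ^ k n) atTop (𝓝 (NormedSpace.exp (s • L))) := by
  let _ : NormedAlgebra ℚ (E →L[ℝ] E) := NormedAlgebra.restrictScalars ℚ ℝ _
  set Q : ℕ → E →L[ℝ] E := fun n => NormedSpace.exp (ε n • L)
  have hQpow : ∀ (n j : ℕ), Q n ^ j = NormedSpace.exp ((j * ε n) • L) := fun n j => by
    rw [mul_smul, Nat.cast_smul_eq_nsmul ℝ, NormedSpace.exp_nsmul]
  have hexp : Continuous fun u : ℝ => NormedSpace.exp (u • L) :=
    NormedSpace.exp_continuous.comp (continuous_id.smul continuous_const)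
  have hlim : Tendsto (fun n => Q n ^ k n) atTop (𝓝 (NormedSpace.exp (s • L))) := by
    simp only [hQpow]
    exact (hexp.tendsto s).comp hk
  have hder := (hasDerivAt_exp_smul_const L (0 : ℝ)).isLittleO
  simp only [zero_smul, NormedSpace.exp_zero, sub_zero, one_mul] at hder
  have ho : Tendsto (fun n => ‖P n - Q n‖ / ε n) atTop (𝓝 0) := by
    have h1 : Tendsto (fun n => ‖Q n - 1 - ε n • L‖ / ε n) atTop (𝓝 0) := by
      have h := (hder.comp_tendsto hε0).norm_left.tendsto_div_nhds_zero
      exact h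
    have h2 : Tendsto (fun n => C * ε n + ‖Q n - 1 - ε n • L‖ / ε n) atTop (𝓝 0) := by
      simpa using (hε0.const_mul C).add h1
    refine squeeze_zero (fun n => div_nonneg (norm_nonneg _) (hε n).le) (fun n => ?_) h2
    rw [div_le_iff₀ (hε n), add_mul, div_mul_cancel₀ _ (hε n).ne']
    calc ‖P n - Q n‖ = ‖(P n - 1 - ε n • L) - (Q n - 1 - ε n • L)‖ := by congr 1; abel
      _ ≤ C * ε n ^ 2 + ‖Q n - 1 - ε n • L‖ := (norm_sub_le _ _).trans (by linarith [hPL n])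
      _ = _ := by ring
  have hb : Tendsto (fun n => max 1 (Real.exp (k n * ε n * ‖L‖))) atTop
      (𝓝 (max 1 (Real.exp (s * ‖L‖)))) :=
    tendsto_const_nhds.max ((Real.continuous_exp.tendsto _).comp (hk.mul_const _))
  have hdiff : Tendsto (fun n => P n ^ k n - Q n ^ k n) atTop (𝓝 0) := by
    refine squeeze_zero_norm (fun n => ?_) (?_ : Tendsto (fun n => (k n * ε n) *
      (‖P n - Q n‖ / ε n) * max 1 (Real.exp (k n * ε n * ‖L‖))) atTop (𝓝 0))
    · refine (norm_pow_sub_pow_le (M := max 1 (Real.exp (k n * ε n * ‖L‖))) (hP n) (k n)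
        fun j hj => ?_).trans_eq ?_
      · rw [hQpow]
        refine (norm_exp_le_exp_norm _).trans (max_le_max le_rfl (Real.exp_le_exp.2 ?_))
        rw [norm_smul, Real.norm_of_nonneg (mul_nonneg (Nat.cast_nonneg _) (hε n).le)]
        have : (j : ℝ) ≤ k n := Nat.cast_le.2 hj
        have := (hε n).le
        gcongr
      · field_simp [(hε n).ne']
    · simpa using (hk.mul ho).mul hb
  simpa using hdiff.add hlim

end Trotter

/-! ### Configurations with finitely many particles -/

/-- The configuration `ξ` has at most `N` particles. -/
def FinCfg (N : ℕ) (ξ : Config d) : Prop :=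
  ∃ F : Finset (Site d), (∀ x ∉ F, ξ x = .active 0) ∧ ∑ x ∈ F, (ξ x).count ≤ N

/-- Written with added indicators on both sides, so that it can be summed over sites without
subtraction of natural numbers. -/
theorem count_jumpAt {x z : Site d} {ξ : Config d} (hx : 1 ≤ (ξ x).activeCount) (hz : z ≠ 0)
    (y : Site d) : (jumpAt x z ξ y).count + (if y = x then 1 else 0) =
      (ξ y).count + if y = x + z then 1 else 0 := by
  have hxz : x ≠ x + z := by simpa using hz
  have hsub : (ξ x).subOne.count + 1 = (ξ x).count := by
    revert hx
    rcases ξ x with (_ | n) | _ <;> simp [activeCount, count, subOne]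
  by_cases h1 : y = x
  · subst h1
    simp [jumpAt, hz, hsub]
  · by_cases h2 : y = x + z
    · subst h2
      simp [jumpAt, hz]
    · simp [jumpAt, h1, h2]

theorem count_sleepAt (x : Site d) (ξ : Config d) (y : Site d) :
    (sleepAt x ξ y).count = (ξ y).count := by
  by_cases h1 : y = x
  · subst h1
    rcases h : ξ y with (_ | _ | n) | _ <;> simp [sleepAt, h, trySleep, count]
  · simp [sleepAt, h1]

theorem count_eq_zero {o : Occ} : o.count = 0 ↔ o = .active 0 := by
  cases o <;> simp [count]

theorem FinCfg.sleepAt {N : ℕ} {ξ : Config d} (h : FinCfg N ξ) (x : Site d) :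
    FinCfg N (sleepAt x ξ) := by
  obtain ⟨F, h1, h2⟩ := h
  refine ⟨F, fun y hy => ?_, ?_⟩
  · rw [← count_eq_zero, count_sleepAt, count_eq_zero, h1 y hy]
  · simpa only [count_sleepAt] using h2

theorem FinCfg.jumpAt {N : ℕ} {ξ : Config d} (h : FinCfg N ξ) {x z : Site d}
    (hx : 1 ≤ (ξ x).activeCount) (hz : z ≠ 0) : FinCfg N (jumpAt x z ξ) := by
  obtain ⟨F, h1, h2⟩ := h
  have hxF : x ∈ F := by
    by_contra hc
    rw [h1 x hc] at hx
    simp [activeCount] at hx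
  refine ⟨insert (x + z) F, fun y hy => ?_, ?_⟩
  · rw [Finset.mem_insert, not_or] at hy
    have := count_jumpAt hx hz y
    rw [if_neg (fun hyx : y = x => hy.2 (hyx ▸ hxF)), if_neg hy.1, h1 y hy.2] at this
    exact count_eq_zero.1 (by simpa [count] using this)
  · have h3 : ∑ y ∈ insert (x + z) F, (ξ y).count = ∑ y ∈ F, (ξ y).count :=
      (Finset.sum_subset (Finset.subset_insert _ _) fun y _ hy => by
        rw [h1 y hy]; rfl).symm
    have h4 := Finset.sum_congr rfl fun y (_ : y ∈ insert (x + z) F) => count_jumpAt hx hz y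
    rw [Finset.sum_add_distrib, Finset.sum_add_distrib, Finset.sum_ite_eq', Finset.sum_ite_eq',
      if_pos (Finset.mem_insert_of_mem hxF), if_pos (Finset.mem_insert_self _ _)] at h4
    omega

theorem FinCfg.applyAt {N : ℕ} {ξ : Config d} (h : FinCfg N ξ) {x : Site d}
    (hx : 1 ≤ (ξ x).activeCount) {i : Instr d} (hi : ∀ z, i = .jump z → z ∈ nbs d) :
    FinCfg N (i.applyAt x ξ) := by
  cases i with
  | sleep => exact h.sleepAt x
  | jump z => exact h.jumpAt hx (ne_zero_of_mem_nbs (hi z rfl))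

theorem NbField.shiftField {I : InstrField d} (hI : NbField I) (h : Site d → ℕ) :
    NbField (shiftField I h) := fun q z hq => hI (q.1, h q.1 + q.2) z hq

/-- The parallel toppling is carried out one site at a time by `cfg_add`. A site of `A` that has not
toppled yet stays active, as it can only have received particles. -/
theorem FinCfg.cfg_indicator {N : ℕ} {ξ : Config d} (h : FinCfg N ξ) {I : InstrField d}
    (hI : NbField I) (A : Finset (Site d)) (hA : ∀ x ∈ A, 1 ≤ (ξ x).activeCount) :
    FinCfg N (cfg ξ I fun x => if x ∈ A then 1 else 0) := by
  induction A using Finset.induction_on with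
  | empty => simpa [← Pi.zero_def] using h
  | insert a A ha ih =>
    have ih := ih fun x hx => hA x (Finset.mem_insert_of_mem hx)
    have hl : ∀ x, LegalAt ξ I (fun x => if x ∈ A then 1 else 0) x := fun x =>
      legalAt_of_le_one (by split_ifs <;> simp) fun hx => hA x (Finset.mem_insert_of_mem (by
        by_contra hc; simp [hc] at hx))
    have he : (fun x => if x ∈ insert a A then 1 else 0) =
        (fun x => if x ∈ A then 1 else 0) + Pi.single a 1 := by
      ext x
      by_cases hx : x = a
      · subst hx; simp [ha]
      · simp [hx]
    have hI' := hI.shiftField fun x => if x ∈ A then 1 else 0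
    rw [he, cfg_add hl, cfg_single fun z => hI' (a, 0) z]
    refine ih.applyAt ?_ fun z => hI' (a, 0) z
    have h0 := rank_cfg_mono (legalAt_zero ξ I a) (η' := ξ) (h' := fun x => if x ∈ A then 1 else 0)
      le_rfl (by simp [ha]) fun z _ => by simp
    rw [cfg_zero] at h0
    exact (hA a (Finset.mem_insert_self a A)).trans (activeCount_mono h0)

theorem FinCfg.cfg_ringing {N : ℕ} {ξ : Config d} (h : FinCfg N ξ) {I : InstrField d}
    (hI : NbField I) (b : Site d × ℕ → Bool) : FinCfg N (cfg ξ I (ringing ξ b)) := by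
  classical
  obtain ⟨F, h1, h2⟩ := h
  have he : ringing ξ b = fun x =>
      if x ∈ F.filter (fun x => Rings (ξ x) fun m => b (x, m)) then 1 else 0 := by
    ext x
    rw [ringing]
    refine if_congr ?_ rfl rfl
    rw [Finset.mem_filter]
    refine ⟨fun hr => ⟨?_, hr⟩, fun hr => hr.2⟩
    by_contra hc
    have := hr.active
    rw [h1 x hc] at this
    simp [activeCount] at this
  rw [he]
  exact FinCfg.cfg_indicator ⟨F, h1, h2⟩ hI _ fun x hx => (Finset.mem_filter.1 hx).2.active

theorem finCfg_truncate (V : Finset (Site d)) (η : Config d) :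
    FinCfg (∑ x ∈ V, (truncate V η x).count) (truncate V η) :=
  ⟨V, fun x hx => by simp [truncate, hx], le_rfl⟩

/-! ### One step of the discrete chain -/

/-- The law of the field of instructions. -/
abbrev fieldLaw (lam : ℝ≥0) (p : PMF (Site d)) : Measure (InstrField d) :=
  Measure.infinitePi fun _ : Site d × ℕ => (instrPMF lam p).toMeasure

theorem instrPMF_jump (lam : ℝ≥0) (p : PMF (Site d)) (z : Site d) :
    instrPMF lam p (.jump z) = p z / (1 + lam) := rfl

theorem instrPMF_sleep (lam : ℝ≥0) (p : PMF (Site d)) :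
    instrPMF lam p .sleep = lam / (1 + lam) := rfl

theorem apply_eq_zero_of_notMem_nbs {p : PMF (Site d)} (hp : p.support ⊆ neighbors d)
    {z : Site d} (hz : z ∉ nbs d) : p z = 0 := by
  by_contra h
  exact hz (mem_nbs.2 (hp ((PMF.mem_support_iff p z).2 h)))

theorem ae_instr_mem_nbs (lam : ℝ≥0) {p : PMF (Site d)} (hp : p.support ⊆ neighbors d) :
    ∀ᵐ i ∂(instrPMF lam p).toMeasure, ∀ z, i = .jump z → z ∈ nbs d := by
  rw [ae_iff, PMF.toMeasure_apply_eq_zero_iff _ .of_discrete, Set.disjoint_left]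
  intro i hi hc
  simp only [Set.mem_ofPred_eq, not_forall] at hc
  obtain ⟨z, rfl, hz⟩ := hc
  rw [PMF.mem_support_iff, instrPMF_jump, apply_eq_zero_of_notMem_nbs hp hz] at hi
  simp at hi

theorem ae_nbField (lam : ℝ≥0) {p : PMF (Site d)} (hp : p.support ⊆ neighbors d) :
    ∀ᵐ I ∂fieldLaw lam p, NbField I :=
  ae_all_iff.2 fun q => (measurePreserving_eval_infinitePi
    (fun _ : Site d × ℕ => (instrPMF lam p).toMeasure) q).quasiMeasurePreserving.ae
      (ae_instr_mem_nbs lam hp)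

/-- Use the field `I` below the odometer `h`, and the fresh field `I'` above it. -/
def mixField (h : Site d → ℕ) (w : InstrField d × InstrField d) : InstrField d := fun q =>
  if q.2 < h q.1 then w.1 q else w.2 (q.1, q.2 - h q.1)

/-- For a deterministic `h`, the instructions above `h` may be replaced by a fresh independent
field; this expresses that the unused instructions are independent of the used ones and have the
same law. -/
theorem measurePreserving_mixField (lam : ℝ≥0) (p : PMF (Site d)) (h : Site d → ℕ) :
    MeasurePreserving (mixField h) ((fieldLaw lam p).prod (fieldLaw lam p)) (fieldLaw lam p) :=
  map_mix _ _ _ (fun q : Site d × ℕ => q.2 < h q.1) (a := id) (b := fun q : Site d × ℕ => (q.1, q.2 - h q.1))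
    Function.injective_id.injOn (fun q hq r hr hqr => by
      simp only [Set.mem_ofPred_eq, not_lt, Prod.mk.injEq] at hq hr hqr
      obtain ⟨q1, q2⟩ := q
      obtain ⟨r1, r2⟩ := r
      obtain ⟨rfl, h2⟩ := hqr
      simp only at *
      congr 1
      omega)
    (fun _ _ => rfl) fun _ _ => rfl

theorem shiftField_mixField (h : Site d → ℕ) (w : InstrField d × InstrField d) :
    shiftField (mixField h w) h = w.2 := by
  ext q
  simp [shiftField, mixField]

theorem cfg_congr_field {η : Config d} {I I' : InstrField d} {h : Site d → ℕ}
    (hI : ∀ x, ∀ j < h x, I (x, j) = I' (x, j)) : cfg η I h = cfg η I' h := by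
  have ha : ∀ x, arrivals I h x = arrivals I' h x := fun x =>
    Finset.sum_congr rfl fun z _ => by
      simp only [Nat.count_eq_card_filter_range]
      congr 1
      refine Finset.filter_congr fun j hj => ?_
      rw [hI _ _ (Finset.mem_range.1 hj)]
  ext x
  rw [cfg, cfg, loaded, loaded, ha]
  exact run_congr fun j hj => hI x j hj

theorem cfg_mixField (ξ : Config d) (h : Site d → ℕ) (w : InstrField d × InstrField d) :
    cfg ξ (mixField h w) h = cfg ξ w.1 h :=
  cfg_congr_field fun x j hj => by simp [mixField, hj]

/-- Use the clocks `B` in the first time step, and the fresh clocks `B'` afterwards. -/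
def mixClocks (w : Clocks d × Clocks d) : Clocks d := fun c =>
  if c.2.2 = 0 then w.1 c else w.2 (c.1, c.2.1, c.2.2 - 1)

theorem measurePreserving_mixClocks (d : ℕ) (q : unitInterval) :
    MeasurePreserving (mixClocks (d := d)) ((clockLaw d q).prod (clockLaw d q)) (clockLaw d q) :=
  map_mix _ _ _ (fun c : Site d × ℕ × ℕ => c.2.2 = 0) (a := id) (b := fun c : Site d × ℕ × ℕ => (c.1, c.2.1, c.2.2 - 1))
    Function.injective_id.injOn (fun q hq r hr hqr => by
      obtain ⟨q1, q2, q3⟩ := q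
      obtain ⟨r1, r2, r3⟩ := r
      simp only [Set.mem_ofPred_eq, Prod.mk.injEq] at hq hr hqr
      obtain ⟨rfl, rfl, h2⟩ := hqr
      have : q3 = r3 := by omega
      rw [this])
    (fun _ _ => rfl) fun _ _ => rfl

/-- The clocks of the first time step. -/
def slice (B : Clocks d) : Site d × ℕ → Bool := fun c => B (c.1, c.2, 0)

/-- The clocks after the first time step. -/
def tail (B : Clocks d) : Clocks d := fun c => B (c.1, c.2.1, 1 + c.2.2)

theorem measurable_slice : Measurable (slice (d := d)) :=
  measurable_pi_lambda _ fun _ => measurable_pi_apply _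

theorem measurable_tail : Measurable (tail (d := d)) :=
  measurable_pi_lambda _ fun _ => measurable_pi_apply _

theorem slice_mixClocks (w : Clocks d × Clocks d) : slice (mixClocks w) = slice w.1 := by
  ext c; simp [slice, mixClocks]

theorem tail_mixClocks (w : Clocks d × Clocks d) : tail (mixClocks w) = w.2 := by
  ext c; simp [tail, mixClocks]

/-- The configuration after one step of the chain. -/
def step (ξ : Config d) (w : InstrField d × Clocks d) : Config d :=
  cfg ξ w.1 (ringing ξ (slice w.2))

/-- The instructions and clocks that remain after one step of the chain. -/
def remaining (ξ : Config d) (w : InstrField d × Clocks d) : InstrField d × Clocks d :=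
  (shiftField w.1 (ringing ξ (slice w.2)), tail w.2)

/-- The law of instructions and clocks. -/
abbrev stepLaw (lam : ℝ≥0) (p : PMF (Site d)) (q : unitInterval) :
    Measure (InstrField d × Clocks d) :=
  (fieldLaw lam p).prod (clockLaw d q)

theorem measurable_step : Measurable fun w : Config d × (InstrField d × Clocks d) =>
    step w.1 w.2 :=
  measurable_cfg measurable_fst (measurable_fst.comp measurable_snd)
    (measurable_ringing measurable_fst
      (measurable_slice.comp (measurable_snd.comp measurable_snd)))

theorem measurable_shiftField {X : Type*} [MeasurableSpace X] {I : X → InstrField d}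
    {h : X → Site d → ℕ} (hI : Measurable I) (hh : Measurable h) :
    Measurable fun ω => shiftField (I ω) (h ω) := by
  refine measurable_pi_lambda _ fun q => ?_
  have h1 : Measurable fun w : (ℕ → Instr d) × ℕ => w.1 (w.2 + q.2) :=
    measurable_from_prod_countable_left fun k => measurable_pi_apply (k + q.2)
  exact h1.comp (Measurable.prodMk
    (measurable_pi_lambda _ fun j => (measurable_pi_apply (q.1, j)).comp hI)
    ((measurable_pi_apply q.1).comp hh))

theorem measurable_remaining : Measurable fun w : Config d × (InstrField d × Clocks d) =>
    remaining w.1 w.2 :=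
  (measurable_shiftField (measurable_fst.comp measurable_snd) (measurable_ringing measurable_fst
    (measurable_slice.comp (measurable_snd.comp measurable_snd)))).prodMk
    (measurable_tail.comp (measurable_snd.comp measurable_snd))

theorem measurable_comp_cfg_ringing {F : Config d × (InstrField d × Clocks d) → ℝ≥0∞}
    (hF : Measurable F) (ξ : Config d) {X : Type*} [MeasurableSpace X] {I I' : X → InstrField d}
    {b : X → Site d × ℕ → Bool} {B : X → Clocks d} (hI : Measurable I) (hI' : Measurable I')
    (hb : Measurable b) (hB : Measurable B) :
    Measurable fun x => F (cfg ξ (I x) (ringing ξ (b x)), (I' x, B x)) :=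
  hF.comp ((measurable_cfg measurable_const hI (measurable_ringing measurable_const hb)).prodMk
    (hI'.prodMk hB))

/-- The Markov property of the discrete chain. -/
theorem lintegral_step (lam : ℝ≥0) (p : PMF (Site d)) (q : unitInterval)
    {F : Config d × (InstrField d × Clocks d) → ℝ≥0∞} (hF : Measurable F) (ξ : Config d) :
    ∫⁻ w, F (step ξ w, remaining ξ w) ∂stepLaw lam p q =
      ∫⁻ w, ∫⁻ w', F (step ξ w, w') ∂stepLaw lam p q ∂stepLaw lam p q := by
  have hstep : Measurable (step ξ) := measurable_step.comp measurable_prodMk_left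
  have hrem : Measurable (remaining ξ) := measurable_remaining.comp measurable_prodMk_left
  obtain ⟨G, hGdef⟩ : ∃ G : (Site d × ℕ → Bool) → Clocks d → ℝ≥0∞, ∀ b B', G b B' =
      ∫⁻ I, ∫⁻ I', F (cfg ξ I (ringing ξ b), (I', B')) ∂fieldLaw lam p ∂fieldLaw lam p :=
    ⟨_, fun _ _ => rfl⟩
  have hG : Measurable fun w : (Site d × ℕ → Bool) × Clocks d => G w.1 w.2 := by
    simp only [hGdef]
    refine Measurable.lintegral_prod_right' (f := fun v : ((Site d × ℕ → Bool) × Clocks d) ×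
      InstrField d => ∫⁻ I', F (cfg ξ v.2 (ringing ξ v.1.1), (I', v.1.2)) ∂fieldLaw lam p) ?_
    refine Measurable.lintegral_prod_right' (f := fun v : (((Site d × ℕ → Bool) × Clocks d) ×
      InstrField d) × InstrField d => F (cfg ξ v.1.2 (ringing ξ v.1.1.1), (v.2, v.1.1.2))) ?_
    exact measurable_comp_cfg_ringing hF ξ (measurable_snd.comp measurable_fst) measurable_snd
      (measurable_fst.comp (measurable_fst.comp measurable_fst))
      (measurable_snd.comp (measurable_fst.comp measurable_fst))
  -- The clocks are frozen first: then the set of toppling sites is deterministic, and the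
  -- instructions above it can be resampled.
  have h1 : ∀ B, ∫⁻ I, F (step ξ (I, B), remaining ξ (I, B)) ∂fieldLaw lam p =
      G (slice B) (tail B) := by
    intro B
    have hm : Measurable fun I => F (step ξ (I, B), remaining ξ (I, B)) :=
      hF.comp ((hstep.comp measurable_prodMk_right).prodMk (hrem.comp measurable_prodMk_right))
    rw [← (measurePreserving_mixField lam p (ringing ξ (slice B))).lintegral_comp hm, hGdef]
    simp only [step, remaining, cfg_mixField, shiftField_mixField]
    rw [lintegral_prod]
    exact (measurable_comp_cfg_ringing hF ξ measurable_fst measurable_snd measurable_const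
      measurable_const).aemeasurable
  -- The later clocks are resampled next; the first step only uses their first slice.
  have h2 : ∫⁻ B, G (slice B) (tail B) ∂clockLaw d q =
      ∫⁻ B, ∫⁻ B', G (slice B) B' ∂clockLaw d q ∂clockLaw d q := by
    have hm : Measurable fun B : Clocks d => G (slice B) (tail B) :=
      hG.comp (measurable_slice.prodMk measurable_tail)
    refine ((measurePreserving_mixClocks d q).lintegral_comp hm).symm.trans ?_
    simp only [slice_mixClocks, tail_mixClocks]
    rw [lintegral_prod]
    exact (hG.comp ((measurable_slice.comp measurable_fst).prodMk measurable_snd)).aemeasurable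
  have hm : Measurable fun w => F (step ξ w, remaining ξ w) := hF.comp (hstep.prodMk hrem)
  rw [lintegral_prod_symm' _ hm, lintegral_congr h1, h2, lintegral_prod_symm']
  · refine lintegral_congr fun B => ?_
    have h3 : ∀ I, ∫⁻ w', F (step ξ (I, B), w') ∂stepLaw lam p q =
        ∫⁻ B', ∫⁻ I', F (cfg ξ I (ringing ξ (slice B)), (I', B')) ∂fieldLaw lam p
          ∂clockLaw d q := fun I =>
      lintegral_prod_symm' _ (hF.comp measurable_prodMk_left)
    rw [lintegral_congr h3, lintegral_congr (hGdef _)]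
    refine lintegral_lintegral_swap ?_
    refine (Measurable.lintegral_prod_right' (f := fun v : (Clocks d × InstrField d) × InstrField d
      => F (cfg ξ v.1.2 (ringing ξ (slice B)), (v.2, v.1.1))) ?_).aemeasurable
    exact measurable_comp_cfg_ringing hF ξ (measurable_snd.comp measurable_fst) measurable_snd
      measurable_const (measurable_fst.comp measurable_fst)
  · exact Measurable.lintegral_prod_right' (f := fun v : (InstrField d × Clocks d) ×
      (InstrField d × Clocks d) => F (step ξ v.1, v.2))
      (hF.comp ((hstep.comp measurable_fst).prodMk measurable_snd))

/-! ### Finite-dimensional distributions of the discrete chain -/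

/-- The discrete path `γ`, from time `t` on, is in `A₁` at time `t + k₁`, in `A₂` at time
`t + k₁ + k₂`, and so on. -/
def Visits (γ : ℕ → Config d) : ℕ → List (ℕ × Set (Config d)) → Prop
  | _, [] => True
  | t, e :: l => γ (t + e.1) ∈ e.2 ∧ Visits γ (t + e.1) l

/-- The path of the discrete chain. -/
def path (ξ : Config d) (w : InstrField d × Clocks d) (i : ℕ) : Config d :=
  cfg ξ w.1 (chain ξ w.1 w.2 i)

theorem path_zero (ξ : Config d) (w : InstrField d × Clocks d) : path ξ w 0 = ξ :=
  cfg_zero ξ w.1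

/-- The abelian property in dynamic form: after one step the path is that of the chain started
afresh with the remaining randomness. -/
theorem path_succ (ξ : Config d) (w : InstrField d × Clocks d) (i : ℕ) :
    path ξ w (i + 1) = path (step ξ w) (remaining ξ w) i := by
  have h1 : chain ξ w.1 w.2 1 = ringing ξ (slice w.2) := by
    rw [chain, chain, zero_add, cfg_zero]
    rfl
  have h2 := chain_add ξ w.1 w.2 1 i
  rw [path, add_comm, h2, cfg_add (legalAt_chain _ _ _ 1), h1]
  rfl

theorem visits_shift {γ γ' : ℕ → Config d} (h : ∀ i, γ (i + 1) = γ' i) (t : ℕ)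
    (l : List (ℕ × Set (Config d))) : Visits γ (t + 1) l ↔ Visits γ' t l := by
  induction l generalizing t with
  | nil => rfl
  | cons e l ih =>
    rw [Visits, Visits, add_right_comm, h, ih]

theorem measurable_path (i : ℕ) : Measurable fun v : Config d × (InstrField d × Clocks d) =>
    path v.1 v.2 i :=
  measurable_cfg measurable_fst (measurable_fst.comp measurable_snd)
    (measurable_chain measurable_fst (measurable_fst.comp measurable_snd)
      (measurable_snd.comp measurable_snd) i)

theorem measurableSet_visits {X : Type*} [MeasurableSpace X] {γ : X → ℕ → Config d}
    (hγ : ∀ i, Measurable fun ω => γ ω i) (t : ℕ) (l : List (ℕ × Set (Config d)))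
    (hl : ∀ e ∈ l, MeasurableSet e.2) : MeasurableSet {ω | Visits (γ ω) t l} := by
  induction l generalizing t with
  | nil => simp [Visits]
  | cons e l ih =>
    exact ((hγ _) (hl e List.mem_cons_self)).inter
      (ih _ fun e he => hl e (List.mem_cons_of_mem _ he))

/-- The finite-dimensional distributions of the discrete chain. -/
def chainProb (lam : ℝ≥0) (p : PMF (Site d)) (q : unitInterval) (l : List (ℕ × Set (Config d)))
    (ξ : Config d) : ℝ≥0∞ :=
  stepLaw lam p q {w | Visits (path ξ w) 0 l}

theorem chainProb_le_one (lam : ℝ≥0) (p : PMF (Site d)) (q : unitInterval)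
    (l : List (ℕ × Set (Config d))) (ξ : Config d) : chainProb lam p q l ξ ≤ 1 := prob_le_one

theorem chainProb_nil (lam : ℝ≥0) (p : PMF (Site d)) (q : unitInterval) (ξ : Config d) :
    chainProb lam p q [] ξ = 1 := by
  simp [chainProb, Visits]

theorem chainProb_cons_zero (lam : ℝ≥0) (p : PMF (Site d)) (q : unitInterval)
    (A : Set (Config d)) (l : List (ℕ × Set (Config d))) (ξ : Config d) :
    chainProb lam p q ((0, A) :: l) ξ = A.indicator (chainProb lam p q l) ξ := by
  by_cases h : ξ ∈ A <;> simp [chainProb, Visits, path_zero, h]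

theorem chainProb_cons_succ (lam : ℝ≥0) (p : PMF (Site d)) (q : unitInterval) (k : ℕ)
    (A : Set (Config d)) (l : List (ℕ × Set (Config d))) (hA : MeasurableSet A)
    (hl : ∀ e ∈ l, MeasurableSet e.2) (ξ : Config d) :
    chainProb lam p q ((k + 1, A) :: l) ξ =
      ∫⁻ w, chainProb lam p q ((k, A) :: l) (step ξ w) ∂stepLaw lam p q := by
  have hl' : ∀ e ∈ (k, A) :: l, MeasurableSet e.2 := List.forall_mem_cons.2 ⟨hA, hl⟩
  have hE : MeasurableSet {v : Config d × (InstrField d × Clocks d) |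
      Visits (path v.1 v.2) 0 ((k, A) :: l)} :=
    measurableSet_visits measurable_path 0 _ hl'
  have h := lintegral_step lam p q (F := Set.indicator {v : Config d × (InstrField d × Clocks d) |
      Visits (path v.1 v.2) 0 ((k, A) :: l)} 1) (measurable_one.indicator hE) ξ
  have h1 : ∀ w, Visits (path ξ w) 0 ((k + 1, A) :: l) ↔
      Visits (path (step ξ w) (remaining ξ w)) 0 ((k, A) :: l) := fun w => by
    rw [Visits, Visits, ← path_succ, zero_add, zero_add,
      visits_shift fun i => path_succ ξ w i]
  have hm : Measurable fun w => (step ξ w, remaining ξ w) :=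
    (measurable_step.comp measurable_prodMk_left).prodMk
      (measurable_remaining.comp measurable_prodMk_left)
  have h2 : chainProb lam p q ((k + 1, A) :: l) ξ =
      ∫⁻ w, Set.indicator {v : Config d × (InstrField d × Clocks d) |
        Visits (path v.1 v.2) 0 ((k, A) :: l)} 1 (step ξ w, remaining ξ w) ∂stepLaw lam p q := by
    rw [chainProb, show {w | Visits (path ξ w) 0 ((k + 1, A) :: l)} =
      {w | Visits (path (step ξ w) (remaining ξ w)) 0 ((k, A) :: l)} from Set.ext h1]
    exact (lintegral_indicator_one (hm hE)).symm
  rw [h2, h]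
  refine lintegral_congr fun w => ?_
  rw [chainProb]
  exact lintegral_indicator_one (measurable_prodMk_left hE)

/-! ### The generator on configurations with at most `N` particles -/

theorem generator_eq_sum (lam : ℝ≥0) {p : PMF (Site d)} (hp : p.support ⊆ neighbors d)
    {ξ : Config d} {F : Finset (Site d)} (hF : ∀ x ∉ F, ξ x = .active 0) (f : Config d → ℝ) :
    generator lam p f ξ = ∑ x ∈ F, ((ξ x).activeCount : ℝ) * ((lam : ℝ) * (f (sleepAt x ξ) - f ξ) +
      ∑ z ∈ nbs d, (p z).toReal * (f (jumpAt x z ξ) - f ξ)) := by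
  rw [generator, tsum_eq_sum (s := F) fun x hx => by simp [hF x hx, activeCount]]
  refine Finset.sum_congr rfl fun x _ => ?_
  rw [tsum_eq_sum (s := nbs d) fun z hz => by simp [apply_eq_zero_of_notMem_nbs hp hz]]

theorem integral_instr (lam : ℝ≥0) {p : PMF (Site d)} (hp : p.support ⊆ neighbors d)
    {g : Instr d → ℝ} {M : ℝ} (hg : ∀ i, |g i| ≤ M) :
    ∫ i, g i ∂(instrPMF lam p).toMeasure =
      (1 + lam : ℝ)⁻¹ * (lam * g .sleep + ∑ z ∈ nbs d, (p z).toReal * g (.jump z)) := by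
  have hint : Integrable g (instrPMF lam p).toMeasure :=
    Integrable.of_bound (Measurable.of_discrete).aestronglyMeasurable M (ae_of_all _ hg)
  have hw : ((1 + lam : ℝ≥0∞)⁻¹).toReal = (1 + lam : ℝ)⁻¹ := by
    rw [ENNReal.toReal_inv, ENNReal.toReal_add (by simp) (by simp)]
    simp
  rw [PMF.integral_eq_tsum _ _ hint, tsum_eq_sum
    (s := insert Instr.sleep ((nbs d).image Instr.jump)), Finset.sum_insert (by simp),
    Finset.sum_image (by simp), mul_add, Finset.mul_sum]
  · congr 1
    · rw [instrPMF_sleep, div_eq_mul_inv, ENNReal.toReal_mul, hw, smul_eq_mul]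
      simp
      ring
    · refine Finset.sum_congr rfl fun z _ => ?_
      rw [instrPMF_jump, div_eq_mul_inv, ENNReal.toReal_mul, hw, smul_eq_mul]
      ring
  · intro i hi
    rcases i with _ | z
    · simp at hi
    · have hz : z ∉ nbs d := fun h => hi (by simp [h])
      simp [instrPMF_jump, apply_eq_zero_of_notMem_nbs hp hz]

/-- The mean of a function after one toppling at `x`. -/
theorem integral_cfg_single (lam : ℝ≥0) {p : PMF (Site d)} (hp : p.support ⊆ neighbors d)
    (ξ : Config d) (x : Site d) {f : Config d → ℝ} {M : ℝ} (hf : ∀ ξ, |f ξ| ≤ M) :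
    ∫ I, f (cfg ξ I (Pi.single x 1)) ∂fieldLaw lam p =
      (1 + lam : ℝ)⁻¹ * (lam * f (sleepAt x ξ) +
        ∑ z ∈ nbs d, (p z).toReal * f (jumpAt x z ξ)) := by
  have h1 : ∫ I, f (cfg ξ I (Pi.single x 1)) ∂fieldLaw lam p =
      ∫ I : InstrField d, f ((I (x, 0)).applyAt x ξ) ∂fieldLaw lam p :=
    integral_congr_ae ((ae_nbField lam hp).mono fun I hI => by
      simp only [cfg_single fun z => hI (x, 0) z])
  have h2 := (measurePreserving_eval_infinitePi
    (fun _ : Site d × ℕ => (instrPMF lam p).toMeasure) (x, 0))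
  have h3 := integral_map (μ := fieldLaw lam p) h2.measurable.aemeasurable
    (f := fun i : Instr d => f (i.applyAt x ξ)) (Measurable.of_discrete).aestronglyMeasurable
  rw [h2.map_eq] at h3
  rw [h1]
  exact h3.symm.trans (integral_instr lam hp fun i => hf _)

/-- The set of active particles of a configuration supported in `F`. -/
def activeSet (ξ : Config d) (F : Finset (Site d)) : Finset (Σ _ : Site d, ℕ) :=
  F.sigma fun x => Finset.range (ξ x).activeCount

theorem card_activeSet_le {N : ℕ} {ξ : Config d} {F : Finset (Site d)}
    (h : ∑ x ∈ F, (ξ x).count ≤ N) : (activeSet ξ F).card ≤ N := by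
  rw [activeSet, Finset.card_sigma]
  simp only [Finset.card_range]
  exact (Finset.sum_le_sum fun x _ => activeCount_le_count _).trans h

theorem sum_activeSet (ξ : Config d) (F : Finset (Site d)) (g : Site d → ℝ) :
    ∑ c ∈ activeSet ξ F, g c.1 = ∑ x ∈ F, ((ξ x).activeCount : ℝ) * g x := by
  rw [activeSet, Finset.sum_sigma]
  simp

theorem ringing_eq (ξ : Config d) {F : Finset (Site d)} (hF : ∀ x ∉ F, ξ x = .active 0)
    (b : Site d × ℕ → Bool) (x : Site d) : ringing ξ b x =
      if x ∈ ((activeSet ξ F).filter fun c => b (c.1, c.2) = true).image Sigma.fst then 1 else 0 := by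
  suffices h : Rings (ξ x) (fun m => b (x, m)) ↔
      x ∈ ((activeSet ξ F).filter fun c => b (c.1, c.2) = true).image Sigma.fst by
    split_ifs with hx
    · exact ringing_eq_one.2 (h.2 hx)
    · exact ringing_eq_zero.2 fun hr => hx (h.1 hr)
  simp only [Rings, activeSet, Finset.mem_image, Finset.mem_filter, Finset.mem_sigma,
    Finset.mem_range]
  constructor
  · rintro ⟨m, hm, hb⟩
    refine ⟨⟨x, m⟩, ⟨⟨?_, hm⟩, hb⟩, rfl⟩
    by_contra hx
    rw [hF x hx] at hm
    simp [activeCount] at hm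
  · rintro ⟨⟨y, m⟩, ⟨⟨_, hm⟩, hb⟩, rfl⟩
    exact ⟨m, hm, hb⟩

/-- The first-order expansion of one step, with an error controlled by the number of pairs of
ringing clocks. -/
theorem abs_step_sub_le (ξ : Config d) {F : Finset (Site d)} (hF : ∀ x ∉ F, ξ x = .active 0)
    (I : InstrField d) (b : Site d × ℕ → Bool) {f : Config d → ℝ} {M : ℝ} (hf : ∀ ξ, |f ξ| ≤ M) :
    |f (cfg ξ I (ringing ξ b)) - f ξ - ∑ c ∈ activeSet ξ F,
      (if b (c.1, c.2) = true then 1 else 0) * (f (cfg ξ I (Pi.single c.1 1)) - f ξ)| ≤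
    4 * M * ∑ c ∈ (activeSet ξ F).offDiag,
      if b (c.1.1, c.1.2) = true ∧ b (c.2.1, c.2.2) = true then 1 else 0 := by
  have hM : 0 ≤ M := (abs_nonneg _).trans (hf ξ)
  set T := (activeSet ξ F).filter fun c => b (c.1, c.2) = true with hT
  have h1 : ∑ c ∈ activeSet ξ F, (if b (c.1, c.2) = true then (1 : ℝ) else 0) *
      (f (cfg ξ I (Pi.single c.1 1)) - f ξ) =
      ∑ c ∈ T, (f (cfg ξ I (Pi.single c.1 1)) - f ξ) := by
    simp only [hT, Finset.sum_filter, ite_mul, one_mul, zero_mul]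
  have h2 : ∑ c ∈ (activeSet ξ F).offDiag,
      (if b (c.1.1, c.1.2) = true ∧ b (c.2.1, c.2.2) = true then (1 : ℝ) else 0) =
      (T.card : ℝ) * T.card - T.card := by
    rw [← Finset.sum_filter, Finset.sum_const, nsmul_one]
    have h3 : (activeSet ξ F).offDiag.filter
        (fun c => b (c.1.1, c.1.2) = true ∧ b (c.2.1, c.2.2) = true) = T.offDiag := by
      ext c
      simp only [hT, Finset.mem_filter, Finset.mem_offDiag]
      tauto
    rw [h3, Finset.offDiag_card, Nat.cast_sub (Nat.le_mul_self _), Nat.cast_mul]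
  rw [h1, h2]
  have hr := ringing_eq ξ hF b
  rw [← hT] at hr
  -- With at most one ringing clock the expansion is exact. With `k ≥ 2` ringing clocks the left
  -- side is at most `2 M (1 + k)`, which is below `4 M k (k - 1)`.
  obtain h0 | h0 | h0 : T.card = 0 ∨ T.card = 1 ∨ 2 ≤ T.card := by omega
  · have hT0 := Finset.card_eq_zero.1 h0
    have : ringing ξ b = 0 := by
      ext x; rw [hr, hT0]; simp
    rw [this, hT0]
    simp
  · obtain ⟨c, hc⟩ := Finset.card_eq_one.1 h0
    have : ringing ξ b = Pi.single c.1 1 := by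
      ext x
      rw [hr, hc]
      by_cases hx : x = c.1
      · subst hx; simp
      · simp [hx]
    rw [this, hc]
    simp
  · have h3 : (2 : ℝ) ≤ T.card := by exact_mod_cast h0
    have h4 : |∑ c ∈ T, (f (cfg ξ I (Pi.single c.1 1)) - f ξ)| ≤ T.card * (2 * M) := by
      refine (Finset.abs_sum_le_sum_abs _ _).trans ?_
      rw [← nsmul_eq_mul]
      refine Finset.sum_le_card_nsmul _ _ _ fun c _ => ?_
      exact (abs_sub _ _).trans (by linarith [hf (cfg ξ I (Pi.single c.1 1)), hf ξ])
    have h5 := hf (cfg ξ I (ringing ξ b))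
    have h6 := hf ξ
    refine (abs_sub _ _).trans ?_
    have h7 : |f (cfg ξ I (ringing ξ b)) - f ξ| ≤ 2 * M := (abs_sub _ _).trans (by linarith)
    nlinarith [mul_nonneg hM (by nlinarith : (0:ℝ) ≤ (T.card - 2) * T.card)]

/-- The countable set of configurations with at most `N` particles. -/
abbrev FinConfig (d N : ℕ) : Type := {ξ : Config d // FinCfg N ξ}

instance (N : ℕ) : TopologicalSpace (FinConfig d N) := ⊥

instance (N : ℕ) : DiscreteTopology (FinConfig d N) := ⟨rfl⟩

theorem countable_finCfg (N : ℕ) : {ξ : Config d | FinCfg N ξ}.Countable := by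
  have h : {ξ : Config d | FinCfg N ξ} ⊆ ⋃ F : Finset (Site d),
      Set.range fun (g : F → Occ) (x : Site d) => if h : x ∈ F then g ⟨x, h⟩ else .active 0 := by
    rintro ξ ⟨F, hF, -⟩
    refine Set.mem_iUnion.2 ⟨F, fun x => ξ x, ?_⟩
    ext x
    by_cases hx : x ∈ F <;> simp [hx, hF]
  exact (Set.countable_iUnion fun F => Set.countable_range _).mono h

open BoundedContinuousFunction Classical in
/-- Extension by zero of a function of configurations with at most `N` particles. -/
def extend {N : ℕ} (f : FinConfig d N →ᵇ ℝ) (ξ : Config d) : ℝ :=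
  if h : FinCfg N ξ then f ⟨ξ, h⟩ else 0

section Operators

open BoundedContinuousFunction

variable {N : ℕ}

theorem extend_of_finCfg (f : FinConfig d N →ᵇ ℝ) {ξ : Config d} (h : FinCfg N ξ) :
    extend f ξ = f ⟨ξ, h⟩ := dif_pos h

theorem abs_extend_le (f : FinConfig d N →ᵇ ℝ) (ξ : Config d) : |extend f ξ| ≤ ‖f‖ := by
  rw [extend]
  split_ifs with h
  · exact f.norm_coe_le_norm _
  · simp

/-- The extension vanishes off a countable set, and singletons of configurations are measurable. -/
theorem measurable_extend (f : FinConfig d N →ᵇ ℝ) : Measurable (extend f) := by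
  refine (measurable_const (a := (0 : ℝ))).measurable_of_countable_ne
    ((countable_finCfg N).mono fun ξ hξ => ?_)
  by_contra hc
  exact hξ (by rw [extend, dif_neg (show ¬ FinCfg N ξ from hc)])

theorem extend_add (f g : FinConfig d N →ᵇ ℝ) (ξ : Config d) :
    extend (f + g) ξ = extend f ξ + extend g ξ := by
  simp only [extend]
  split_ifs
  · rfl
  · simp

theorem extend_smul (c : ℝ) (f : FinConfig d N →ᵇ ℝ) (ξ : Config d) :
    extend (c • f) ξ = c * extend f ξ := by
  simp only [extend]
  split_ifs <;> simp

theorem integrable_extend_step (lam : ℝ≥0) (p : PMF (Site d)) (q : unitInterval)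
    (f : FinConfig d N →ᵇ ℝ) (ξ : Config d) :
    Integrable (fun w => extend f (step ξ w)) (stepLaw lam p q) :=
  Integrable.of_bound ((measurable_extend f).comp
    (measurable_step.comp measurable_prodMk_left)).aestronglyMeasurable ‖f‖
    (ae_of_all _ fun _ => abs_extend_le f _)

/-- The transition operator of the discrete chain. -/
def stepOp (lam : ℝ≥0) (p : PMF (Site d)) (q : unitInterval) (N : ℕ) :
    (FinConfig d N →ᵇ ℝ) →L[ℝ] (FinConfig d N →ᵇ ℝ) :=
  LinearMap.mkContinuous
    { toFun := fun f => ofNormedAddCommGroupDiscrete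
        (fun ξ => ∫ w, extend f (step ξ.1 w) ∂stepLaw lam p q) ‖f‖ fun ξ => by
          simpa using norm_integral_le_of_norm_le_const (μ := stepLaw lam p q)
            (f := fun w => extend f (step ξ.1 w)) (C := ‖f‖)
            (ae_of_all _ fun w => abs_extend_le f (step ξ.1 w))
      map_add' := fun f g => by
        ext ξ
        simp only [extend_add, coe_ofNormedAddCommGroupDiscrete, coe_add, Pi.add_apply]
        exact integral_add (integrable_extend_step lam p q f _) (integrable_extend_step lam p q g _)
      map_smul' := fun c f => by
        ext ξ
        simp only [extend_smul, coe_ofNormedAddCommGroupDiscrete, coe_smul, smul_eq_mul,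
          RingHom.id_apply]
        exact integral_const_mul _ _ }
    1 fun f => by
      rw [one_mul]
      exact (norm_le (norm_nonneg f)).2 fun ξ => by
        simpa using norm_integral_le_of_norm_le_const (μ := stepLaw lam p q)
          (f := fun w => extend f (step ξ.1 w)) (C := ‖f‖)
          (ae_of_all _ fun w => abs_extend_le f (step ξ.1 w))

theorem stepOp_apply (lam : ℝ≥0) (p : PMF (Site d)) (q : unitInterval)
    (f : FinConfig d N →ᵇ ℝ) (ξ : FinConfig d N) :
    stepOp lam p q N f ξ = ∫ w, extend f (step ξ.1 w) ∂stepLaw lam p q := rfl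

theorem norm_stepOp_le (lam : ℝ≥0) (p : PMF (Site d)) (q : unitInterval) :
    ‖stepOp lam p q N‖ ≤ 1 :=
  LinearMap.mkContinuous_norm_le _ zero_le_one _

variable {lam : ℝ≥0} {p : PMF (Site d)}

/-- Sleep at rate `lam` and jumps at total rate `1` amount to one clock of rate `1 + lam` per active
particle, followed by a random instruction. -/
theorem generator_eq_sum_integral (hp : p.support ⊆ neighbors d) {ξ : Config d}
    {F : Finset (Site d)} (hF : ∀ x ∉ F, ξ x = .active 0) {f : Config d → ℝ} {M : ℝ}
    (hf : ∀ ξ, |f ξ| ≤ M) :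
    generator lam p f ξ = (1 + lam) * ∑ c ∈ activeSet ξ F,
      (∫ I, f (cfg ξ I (Pi.single c.1 1)) ∂fieldLaw lam p - f ξ) := by
  rw [sum_activeSet ξ F fun x => ∫ I, f (cfg ξ I (Pi.single x 1)) ∂fieldLaw lam p - f ξ,
    generator_eq_sum lam hp hF, Finset.mul_sum]
  refine Finset.sum_congr rfl fun x _ => ?_
  have hsum : ∑ z ∈ nbs d, (p z).toReal = 1 := by
    have h1 := p.tsum_coe
    rw [tsum_eq_sum (s := nbs d) fun z hz => apply_eq_zero_of_notMem_nbs hp hz] at h1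
    rw [← ENNReal.toReal_sum fun z _ => p.apply_ne_top z, h1, ENNReal.toReal_one]
  rw [integral_cfg_single lam hp ξ x hf]
  simp only [mul_sub, Finset.sum_sub_distrib, ← Finset.sum_mul, hsum]
  field_simp
  ring

theorem abs_generator_le (hp : p.support ⊆ neighbors d) {ξ : Config d} (hξ : FinCfg N ξ)
    {f : Config d → ℝ} {M : ℝ} (hf : ∀ ξ, |f ξ| ≤ M) :
    |generator lam p f ξ| ≤ (1 + lam) * (N * 2) * M := by
  have hM : 0 ≤ M := (abs_nonneg _).trans (hf ξ)
  obtain ⟨F, hF, hN⟩ := hξ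
  rw [generator_eq_sum_integral hp hF hf, abs_mul, abs_of_nonneg (by positivity), mul_assoc]
  refine mul_le_mul_of_nonneg_left ?_ (by positivity)
  refine (Finset.abs_sum_le_sum_abs _ _).trans ((Finset.sum_le_card_nsmul _ _ (2 * M)
    fun c _ => ?_).trans ?_)
  · have h1 : |∫ I, f (cfg ξ I (Pi.single c.1 1)) ∂fieldLaw lam p| ≤ M := by
      simpa using norm_integral_le_of_norm_le_const (μ := fieldLaw lam p)
        (f := fun I => f (cfg ξ I (Pi.single c.1 1))) (C := M)
        (ae_of_all _ fun I => hf (cfg ξ I (Pi.single c.1 1)))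
    exact (abs_sub _ _).trans (by linarith [hf ξ])
  · have : ((activeSet ξ F).card : ℝ) ≤ N := Nat.cast_le.2 (card_activeSet_le hN)
    rw [nsmul_eq_mul, mul_assoc]
    exact mul_le_mul_of_nonneg_right this (by linarith)

/-- The generator, as a bounded operator on functions of configurations with at most `N`
particles. -/
def genOp (lam : ℝ≥0) {p : PMF (Site d)} (hp : p.support ⊆ neighbors d) (N : ℕ) :
    (FinConfig d N →ᵇ ℝ) →L[ℝ] (FinConfig d N →ᵇ ℝ) :=
  LinearMap.mkContinuous
    { toFun := fun f => ofNormedAddCommGroupDiscrete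
        (fun ξ => generator lam p (extend f) ξ.1) ((1 + lam) * (N * 2) * ‖f‖) fun ξ =>
          abs_generator_le hp ξ.2 (abs_extend_le f)
      map_add' := fun f g => by
        ext ξ
        obtain ⟨F, hF, -⟩ := ξ.2
        simp only [coe_ofNormedAddCommGroupDiscrete, coe_add, Pi.add_apply,
          generator_eq_sum lam hp hF, extend_add, ← Finset.sum_add_distrib]
        refine Finset.sum_congr rfl fun x _ => ?_
        rw [← mul_add]
        congr 1
        rw [add_add_add_comm, ← Finset.sum_add_distrib]
        congr 1
        · ring
        · exact Finset.sum_congr rfl fun z _ => by ring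
      map_smul' := fun c f => by
        ext ξ
        obtain ⟨F, hF, -⟩ := ξ.2
        simp only [coe_ofNormedAddCommGroupDiscrete, coe_smul, smul_eq_mul, RingHom.id_apply,
          generator_eq_sum lam hp hF, extend_smul, Finset.mul_sum]
        refine Finset.sum_congr rfl fun x _ => ?_
        simp only [mul_add, Finset.mul_sum]
        congr 1
        · ring
        · exact Finset.sum_congr rfl fun z _ => by ring }
    ((1 + lam) * (N * 2)) fun f =>
      (norm_le (by positivity)).2 fun ξ => abs_generator_le hp ξ.2 (abs_extend_le f)

theorem genOp_apply (hp : p.support ⊆ neighbors d) (f : FinConfig d N →ᵇ ℝ)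
    (ξ : FinConfig d N) : genOp lam hp N f ξ = generator lam p (extend f) ξ.1 := rfl

theorem clockLaw_pair (q : unitInterval) {c c' : Σ _ : Site d, ℕ} (h : c ≠ c') :
    ∫ B, (if slice B (c.1, c.2) = true ∧ slice B (c'.1, c'.2) = true then (1 : ℝ) else 0)
      ∂clockLaw d q = (q : ℝ) ^ 2 := by
  have hne : ((c.1, c.2, 0) : Site d × ℕ × ℕ) ≠ (c'.1, c'.2, 0) := fun he => h (by
    obtain ⟨c1, c2⟩ := c
    obtain ⟨c1', c2'⟩ := c'
    simp only [Prod.mk.injEq] at he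
    obtain ⟨rfl, rfl, -⟩ := he
    rfl)
  have h1 : {B : Clocks d | slice B (c.1, c.2) = true ∧ slice B (c'.1, c'.2) = true} =
      Set.pi (({(c.1, c.2, 0), (c'.1, c'.2, 0)} : Finset (Site d × ℕ × ℕ)) :
        Set (Site d × ℕ × ℕ)) fun _ => {true} := by
    ext B
    simp [slice]
  have h2 : clockLaw d q {B : Clocks d | slice B (c.1, c.2) = true ∧
      slice B (c'.1, c'.2) = true} = ENNReal.ofReal q ^ 2 := by
    rw [h1, Measure.infinitePi_pi _ fun i _ => measurableSet_singleton _, Finset.prod_pair hne,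
      bern_true, sq]
  have hm : MeasurableSet {B : Clocks d | slice B (c.1, c.2) = true ∧
      slice B (c'.1, c'.2) = true} :=
    (((measurable_pi_apply _).comp measurable_slice).setOf_discrete (· = true)).inter
      (((measurable_pi_apply _).comp measurable_slice).setOf_discrete (· = true))
  have h3 := integral_indicator_one (μ := clockLaw d q) hm
  rw [measureReal_def, h2, ENNReal.toReal_pow, ENNReal.toReal_ofReal q.2.1] at h3
  rw [← h3]
  refine integral_congr_ae (ae_of_all _ fun B => ?_)
  simp only [Set.indicator, Set.mem_ofPred_eq, Pi.one_apply]

theorem clockLaw_single (q : unitInterval) (c : Σ _ : Site d, ℕ) :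
    ∫ B, (if slice B (c.1, c.2) = true then (1 : ℝ) else 0) ∂clockLaw d q = q := by
  have hm : MeasurableSet {B : Clocks d | slice B (c.1, c.2) = true} :=
    ((measurable_pi_apply _).comp measurable_slice).setOf_discrete (· = true)
  have h2 : clockLaw d q {B : Clocks d | slice B (c.1, c.2) = true} = ENNReal.ofReal q := by
    rw [← bern_true]
    exact (measurePreserving_eval_infinitePi (fun _ : Site d × ℕ × ℕ => bern q)
      (c.1, c.2, 0)).measure_preimage (measurableSet_singleton true).nullMeasurableSet
  have h3 := integral_indicator_one (μ := clockLaw d q) hm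
  rw [measureReal_def, h2, ENNReal.toReal_ofReal q.2.1] at h3
  rw [← h3]
  refine integral_congr_ae (ae_of_all _ fun B => ?_)
  simp only [Set.indicator, Set.mem_ofPred_eq, Pi.one_apply]

/-- A single clock rings with probability `q`, which contributes `q/(1 + lam)` times the generator.
The error comes from pairs of ringing clocks: at most `N²` pairs, each of probability `q²`. -/
theorem norm_stepOp_sub_le (hp : p.support ⊆ neighbors d) (q : unitInterval) :
    ‖stepOp lam p q N - 1 - ((q : ℝ) / (1 + lam)) • genOp lam hp N‖ ≤ 4 * N ^ 2 * (q : ℝ) ^ 2 := by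
  refine ContinuousLinearMap.opNorm_le_bound _ (by positivity) fun f => ?_
  refine (norm_le (by positivity)).2 fun ξ => ?_
  obtain ⟨F, hF, hN⟩ := ξ.2
  have hb := abs_extend_le f
  simp only [_root_.sub_apply, _root_.smul_apply, coe_sub, Pi.sub_apply,
    one_apply_eq_self, coe_smul, stepOp_apply, genOp_apply, smul_eq_mul]
  have hfξ : f ξ = extend f ξ.1 := (extend_of_finCfg f ξ.2).symm
  rw [hfξ, generator_eq_sum_integral hp hF hb, ← mul_assoc,
    div_mul_cancel₀ _ (by positivity : (1 + lam : ℝ) ≠ 0), Finset.mul_sum]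
  have hmeas1 : ∀ x : Site d, Measurable fun I : InstrField d =>
      extend f (cfg ξ.1 I (Pi.single x 1)) := fun x =>
    (measurable_extend f).comp (measurable_cfg measurable_const measurable_id measurable_const)
  have hint1 : ∀ x : Site d, Integrable (fun I : InstrField d =>
      extend f (cfg ξ.1 I (Pi.single x 1))) (fieldLaw lam p) := fun x =>
    Integrable.of_bound (hmeas1 x).aestronglyMeasurable ‖f‖ (ae_of_all _ fun I => hb _)
  have hbit : ∀ c : Σ _ : Site d, ℕ, Measurable fun B : Clocks d =>
      if slice B (c.1, c.2) = true then (1 : ℝ) else 0 := fun c =>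
    Measurable.ite (((measurable_pi_apply _).comp measurable_slice).setOf_discrete (· = true))
      measurable_const measurable_const
  have hbit_int : ∀ c : Σ _ : Site d, ℕ, Integrable (fun B : Clocks d =>
      if slice B (c.1, c.2) = true then (1 : ℝ) else 0) (clockLaw d q) := fun c =>
    Integrable.of_bound (hbit c).aestronglyMeasurable 1 (ae_of_all _ fun B => by
      split_ifs <;> simp)
  have hterm_int : ∀ c : Σ _ : Site d, ℕ, Integrable (fun w : InstrField d × Clocks d =>
      (if slice w.2 (c.1, c.2) = true then (1 : ℝ) else 0) *
        (extend f (cfg ξ.1 w.1 (Pi.single c.1 1)) - extend f ξ.1)) (stepLaw lam p q) := fun c => by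
    have hs : Integrable (fun I => extend f (cfg ξ.1 I (Pi.single c.1 1)) - extend f ξ.1)
        (fieldLaw lam p) := (hint1 c.1).sub (integrable_const _)
    simpa only [mul_comm] using hs.mul_prod (hbit_int c)
  have hterm : ∀ c : Σ _ : Site d, ℕ, ∫ w : InstrField d × Clocks d,
      (if slice w.2 (c.1, c.2) = true then (1 : ℝ) else 0) *
        (extend f (cfg ξ.1 w.1 (Pi.single c.1 1)) - extend f ξ.1) ∂stepLaw lam p q =
      q * (∫ I, extend f (cfg ξ.1 I (Pi.single c.1 1)) ∂fieldLaw lam p - extend f ξ.1) := by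
    intro c
    have h := integral_prod_mul (μ := fieldLaw lam p) (ν := clockLaw d q)
      (fun I => extend f (cfg ξ.1 I (Pi.single c.1 1)) - extend f ξ.1)
      (fun B => if slice B (c.1, c.2) = true then (1 : ℝ) else 0)
    rw [clockLaw_single, integral_sub (hint1 c.1) (integrable_const _), integral_const,
      probReal_univ, one_smul, mul_comm] at h
    simpa only [mul_comm] using h
  rw [← Finset.sum_congr rfl fun c _ => hterm c, ← integral_finsetSum _ fun c _ => hterm_int c]
  have hconst : extend f ξ.1 = ∫ _, extend f ξ.1 ∂stepLaw lam p q := by simp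
  have hS := integrable_extend_step lam p q f ξ.1
  have hsub1 : ∫ w, extend f (step ξ.1 w) ∂stepLaw lam p q - extend f ξ.1 =
      ∫ w, (extend f (step ξ.1 w) - extend f ξ.1) ∂stepLaw lam p q := by
    rw [integral_sub hS (integrable_const _), ← hconst]
  have hS' : Integrable (fun w => extend f (step ξ.1 w) - extend f ξ.1) (stepLaw lam p q) :=
    hS.sub (integrable_const _)
  rw [hsub1, ← integral_sub hS' (integrable_finsetSum _ fun c _ => hterm_int c)]
  set err : InstrField d × Clocks d → ℝ := fun w => 4 * ‖f‖ *
    ∑ c ∈ (activeSet ξ.1 F).offDiag, if slice w.2 (c.1.1, c.1.2) = true ∧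
      slice w.2 (c.2.1, c.2.2) = true then 1 else 0 with herr
  have hpair_int : ∀ c : (Σ _ : Site d, ℕ) × (Σ _ : Site d, ℕ), Integrable (fun B : Clocks d =>
      if slice B (c.1.1, c.1.2) = true ∧ slice B (c.2.1, c.2.2) = true then (1 : ℝ) else 0)
      (clockLaw d q) := fun c =>
    Integrable.of_bound (Measurable.ite
      ((((measurable_pi_apply _).comp measurable_slice).setOf_discrete (· = true)).inter
        (((measurable_pi_apply _).comp measurable_slice).setOf_discrete (· = true)))
      measurable_const measurable_const).aestronglyMeasurable 1 (ae_of_all _ fun B => by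
        split_ifs <;> simp)
  have herr_int : Integrable err (stepLaw lam p q) :=
    (integrable_finsetSum _ fun c _ => (hpair_int c).comp_snd _).const_mul _
  have herr_val : ∫ w, err w ∂stepLaw lam p q = 4 * ‖f‖ *
      ((activeSet ξ.1 F).offDiag.card * (q : ℝ) ^ 2) := by
    rw [herr, integral_const_mul, integral_finsetSum _ fun c _ => (hpair_int c).comp_snd _,
      ← nsmul_eq_mul (_ : ℕ), ← Finset.sum_const]
    congr 1
    refine Finset.sum_congr rfl fun c hc => ?_
    rw [← clockLaw_pair (d := d) q (Finset.mem_offDiag.1 hc).2.2]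
    simpa using integral_fun_snd (μ := fieldLaw lam p) (ν := clockLaw d q) (f := fun B : Clocks d =>
      if slice B (c.1.1, c.1.2) = true ∧ slice B (c.2.1, c.2.2) = true then (1 : ℝ) else 0)
  refine (norm_integral_le_of_norm_le herr_int (ae_of_all _ fun w =>
    abs_step_sub_le ξ.1 hF w.1 (slice w.2) hb)).trans ?_
  rw [herr_val]
  have hcard : ((activeSet ξ.1 F).offDiag.card : ℝ) ≤ (N : ℝ) ^ 2 := by
    rw [Finset.offDiag_card, sq]
    have := card_activeSet_le hN
    exact_mod_cast (Nat.sub_le _ _).trans (Nat.mul_le_mul this this)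
  have : 0 ≤ ‖f‖ * (q : ℝ) ^ 2 := by positivity
  nlinarith

end Operators

/-- The exponential of a bounded operator. -/
def opExp {E : Type*} [NormedAddCommGroup E] [NormedSpace ℝ E] (A : E →L[ℝ] E) : E →L[ℝ] E :=
  NormedSpace.exp A

theorem hasSum_opExp {E : Type*} [NormedAddCommGroup E] [NormedSpace ℝ E] [CompleteSpace E]
    (A : E →L[ℝ] E) (v : E) (φ : E →L[ℝ] ℝ) :
    HasSum (fun k : ℕ => (k.factorial : ℝ)⁻¹ * φ ((A ^ k) v)) (φ (opExp A v)) := by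
  have h1 := NormedSpace.exp_series_hasSum_exp' (𝕂 := ℝ) A
  simpa [opExp] using (φ.comp (ContinuousLinearMap.apply ℝ E v)).hasSum h1

theorem tendsto_pow_opExp {E : Type*} [NormedAddCommGroup E] [NormedSpace ℝ E] [CompleteSpace E]
    (L : E →L[ℝ] E) {P : ℕ → E →L[ℝ] E} {ε : ℕ → ℝ} {k : ℕ → ℕ} {s C : ℝ}
    (hε : ∀ n, 0 < ε n) (hε0 : Tendsto ε atTop (𝓝 0)) (hP : ∀ n, ‖P n‖ ≤ 1)
    (hPL : ∀ n, ‖P n - 1 - ε n • L‖ ≤ C * ε n ^ 2)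
    (hk : Tendsto (fun n => k n * ε n) atTop (𝓝 s)) :
    Tendsto (fun n => P n ^ k n) atTop (𝓝 (opExp (s • L))) :=
  tendsto_pow_exp L hε hε0 hP hPL hk

section Convergence

open BoundedContinuousFunction

variable {N : ℕ} {lam : ℝ≥0} {p : PMF (Site d)}

/-! ### The semigroup as an operator exponential -/

/-- The dynamics does not leave the set of configurations with at most `N` particles; at sites
without active particles, where the moves would make no sense, the rate is zero. -/
theorem generator_congr (hp : p.support ⊆ neighbors d) {f g : Config d → ℝ}
    (h : ∀ ξ, FinCfg N ξ → f ξ = g ξ) {ξ : Config d} (hξ : FinCfg N ξ) :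
    generator lam p f ξ = generator lam p g ξ := by
  obtain ⟨F, hF, hN⟩ := hξ
  rw [generator_eq_sum lam hp hF, generator_eq_sum lam hp hF]
  refine Finset.sum_congr rfl fun x _ => ?_
  have hξ : FinCfg N ξ := ⟨F, hF, hN⟩
  rcases Nat.eq_zero_or_pos (ξ x).activeCount with h0 | h1
  · rw [h0]; simp
  · rw [h _ hξ, h _ (hξ.sleepAt x)]
    congr 2
    refine Finset.sum_congr rfl fun z hz => ?_
    rw [h _ (hξ.jumpAt h1 (ne_zero_of_mem_nbs hz))]

theorem generator_iterate (hp : p.support ⊆ neighbors d) {f : Config d → ℝ}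
    {g : FinConfig d N →ᵇ ℝ} (h : ∀ ξ : FinConfig d N, f ξ.1 = g ξ) (k : ℕ)
    (ξ : FinConfig d N) : (generator lam p)^[k] f ξ.1 = ((genOp lam hp N) ^ k) g ξ := by
  induction k generalizing f g with
  | zero => exact h ξ
  | succ k ih =>
    rw [Function.iterate_succ_apply, pow_succ]
    refine ih fun ζ => ?_
    refine Eq.trans ?_ (genOp_apply hp g ζ).symm
    exact generator_congr hp (fun ξ hξ => (h ⟨ξ, hξ⟩).trans (extend_of_finCfg g hξ).symm) ζ.2

/-- On configurations with at most `N` particles the generator is bounded, so evaluation at `ξ` can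
be taken inside the exponential series. -/
theorem semigroup_eq_exp (hp : p.support ⊆ neighbors d) {f : Config d → ℝ}
    {g : FinConfig d N →ᵇ ℝ} (h : ∀ ξ : FinConfig d N, f ξ.1 = g ξ) (t : ℝ≥0)
    (ξ : FinConfig d N) :
    semigroup lam p t f ξ.1 = opExp ((t : ℝ) • genOp lam hp N) g ξ := by
  have h2 := hasSum_opExp ((t : ℝ) • genOp lam hp N) g (evalCLM ℝ ξ)
  refine Eq.trans ?_ h2.tsum_eq
  rw [semigroup]
  refine tsum_congr fun k => ?_
  rw [generator_iterate hp h, smul_pow]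
  simp only [_root_.smul_apply, evalCLM_apply, coe_smul, smul_eq_mul]
  ring

/-- Multiplication by the indicator of `A`. -/
def indOp (N : ℕ) (A : Set (Config d)) : (FinConfig d N →ᵇ ℝ) →L[ℝ] (FinConfig d N →ᵇ ℝ) :=
  LinearMap.mkContinuous
    { toFun := fun f => ofNormedAddCommGroupDiscrete
        (fun ξ => A.indicator (fun _ => f ξ) ξ.1) ‖f‖ fun ξ =>
          (norm_indicator_le_norm_self (fun _ => f ξ) ξ.1).trans (f.norm_coe_le_norm ξ)
      map_add' := fun f g => by
        ext ξ
        by_cases h : ξ.1 ∈ A <;> simp [h]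
      map_smul' := fun c f => by
        ext ξ
        by_cases h : ξ.1 ∈ A <;> simp [h] }
    1 fun f => by
      rw [one_mul]
      exact (norm_le (norm_nonneg f)).2 fun ξ =>
        (norm_indicator_le_norm_self (fun _ => f ξ) ξ.1).trans (f.norm_coe_le_norm ξ)

theorem indOp_apply (A : Set (Config d)) (f : FinConfig d N →ᵇ ℝ) (ξ : FinConfig d N) :
    indOp N A f ξ = A.indicator (fun _ => f ξ) ξ.1 := rfl

/-- Finite-dimensional distributions as a function on the configurations with at most `N`
particles. -/
def expProb (lam : ℝ≥0) {p : PMF (Site d)} (hp : p.support ⊆ neighbors d) (N : ℕ) :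
    List (ℝ≥0 × Set (Config d)) → FinConfig d N →ᵇ ℝ
  | [] => BoundedContinuousFunction.const _ 1
  | e :: l => opExp ((e.1 : ℝ) • genOp lam hp N) (indOp N e.2 (expProb lam hp N l))

theorem finiteProb_eq_expProb (hp : p.support ⊆ neighbors d) (l : List (ℝ≥0 × Set (Config d)))
    (ξ : FinConfig d N) : finiteProb lam p l ξ.1 = expProb lam hp N l ξ := by
  induction l generalizing ξ with
  | nil => rfl
  | cons e l ih =>
    refine semigroup_eq_exp hp (fun ζ => ?_) e.1 ξ
    rw [indOp_apply]
    by_cases h : ζ.1 ∈ e.2 <;> simp [h, ih]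

/-! ### The transition operator of the discrete chain -/

theorem ae_finCfg_step (hp : p.support ⊆ neighbors d) (q : unitInterval) {ξ : Config d}
    (hξ : FinCfg N ξ) : ∀ᵐ w ∂stepLaw lam p q, FinCfg N (step ξ w) :=
  (Measure.quasiMeasurePreserving_fst.ae (ae_nbField lam hp)).mono fun _ hw =>
    hξ.cfg_ringing hw _

/-- Finite-dimensional distributions of the discrete chain as a function on the configurations with
at most `N` particles. -/
def stepProb (lam : ℝ≥0) (p : PMF (Site d)) (q : unitInterval) (N : ℕ) :
    List (ℕ × Set (Config d)) → FinConfig d N →ᵇ ℝ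
  | [] => BoundedContinuousFunction.const _ 1
  | e :: l => (stepOp lam p q N ^ e.1) (indOp N e.2 (stepProb lam p q N l))

theorem toReal_chainProb (hp : p.support ⊆ neighbors d) (q : unitInterval)
    (l : List (ℕ × Set (Config d))) (hl : ∀ e ∈ l, MeasurableSet e.2) (ξ : FinConfig d N) :
    (chainProb lam p q l ξ.1).toReal = stepProb lam p q N l ξ := by
  induction l generalizing ξ with
  | nil => rw [chainProb_nil]; rfl
  | cons e l ih =>
    obtain ⟨k, A⟩ := e
    replace ih := ih fun e he => hl e (List.mem_cons_of_mem _ he)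
    have hA := hl _ List.mem_cons_self
    have hl' : ∀ e ∈ l, MeasurableSet e.2 := fun e he => hl e (List.mem_cons_of_mem _ he)
    replace hA : MeasurableSet A := hA
    clear hl
    -- Inner induction on the number of steps before the next observation: the Markov property peels
    -- off one factor `stepOp`, and the chain almost surely stays among configurations with at most
    -- `N` particles.
    induction k generalizing ξ with
    | zero =>
      rw [chainProb_cons_zero, stepProb, pow_zero, one_apply_eq_self, indOp_apply]
      by_cases h : ξ.1 ∈ A
      · simp only [Set.indicator_of_mem h]; exact ih ξ
      · simp [h]
    | succ k ihk =>
      rw [chainProb_cons_succ lam p q k A l hA hl', stepProb, pow_succ', mul_apply_eq_comp,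
        stepOp_apply]
      have hm : ∀ᵐ w ∂stepLaw lam p q, (chainProb lam p q ((k, A) :: l) (step ξ.1 w)).toReal =
          extend (stepProb lam p q N ((k, A) :: l)) (step ξ.1 w) :=
        (ae_finCfg_step hp q ξ.2).mono fun w hw => by
          rw [extend_of_finCfg _ hw, ← ihk ⟨_, hw⟩]
      refine Eq.trans ?_ (integral_congr_ae hm)
      symm
      refine (integral_toReal ?_ (ae_of_all _ fun w =>
        (chainProb_le_one _ _ _ _ _).trans_lt ENNReal.one_lt_top))
      have hE : MeasurableSet {v : Config d × (InstrField d × Clocks d) |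
          Visits (path v.1 v.2) 0 ((k, A) :: l)} :=
        measurableSet_visits measurable_path 0 _ (List.forall_mem_cons.2 ⟨hA, hl'⟩)
      exact ((measurable_measure_prodMk_left hE).comp
        (measurable_step.comp measurable_prodMk_left)).aemeasurable

/-! ### Convergence as the mesh tends to zero -/

/-- The number of time steps of length `2⁻ⁿ` before time `t`. -/
def tick (n : ℕ) (t : ℝ≥0) : ℕ := ⌊(t : ℝ) * 2 ^ n⌋₊

theorem tick_mono (n : ℕ) : Monotone (tick n) := fun s t h =>
  Nat.floor_mono (mul_le_mul_of_nonneg_right (NNReal.coe_le_coe.2 h) (by positivity))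

theorem tendsto_tick (t : ℝ≥0) : Tendsto (fun n => (tick n t : ℝ) / 2 ^ n) atTop (𝓝 t) :=
  (tendsto_nat_floor_mul_div_atTop (R := ℝ) t.2).comp
    (tendsto_pow_atTop_atTop_of_one_lt one_lt_two)

theorem tendsto_ringProb (θ : ℝ≥0) :
    Tendsto (fun n => (2 : ℝ) ^ n * ringProb θ n) atTop (𝓝 θ) := by
  have h1 : HasDerivAt (fun x : ℝ => -Real.exp (-(θ * x))) (θ : ℝ) 0 := by
    have h0 : HasDerivAt (fun x : ℝ => -(θ * x)) (-(θ * 1 : ℝ)) 0 :=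
      ((hasDerivAt_id (0 : ℝ)).const_mul (θ : ℝ)).neg
    have h : HasDerivAt (fun x : ℝ => -Real.exp (-(θ * x)))
        (-(Real.exp (-(θ * 0)) * (-(θ * 1)))) 0 := h0.exp.neg
    simpa using h
  have h2 := hasDerivAt_iff_tendsto_slope_zero.1 h1
  have h3 : Tendsto (fun n : ℕ => ((2 : ℝ) ^ n)⁻¹) atTop (𝓝[≠] 0) :=
    tendsto_nhdsWithin_iff.2 ⟨tendsto_inv_atTop_zero.comp
      (tendsto_pow_atTop_atTop_of_one_lt one_lt_two),
      Eventually.of_forall fun n => by simp⟩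
  refine (h2.comp h3).congr fun n => ?_
  simp [ringProb, div_eq_mul_inv]
  ring

theorem ringProb_pos {θ : ℝ≥0} (hθ : 0 < θ) (n : ℕ) : 0 < (ringProb θ n : ℝ) := by
  have : Real.exp (-(θ / 2 ^ n : ℝ)) < 1 := Real.exp_lt_one_iff.2 (by
    rw [neg_lt_zero]; positivity)
  simp only [ringProb]
  linarith

theorem tendsto_ringProb_zero (θ : ℝ≥0) : Tendsto (fun n => (ringProb θ n : ℝ)) atTop (𝓝 0) := by
  have h := (tendsto_ringProb θ).mul (tendsto_inv_atTop_zero.comp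
      (tendsto_pow_atTop_atTop_of_one_lt (one_lt_two (α := ℝ))))
  rw [mul_zero] at h
  refine h.congr fun n => ?_
  simp only [Function.comp_apply]
  field_simp

/-- The times of a list in units of `2⁻ⁿ`. -/
def discretize (n : ℕ) : ℝ≥0 → List (ℝ≥0 × Set (Config d)) → List (ℕ × Set (Config d))
  | _, [] => []
  | t, e :: l => (tick n (t + e.1) - tick n t, e.2) :: discretize n (t + e.1) l

theorem measurableSet_of_mem_discretize {n : ℕ} {l : List (ℝ≥0 × Set (Config d))}
    (hl : ∀ e ∈ l, MeasurableSet e.2) (t : ℝ≥0) : ∀ e ∈ discretize n t l, MeasurableSet e.2 := by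
  induction l generalizing t with
  | nil => simp [discretize]
  | cons e l ih =>
    rw [discretize, List.forall_mem_cons]
    exact ⟨hl e List.mem_cons_self, ih (fun e he => hl e (List.mem_cons_of_mem _ he)) _⟩

/-- The step size is `ε = q/(1 + lam)` with `q` the ring probability, asymptotically `2⁻ⁿ`. The
number of steps times `ε` therefore tends to `s`, and the error `4 N² q²` becomes `C ε²` for the
chosen `C`. -/
theorem tendsto_stepOp_pow (hp : p.support ⊆ neighbors d) (t s : ℝ≥0) :
    Tendsto (fun n => stepOp lam p (ringProb (1 + lam) n) N ^ (tick n (t + s) - tick n t)) atTop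
      (𝓝 (opExp ((s : ℝ) • genOp lam hp N))) := by
  have hθ : (0 : ℝ≥0) < 1 + lam := by positivity
  have hθ' : (0 : ℝ) < 1 + lam := by positivity
  refine tendsto_pow_opExp (C := 4 * N ^ 2 * (1 + lam) ^ 2)
    (ε := fun n => (ringProb (1 + lam) n : ℝ) / (1 + lam)) _
    (fun n => div_pos (ringProb_pos hθ n) hθ') ?_ (fun n => norm_stepOp_le _ _ _)
    (fun n => (norm_stepOp_sub_le hp _).trans_eq ?_) ?_
  · simpa using (tendsto_ringProb_zero (1 + lam)).div_const (1 + lam : ℝ)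
  · field_simp
  · have h1 := ((tendsto_tick (t + s)).sub (tendsto_tick t)).mul
      ((tendsto_ringProb (1 + lam)).div_const (1 + lam : ℝ))
    have h2 : ((t + s : ℝ≥0) - t : ℝ) * ((1 + lam : ℝ≥0) / (1 + lam : ℝ)) = s := by
      push_cast
      field_simp
      ring
    rw [h2] at h1
    refine h1.congr fun n => ?_
    rw [Nat.cast_sub (tick_mono n (by simp))]
    field_simp

theorem tendsto_stepProb (hp : p.support ⊆ neighbors d) (t : ℝ≥0)
    (l : List (ℝ≥0 × Set (Config d))) :
    Tendsto (fun n => stepProb lam p (ringProb (1 + lam) n) N (discretize n t l)) atTop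
      (𝓝 (expProb lam hp N l)) := by
  induction l generalizing t with
  | nil => exact tendsto_const_nhds
  | cons e l ih =>
    exact ((isBoundedBilinearMap_apply (𝕜 := ℝ) (E := FinConfig d N →ᵇ ℝ)
      (F := FinConfig d N →ᵇ ℝ)).continuous.tendsto _).comp
      ((tendsto_stepOp_pow hp t e.1).prodMk_nhds
        (((indOp N e.2).continuous.tendsto _).comp (ih (t + e.1))))

/-- Convergence of the finite-dimensional distributions of the discrete chains. -/
theorem tendsto_chainProb (hp : p.support ⊆ neighbors d) {l : List (ℝ≥0 × Set (Config d))}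
    (hl : ∀ e ∈ l, MeasurableSet e.2) {ξ : Config d} (hξ : FinCfg N ξ) :
    Tendsto (fun n => (chainProb lam p (ringProb (1 + lam) n) (discretize n 0 l) ξ).toReal) atTop
      (𝓝 (finiteProb lam p l ξ)) := by
  rw [finiteProb_eq_expProb hp l ⟨ξ, hξ⟩]
  refine Tendsto.congr (fun n => (toReal_chainProb hp _ _
    (measurableSet_of_mem_discretize hl 0) ⟨ξ, hξ⟩).symm) ?_
  exact ((evalCLM ℝ (⟨ξ, hξ⟩ : FinConfig d N)).continuous.tendsto _).comp (tendsto_stepProb hp 0 l)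

end Convergence

/-! ### Moment bounds for the discrete chain -/

section Moments

variable (ρ : Measure (Config d × InstrField d)) (q : unitInterval)

/-- The odometer of the discrete chain as a function of all the randomness. -/
def tops (v : (Config d × InstrField d) × Clocks d) (i : ℕ) : Site d → ℕ :=
  chain v.1.1 v.1.2 v.2 i

/-- The configuration of the discrete chain as a function of all the randomness. -/
def walk (v : (Config d × InstrField d) × Clocks d) (i : ℕ) : Config d :=
  cfg v.1.1 v.1.2 (tops v i)

theorem tops_mono (v : (Config d × InstrField d) × Clocks d) (x : Site d) :
    Monotone fun i => tops v i x := chain_mono_step _ _ _ x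

theorem measurable_tops (i : ℕ) :
    Measurable fun v : (Config d × InstrField d) × Clocks d => tops v i :=
  measurable_chain (measurable_fst.comp measurable_fst) (measurable_snd.comp measurable_fst)
    measurable_snd i

theorem measurable_walk (i : ℕ) :
    Measurable fun v : (Config d × InstrField d) × Clocks d => walk v i :=
  measurable_cfg (measurable_fst.comp measurable_fst) (measurable_snd.comp measurable_fst)
    (measurable_tops i)

theorem measurable_tops_apply (i : ℕ) (x : Site d) :
    Measurable fun v : (Config d × InstrField d) × Clocks d => tops v i x :=
  (measurable_pi_apply x).comp (measurable_tops i)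

theorem measurable_walk_apply (i : ℕ) (x : Site d) :
    Measurable fun v : (Config d × InstrField d) × Clocks d => walk v i x :=
  (measurable_pi_apply x).comp (measurable_walk i)

/-- The event `E` is determined by the clocks of the first `i` time steps. -/
def IsPast (i : ℕ) (E : Set ((Config d × InstrField d) × Clocks d)) : Prop :=
  ∀ r B B', (∀ x m, ∀ k < i, B (x, m, k) = B' (x, m, k)) → ((r, B) ∈ E ↔ (r, B') ∈ E)

theorem tops_congr {r : Config d × InstrField d} {B B' : Clocks d} {i j : ℕ} (hj : j ≤ i)
    (h : ∀ x m, ∀ k < i, B (x, m, k) = B' (x, m, k)) : tops (r, B) j = tops (r, B') j :=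
  chain_congr_clocks (fun x m k hk => h x m k (hk.trans_le hj)) _ _

theorem walk_congr {r : Config d × InstrField d} {B B' : Clocks d} {i j : ℕ} (hj : j ≤ i)
    (h : ∀ x m, ∀ k < i, B (x, m, k) = B' (x, m, k)) : walk (r, B) j = walk (r, B') j := by
  rw [walk, walk, tops_congr hj h]

/-- A clock of step `i` is a single coordinate of a product measure on which an event of the first
`i` steps does not depend. -/
theorem measure_inter_clock {i : ℕ} {E : Set ((Config d × InstrField d) × Clocks d)}
    (hE : MeasurableSet E) (hp : IsPast i E) (x : Site d) (m : ℕ) :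
    (ρ.prod (clockLaw d q)) (E ∩ {v | v.2 (x, m, i) = true}) =
      (ρ.prod (clockLaw d q)) E * ENNReal.ofReal q := by
  have hS : MeasurableSet {v : (Config d × InstrField d) × Clocks d | v.2 (x, m, i) = true} :=
    Measurable.setOf_discrete (f := fun v : (Config d × InstrField d) × Clocks d => v.2 (x, m, i))
      ((measurable_pi_apply (x, m, i)).comp measurable_snd) (· = true)
  rw [Measure.prod_apply (hE.inter hS), Measure.prod_apply hE, ← lintegral_mul_const _
    (measurable_measure_prodMk_left hE)]
  refine lintegral_congr fun r => ?_
  rw [← bern_true q]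
  refine infinitePi_inter_coord (fun _ : Site d × ℕ × ℕ => bern q)
    (measurable_prodMk_left hE) (x, m, i) (fun B B' hB => ?_) (measurableSet_singleton true)
  refine hp r B B' fun y m' k hk => hB _ fun he => ?_
  simp only [Prod.mk.injEq] at he
  omega

theorem setLIntegral_natCast {X : Type*} [MeasurableSpace X] (μ : Measure X) {a : X → ℕ}
    (ha : Measurable a) (E : Set X) :
    ∫⁻ x in E, (a x : ℝ≥0∞) ∂μ = ∑' m : ℕ, μ ({x | m < a x} ∩ E) := by
  have h1 : ∀ x, (a x : ℝ≥0∞) = ∑' m : ℕ, {x | m < a x}.indicator (1 : X → ℝ≥0∞) x := by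
    intro x
    rw [tsum_eq_sum (s := Finset.range (a x)) fun m hm => by simpa using hm]
    rw [Finset.sum_congr rfl fun m hm => Set.indicator_of_mem (f := (1 : X → ℝ≥0∞))
      (show x ∈ {x | m < a x} from Finset.mem_range.1 hm)]
    simp
  have hm : ∀ m : ℕ, MeasurableSet {x | m < a x} := fun m => ha.setOf_discrete (m < ·)
  simp only [h1]
  rw [lintegral_tsum fun m => (measurable_one.indicator (hm m)).aemeasurable]
  refine tsum_congr fun m => ?_
  rw [lintegral_indicator_one (hm m), Measure.restrict_apply (hm m)]

/-- Union bound over the active particles: particle number `m` exists by the past, and its clock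
rings independently with probability `q`. -/
theorem measure_topple_le {i : ℕ} {E : Set ((Config d × InstrField d) × Clocks d)}
    (hE : MeasurableSet E) (hp : IsPast i E) (x : Site d) :
    (ρ.prod (clockLaw d q)) (E ∩ {v | tops v i x < tops v (i + 1) x}) ≤
      ENNReal.ofReal q * ∫⁻ v in E, ((walk v i x).activeCount : ℝ≥0∞) ∂ρ.prod (clockLaw d q) := by
  have ha : Measurable fun v : (Config d × InstrField d) × Clocks d =>
      (walk v i x).activeCount :=
    (Measurable.of_discrete (f := activeCount)).comp (measurable_walk_apply i x)
  rw [setLIntegral_natCast _ ha, ← ENNReal.tsum_mul_left]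
  have hsub : E ∩ {v | tops v i x < tops v (i + 1) x} ⊆ ⋃ m : ℕ,
      ({v | m < (walk v i x).activeCount} ∩ E) ∩ {v | v.2 (x, m, i) = true} := by
    rintro v ⟨hv, hlt⟩
    obtain ⟨m, hm, hb⟩ := rings_of_chain_lt hlt
    exact Set.mem_iUnion.2 ⟨m, ⟨hm, hv⟩, hb⟩
  refine (measure_mono hsub).trans ((measure_iUnion_le _).trans_eq (tsum_congr fun m => ?_))
  rw [measure_inter_clock ρ q ((ha.setOf_discrete (m < ·)).inter hE), mul_comm]
  intro r B B' h
  have := walk_congr (r := r) le_rfl h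
  simp only [Set.mem_inter_iff, Set.mem_ofPred_eq, hp r B B' h, this]

variable {M : ℝ≥0∞}

theorem natCast_sub_succ_le (v : (Config d × InstrField d) × Clocks d) (i : ℕ) (x : Site d) :
    ((tops v (i + 1) x - tops v i x : ℕ) : ℝ≥0∞) =
      {v | tops v i x < tops v (i + 1) x}.indicator 1 v := by
  by_cases h : tops v i x < tops v (i + 1) x
  · rw [Set.indicator_of_mem (by exact h)]
    have h1 : tops v (i + 1) x ≤ tops v i x + 1 := chain_succ_le _ _ _ _ _
    have : tops v (i + 1) x - tops v i x = 1 := by omega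
    rw [this]; simp
  · rw [Set.indicator_of_notMem (by exact h)]
    have : tops v (i + 1) x - tops v i x = 0 := by omega
    rw [this]; simp

theorem lintegral_tops_succ_le [SFinite ρ] (i : ℕ) (x : Site d) :
    ∫⁻ v, ((tops v (i + 1) x - tops v i x : ℕ) : ℝ≥0∞) ∂ρ.prod (clockLaw d q) ≤
      ENNReal.ofReal q * ∫⁻ v, ((walk v i x).count : ℝ≥0∞) ∂ρ.prod (clockLaw d q) := by
  have h := measure_topple_le ρ q MeasurableSet.univ (i := i) (fun _ _ _ _ => by simp) x
  rw [Set.univ_inter, Measure.restrict_univ] at h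
  have hm : MeasurableSet {v : (Config d × InstrField d) × Clocks d |
      tops v i x < tops v (i + 1) x} :=
    measurableSet_lt (measurable_tops_apply i x) (measurable_tops_apply (i + 1) x)
  simp only [natCast_sub_succ_le]
  rw [lintegral_indicator_one hm]
  exact h.trans (mul_le_mul_right (lintegral_mono fun v =>
    Nat.cast_le.2 (activeCount_le_count (walk v i x))) _)

variable [IsProbabilityMeasure ρ]

/-- The growth factor of the mean number of particles in one time step. -/
def growth (d : ℕ) (q : unitInterval) : ℝ≥0∞ := 1 + (nbs d).card * ENNReal.ofReal q

/-- In one step the mean number of particles at a site grows at most by the mean number of topplings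
at its neighbours, each of which is at most `q` times the mean number of particles there. A bound
uniform in the site thus grows by the factor `growth`. -/
theorem lintegral_count_le (hM : ∀ x, ∫⁻ r, ((r.1 x).count : ℝ≥0∞) ∂ρ ≤ M)
    (i : ℕ) (x : Site d) :
    ∫⁻ v, ((walk v i x).count : ℝ≥0∞) ∂ρ.prod (clockLaw d q) ≤ M * growth d q ^ i := by
  induction i generalizing x with
  | zero =>
    have h0 : ∀ v : (Config d × InstrField d) × Clocks d, walk v 0 = v.1.1 := fun v =>
      cfg_zero _ _
    simp only [h0, pow_zero, mul_one]
    refine le_trans (le_of_eq ?_) (hM x)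
    have hm : Measurable fun r : Config d × InstrField d => ((r.1 x).count : ℝ≥0∞) :=
      (Measurable.of_discrete (f := fun o : Occ => (o.count : ℝ≥0∞))).comp
        (f := fun r : Config d × InstrField d => r.1 x)
        ((measurable_pi_apply x).comp measurable_fst)
    exact measurePreserving_fst.lintegral_comp hm
  | succ i ih =>
    have h1 : ∀ v : (Config d × InstrField d) × Clocks d, ((walk v (i + 1) x).count : ℝ≥0∞) ≤
        (walk v i x).count + ∑ z ∈ nbs d, ((tops v (i + 1) (x - z) - tops v i (x - z) : ℕ) : ℝ≥0∞) := by
      intro v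
      have h := count_cfg_add_le (legalAt_chain v.1.1 v.1.2 v.2 i)
        (fun y => tops v (i + 1) y - tops v i y) x
      have h2 : (chain v.1.1 v.1.2 v.2 i + fun y => tops v (i + 1) y - tops v i y) =
          tops v (i + 1) := by
        ext y
        exact Nat.add_sub_cancel' (tops_mono v y (Nat.le_succ i))
      rw [h2] at h
      exact_mod_cast h
    have hmeas : ∀ y, Measurable fun v : (Config d × InstrField d) × Clocks d =>
        ((tops v (i + 1) y - tops v i y : ℕ) : ℝ≥0∞) := fun y =>
      (Measurable.of_discrete (f := fun n : ℕ × ℕ => ((n.1 - n.2 : ℕ) : ℝ≥0∞))).comp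
        ((measurable_tops_apply (i + 1) y).prodMk (measurable_tops_apply i y))
    have hmc : Measurable fun v : (Config d × InstrField d) × Clocks d =>
        ((walk v i x).count : ℝ≥0∞) :=
      (Measurable.of_discrete (f := fun o : Occ => (o.count : ℝ≥0∞))).comp
        (measurable_walk_apply i x)
    refine (lintegral_mono h1).trans ?_
    rw [lintegral_add_left hmc, lintegral_finsetSum _ fun z _ => hmeas _]
    refine (add_le_add (ih x) (Finset.sum_le_card_nsmul _ _
      (ENNReal.ofReal q * (M * growth d q ^ i)) fun z _ =>
        (lintegral_tops_succ_le ρ q i _).trans (mul_le_mul_right (ih _) _))).trans_eq ?_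
    rw [nsmul_eq_mul, pow_succ, growth]
    ring

theorem one_le_growth (q : unitInterval) : 1 ≤ growth d q := le_self_add

theorem lintegral_tops_sub_le (hM : ∀ x, ∫⁻ r, ((r.1 x).count : ℝ≥0∞) ∂ρ ≤ M)
    {i j N : ℕ} (hij : i ≤ j) (hj : j ≤ N) (x : Site d) :
    ∫⁻ v, ((tops v j x - tops v i x : ℕ) : ℝ≥0∞) ∂ρ.prod (clockLaw d q) ≤
      (j - i : ℕ) * (ENNReal.ofReal q * (M * growth d q ^ N)) := by
  induction hij with
  | refl => simp
  | @step j hij ih =>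
    have hj' : j ≤ N := by omega
    have h1 : ∀ v : (Config d × InstrField d) × Clocks d,
        ((tops v (j + 1) x - tops v i x : ℕ) : ℝ≥0∞) =
        (tops v j x - tops v i x : ℕ) + (tops v (j + 1) x - tops v j x : ℕ) := by
      intro v
      have h2 : tops v i x ≤ tops v j x := tops_mono v x hij
      have h3 : tops v j x ≤ tops v (j + 1) x := tops_mono v x (Nat.le_succ j)
      rw [← Nat.cast_add]
      congr 1
      omega
    have hmeas : Measurable fun v : (Config d × InstrField d) × Clocks d =>
        ((tops v j x - tops v i x : ℕ) : ℝ≥0∞) :=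
      (Measurable.of_discrete (f := fun n : ℕ × ℕ => ((n.1 - n.2 : ℕ) : ℝ≥0∞))).comp
        ((measurable_tops_apply j x).prodMk (measurable_tops_apply i x))
    rw [lintegral_congr h1, lintegral_add_left hmeas, Nat.succ_sub hij, Nat.cast_succ, add_mul,
      one_mul]
    refine add_le_add (ih hj') ((lintegral_tops_succ_le ρ q j x).trans (mul_le_mul_right ?_ _))
    refine (lintegral_count_le ρ q hM j x).trans (mul_le_mul_right ?_ _)
    exact pow_le_pow_right₀ (one_le_growth q) hj'

/-- A stable site is unlikely to receive a particle and to topple within a short time. -/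
theorem measure_stable_topple_le (hM : ∀ x, ∫⁻ r, ((r.1 x).count : ℝ≥0∞) ∂ρ ≤ M)
    {i j N : ℕ} (hij : i ≤ j) (hj : j ≤ N) (x : Site d) :
    (ρ.prod (clockLaw d q)) {v | (walk v i x).Stable ∧ tops v i x < tops v j x} ≤
      (j - i : ℕ) * (ENNReal.ofReal q * (2 * ((nbs d).card *
        ((j - i : ℕ) * (ENNReal.ofReal q * (M * growth d q ^ N)))))) := by
  -- `G r`: stable at time `i` and not toppled up to time `r`. The event is decomposed according to
  -- the first step at which the site topples.
  set G : ℕ → Set ((Config d × InstrField d) × Clocks d) := fun r =>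
    {v | (walk v i x).Stable} ∩ {v | tops v r x = tops v i x} with hG
  have hGm : ∀ r, MeasurableSet (G r) := fun r =>
    ((measurable_walk_apply i x).setOf_discrete Occ.Stable).inter
      (measurableSet_eq_fun (measurable_tops_apply r x) (measurable_tops_apply i x))
  have hGp : ∀ r, i ≤ r → IsPast r (G r) := fun r hr v B B' h => by
    simp only [hG, Set.mem_inter_iff, Set.mem_ofPred_eq, tops_congr (r := v) hr h,
      tops_congr (r := v) le_rfl h, walk_congr (r := v) hr h]
  have hsub : {v | (walk v i x).Stable ∧ tops v i x < tops v j x} ⊆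
      ⋃ r ∈ Finset.Ico i j, G r ∩ {v | tops v r x < tops v (r + 1) x} := by
    rintro v ⟨hs, hlt⟩
    by_contra hc
    simp only [Set.mem_iUnion, not_exists, Finset.mem_Ico] at hc
    have : ∀ r, i ≤ r → r ≤ j → tops v r x = tops v i x := by
      intro r hr
      induction hr with
      | refl => intro _; rfl
      | @step r hr ih =>
        intro hrj
        have h1 := ih (by omega)
        have h2 := hc r ⟨hr, by omega⟩
        have h3 : tops v r x ≤ tops v (r + 1) x := tops_mono v x (Nat.le_succ r)
        by_contra hne
        exact h2 ⟨⟨hs, h1⟩, lt_of_le_of_ne h3 fun h4 => hne (h4.symm.trans h1)⟩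
    exact hlt.ne' (this j hij le_rfl)
  have hterm : ∀ r ∈ Finset.Ico i j,
      (ρ.prod (clockLaw d q)) (G r ∩ {v | tops v r x < tops v (r + 1) x}) ≤
      ENNReal.ofReal q * (2 * ((nbs d).card *
        ((j - i : ℕ) * (ENNReal.ofReal q * (M * growth d q ^ N))))) := by
    intro r hr
    rw [Finset.mem_Ico] at hr
    refine (measure_topple_le ρ q (hGm r) (hGp r hr.1) x).trans (mul_le_mul_right ?_ _)
    -- Until its first toppling, a site that was stable has only active particles due to arrivals
    -- since time `i`. This supplies a second small factor, besides that of the site's own clock.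
    have hpt : ∀ v ∈ G r, ((walk v r x).activeCount : ℝ≥0∞) ≤
        2 * ∑ z ∈ nbs d, ((tops v r (x - z) - tops v i (x - z) : ℕ) : ℝ≥0∞) := by
      rintro v ⟨hs, he⟩
      have h2 : (chain v.1.1 v.1.2 v.2 i + fun y => tops v r y - tops v i y) = tops v r := by
        ext y
        exact Nat.add_sub_cancel' (tops_mono v y hr.1)
      have h3 : walk v r x = addOne^[arrivals (shiftField v.1.2 (tops v i))
          (fun y => tops v r y - tops v i y) x] (walk v i x) := by
        have h0 : tops v r x - tops v i x = 0 := Nat.sub_eq_zero_of_le (le_of_eq he)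
        have h1 := congrFun (cfg_add (legalAt_chain v.1.1 v.1.2 v.2 i)
          fun y => tops v r y - tops v i y) x
        rw [h2] at h1
        refine h1.trans ?_
        change run _ _ (tops v r x - tops v i x) = _
        rw [h0]
        rfl
      rw [h3]
      have h4 := activeCount_addOne_iterate_le hs (arrivals (shiftField v.1.2 (tops v i))
          (fun y => tops v r y - tops v i y) x)
      have h5 := arrivals_add_le (shiftField v.1.2 (tops v i)) 0
        (fun y => tops v r y - tops v i y) x
      rw [zero_add, arrivals_zero, zero_add] at h5
      exact_mod_cast h4.trans (Nat.mul_le_mul_left 2 h5)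
    have hmeas : ∀ y, Measurable fun v : (Config d × InstrField d) × Clocks d =>
        ((tops v r y - tops v i y : ℕ) : ℝ≥0∞) := fun y =>
      (Measurable.of_discrete (f := fun n : ℕ × ℕ => ((n.1 - n.2 : ℕ) : ℝ≥0∞))).comp
        ((measurable_tops_apply r y).prodMk (measurable_tops_apply i y))
    refine (setLIntegral_mono_ae' (hGm r) (ae_of_all _ hpt)).trans
      ((setLIntegral_le_lintegral _ _).trans ?_)
    rw [lintegral_const_mul _ (Finset.measurable_fun_sum _ fun z _ => hmeas _),
      lintegral_finsetSum _ fun z _ => hmeas _]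
    refine mul_le_mul_right ((Finset.sum_le_card_nsmul _ _ _ fun z _ =>
      lintegral_tops_sub_le ρ q hM hr.1 (hr.2.le.trans hj) (x - z)).trans ?_) _
    rw [nsmul_eq_mul]
    refine mul_le_mul_right (mul_le_mul_left ?_ _) _
    exact_mod_cast Nat.sub_le_sub_right hr.2.le i
  refine (measure_mono hsub).trans ((measure_biUnion_finset_le _ _).trans
    ((Finset.sum_le_card_nsmul _ _ _ hterm).trans_eq ?_))
  rw [Nat.card_Ico, nsmul_eq_mul]

end Moments

/-! ### Bounds at the time scale `2⁻ⁿ` -/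

theorem ringProb_le (θ : ℝ≥0) (n : ℕ) : (ringProb θ n : ℝ) ≤ θ / 2 ^ n := by
  have := Real.add_one_le_exp (-(θ / 2 ^ n : ℝ))
  simp only [ringProb]
  linarith

theorem growth_pow_le (θ : ℝ≥0) (n : ℕ) (t : ℝ≥0) :
    growth d (ringProb θ n) ^ tick n t ≤ ENNReal.ofReal (Real.exp ((nbs d).card * θ * t)) := by
  have h0 := (ringProb θ n).2.1
  have h1 : growth d (ringProb θ n) =
      ENNReal.ofReal (1 + (nbs d).card * (ringProb θ n : ℝ)) := by
    rw [growth, ENNReal.ofReal_add zero_le_one (by positivity), ENNReal.ofReal_mul (by positivity)]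
    simp
  rw [h1, ← ENNReal.ofReal_pow (by positivity)]
  refine ENNReal.ofReal_le_ofReal ?_
  have h2 : 1 + (nbs d).card * (ringProb θ n : ℝ) ≤ Real.exp ((nbs d).card * (θ / 2 ^ n)) := by
    have h3 := mul_le_mul_of_nonneg_left (ringProb_le θ n) (Nat.cast_nonneg (α := ℝ) (nbs d).card)
    have h4 := Real.add_one_le_exp ((nbs d).card * (θ / 2 ^ n : ℝ))
    linarith
  refine (pow_le_pow_left₀ (by positivity) h2 _).trans ?_
  rw [← Real.exp_nat_mul, Real.exp_le_exp]
  have h5 : (tick n t : ℝ) ≤ t * 2 ^ n := Nat.floor_le (by positivity)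
  calc (tick n t : ℝ) * ((nbs d).card * (θ / 2 ^ n)) ≤ (t * 2 ^ n) * ((nbs d).card * (θ / 2 ^ n)) := by
        gcongr
    _ = _ := by field_simp

/-! ### The limit of the discrete chains -/

/-- Initial configurations, instructions and clocks. -/
abbrev Omega (d : ℕ) : Type := (Config d × InstrField d) × Noise d

/-- The randomness used by the chain with time steps of length `2⁻ⁿ`. -/
def atLevel (n : ℕ) (ω : Omega d) : (Config d × InstrField d) × Clocks d := (ω.1, clocks ω.2 n)

/-- The odometer at time `t` of the chain with time steps of length `2⁻ⁿ`. -/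
def dheight (ω : Omega d) (n : ℕ) (t : ℝ≥0) : Site d → ℕ := tops (atLevel n ω) (tick n t)

/-- The odometer at time `t` of the limit of the discrete chains. -/
def height (ω : Omega d) (t : ℝ≥0) (x : Site d) : ℕ∞ := ⨆ n, (dheight ω n t x : ℕ∞)

theorem two_mul_tick_le (n : ℕ) (t : ℝ≥0) : 2 * tick n t ≤ tick (n + 1) t := by
  refine Nat.le_floor ?_
  have : (tick n t : ℝ) ≤ t * 2 ^ n := Nat.floor_le (by positivity)
  push_cast
  rw [pow_succ]
  linarith

/-- Rounding helps: two fine steps per coarse step never exceed the number of fine steps available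
(`two_mul_tick_le`). -/
theorem dheight_mono_level (ω : Omega d) (t : ℝ≥0) (x : Site d) :
    Monotone fun n => dheight ω n t x :=
  monotone_nat_of_le_succ fun n =>
    (chain_le_of_refines (clocks_refines ω.2 n) ω.1.1 ω.1.2 (tick n t) x).trans
      (chain_mono_step _ _ _ x (two_mul_tick_le n t))

theorem dheight_mono (ω : Omega d) (n : ℕ) {s t : ℝ≥0} (h : s ≤ t) (x : Site d) :
    dheight ω n s x ≤ dheight ω n t x := tops_mono _ x (tick_mono n h)

theorem dheight_le_height (ω : Omega d) (n : ℕ) (t : ℝ≥0) (x : Site d) :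
    (dheight ω n t x : ℕ∞) ≤ height ω t x := le_iSup (fun n => (dheight ω n t x : ℕ∞)) n

theorem height_mono (ω : Omega d) {s t : ℝ≥0} (h : s ≤ t) (x : Site d) :
    height ω s x ≤ height ω t x :=
  iSup_mono fun n => Nat.cast_le.2 (dheight_mono ω n h x)

/-- A finite supremum of natural numbers is attained, and kept at all finer levels by monotonicity.
So limits in `n` are exact from some level on. -/
theorem eventually_dheight_eq {ω : Omega d} {t : ℝ≥0} {x : Site d} (h : height ω t x < ⊤) :
    ∀ᶠ n in atTop, (dheight ω n t x : ℕ∞) = height ω t x := by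
  obtain ⟨n, hn⟩ := ENat.exists_eq_iSup_of_lt_top h
  filter_upwards [eventually_ge_atTop n] with m hm
  exact (dheight_le_height ω m t x).antisymm
    (hn.symm.le.trans (Nat.cast_le.2 (dheight_mono_level ω t x hm)))

/-- The configuration at time `t`. -/
def stateAt (ω : Omega d) (t : ℝ≥0) : Config d :=
  cfg ω.1.1 ω.1.2 fun x => (height ω t x).toNat

theorem eventually_walk_eq {ω : Omega d} {t : ℝ≥0} (h : ∀ x, height ω t x < ⊤) (x : Site d) :
    ∀ᶠ n in atTop, walk (atLevel n ω) (tick n t) x = stateAt ω t x := by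
  have h1 : ∀ y, ∀ᶠ n in atTop, dheight ω n t y = (height ω t y).toNat := fun y =>
    (eventually_dheight_eq (h y)).mono fun n hn => by rw [← hn, ENat.toNat_natCast]
  filter_upwards [h1 x, (nbs d).eventually_all.2 fun z _ => h1 (x - z)] with n hn hn'
  exact cfg_congr hn hn'

/-- The right-continuous version of the odometer. -/
def rheight (ω : Omega d) (t : ℝ≥0) (x : Site d) : ℕ∞ := ⨅ k : ℕ, height ω (t + (2 ^ k)⁻¹) x

theorem height_le_rheight (ω : Omega d) (t : ℝ≥0) (x : Site d) : height ω t x ≤ rheight ω t x :=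
  le_iInf fun _ => height_mono ω le_self_add x

theorem tendsto_inv_two_pow : Tendsto (fun k : ℕ => ((2 : ℝ≥0) ^ k)⁻¹) atTop (𝓝 0) := by
  have := tendsto_pow_atTop_nhds_zero_of_lt_one (r := (2⁻¹ : ℝ≥0)) (by simp)
    (by rw [← NNReal.coe_lt_coe]; push_cast; norm_num)
  simpa only [inv_pow] using this

theorem rheight_le_height (ω : Omega d) {s t : ℝ≥0} (h : s < t) (x : Site d) :
    rheight ω s x ≤ height ω t x := by
  obtain ⟨k, hk⟩ := (tendsto_inv_two_pow.eventually_lt_const (tsub_pos_of_lt h)).exists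
  refine (iInf_le _ k).trans (height_mono ω ?_ x)
  rw [add_comm]
  exact (add_le_of_le_tsub_right_of_le h.le hk.le)

/-- An infimum in `ℕ∞` is attained, so the odometer is constant just to the right of `t`. -/
theorem eventually_rheight_eq (ω : Omega d) (t : ℝ≥0) (x : Site d) :
    ∀ᶠ s in 𝓝[>] t, rheight ω s x = rheight ω t x := by
  obtain ⟨k, hk⟩ := ciInf_mem fun k : ℕ => height ω (t + (2 ^ k)⁻¹) x
  have hlt : t < t + (2 ^ k)⁻¹ := lt_add_of_pos_right t (by positivity)
  filter_upwards [Ioo_mem_nhdsGT hlt] with s hs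
  refine le_antisymm ?_ ?_
  · exact (rheight_le_height ω hs.2 x).trans_eq hk
  · exact le_iInf fun m => (rheight_le_height ω (hs.1.trans_le le_self_add) x)

/-- The right-continuous process. -/
def procAt (ω : Omega d) (t : ℝ≥0) : Config d :=
  cfg ω.1.1 ω.1.2 fun x => (rheight ω t x).toNat

theorem eventually_procAt_eq (ω : Omega d) (x : Site d) (t : ℝ≥0) :
    ∀ᶠ s in 𝓝[>] t, procAt ω s x = procAt ω t x := by
  filter_upwards [eventually_rheight_eq ω t x,
    (nbs d).eventually_all.2 fun z _ => eventually_rheight_eq ω t (x - z)] with s hs hs'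
  exact cfg_congr (by rw [hs]) fun z hz => by rw [hs' z hz]

/-! ### Measurability -/

theorem measurable_enat_of_le {X : Type*} [MeasurableSpace X] {f : X → ℕ∞}
    (h : ∀ n : ℕ, MeasurableSet {ω | f ω ≤ n}) : Measurable f := by
  refine ENat.measurable_iff.2 fun n => ?_
  rcases n with _ | n
  · convert h 0 using 1
    ext ω
    simp
  · convert (h (n + 1)).diff (h n) using 1
    ext ω
    simp only [Set.mem_preimage, Set.mem_singleton_iff, Set.mem_sdiff, Set.mem_ofPred_eq, not_le]
    constructor
    · intro h
      rw [h]
      exact ⟨le_rfl, Nat.cast_lt.2 (Nat.lt_succ_self n)⟩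
    · rintro ⟨h1, h2⟩
      refine h1.antisymm ?_
      push_cast
      exact Order.add_one_le_of_lt h2

theorem measurable_atLevel (n : ℕ) : Measurable (atLevel (d := d) n) :=
  measurable_fst.prodMk ((measurable_clocks n).comp measurable_snd)

theorem measurable_dheight (n : ℕ) (t : ℝ≥0) (x : Site d) :
    Measurable fun ω : Omega d => dheight ω n t x :=
  (measurable_tops_apply (tick n t) x).comp (measurable_atLevel n)

theorem measurable_height (t : ℝ≥0) (x : Site d) : Measurable fun ω : Omega d => height ω t x :=
  measurable_enat_of_le fun n => by
    have : {ω : Omega d | height ω t x ≤ n} = ⋂ m, {ω | dheight ω m t x ≤ n} := by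
      ext ω
      simp [height]
    rw [this]
    exact MeasurableSet.iInter fun m => (measurable_dheight m t x).setOf_discrete (· ≤ n)

theorem measurable_rheight (t : ℝ≥0) (x : Site d) : Measurable fun ω : Omega d => rheight ω t x :=
  measurable_enat_of_le fun n => by
    have : {ω : Omega d | rheight ω t x ≤ n} = ⋃ k : ℕ, {ω | height ω (t + (2 ^ k)⁻¹) x ≤ n} := by
      ext ω
      simp only [Set.mem_ofPred_eq, Set.mem_iUnion]
      refine ⟨fun h => ?_, fun ⟨k, hk⟩ => (iInf_le _ k).trans hk⟩
      obtain ⟨k, hk⟩ := ciInf_mem fun k : ℕ => height ω (t + (2 ^ k)⁻¹) x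
      exact ⟨k, hk.le.trans h⟩
    rw [this]
    exact MeasurableSet.iUnion fun k => (measurable_height _ x).setOf_discrete (· ≤ (n : ℕ∞))

theorem measurable_stateAt (t : ℝ≥0) : Measurable fun ω : Omega d => stateAt ω t :=
  measurable_cfg (measurable_fst.comp measurable_fst) (measurable_snd.comp measurable_fst)
    (measurable_pi_lambda _ fun x =>
      (Measurable.of_discrete (f := ENat.toNat)).comp (measurable_height t x))

theorem measurable_procAt (t : ℝ≥0) : Measurable fun ω : Omega d => procAt ω t :=
  measurable_cfg (measurable_fst.comp measurable_fst) (measurable_snd.comp measurable_fst)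
    (measurable_pi_lambda _ fun x =>
      (Measurable.of_discrete (f := ENat.toNat)).comp (measurable_rheight t x))

/-! ### Probability bounds -/

/-- Fatou's lemma for events. It transfers the bounds at level `n` to the limit without requiring
measurability of `A`. -/
theorem measure_le_of_eventually {X : Type*} [MeasurableSpace X] {μ : Measure X} {E : ℕ → Set X}
    {A : Set X} (h : ∀ ω ∈ A, ∀ᶠ n in atTop, ω ∈ E n) {b : ℕ → ℝ≥0∞} {c : ℝ≥0∞}
    (hb : ∀ n, μ (E n) ≤ b n) (hbc : Tendsto b atTop (𝓝 c)) : μ A ≤ c := by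
  have hmono : Monotone fun N : ℕ => ⋂ n ≥ N, E n := fun N N' hN =>
    Set.biInter_subset_biInter_left fun n hn => le_trans hN hn
  have hsub : A ⊆ ⋃ N : ℕ, ⋂ n ≥ N, E n := fun ω hω => by
    obtain ⟨N, hN⟩ := eventually_atTop.1 (h ω hω)
    exact Set.mem_iUnion.2 ⟨N, Set.mem_iInter₂.2 hN⟩
  refine (measure_mono hsub).trans ?_
  rw [hmono.measure_iUnion]
  refine iSup_le fun N => ge_of_tendsto hbc ?_
  filter_upwards [eventually_ge_atTop N] with n hn
  exact (measure_mono (Set.biInter_subset_of_mem hn)).trans (hb n)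

section Bounds

variable (ρ : Measure (Config d × InstrField d)) [IsProbabilityMeasure ρ] (θ : ℝ≥0)

theorem measurePreserving_atLevel (n : ℕ) :
    MeasurePreserving (atLevel (d := d) n) (ρ.prod (noiseLaw d θ))
      (ρ.prod (clockLaw d (ringProb θ n))) :=
  (MeasurePreserving.id ρ).prod (measurePreserving_clocks θ n)

/-- The growth of the mean number of particles up to time `T`. -/
def growthBound (d : ℕ) (θ T : ℝ≥0) (M : ℝ≥0∞) : ℝ≥0∞ :=
  M * ENNReal.ofReal (Real.exp ((nbs d).card * θ * T))

theorem growthBound_lt_top {T : ℝ≥0} {M : ℝ≥0∞} (hM : M < ⊤) : growthBound d θ T M < ⊤ :=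
  ENNReal.mul_lt_top hM ENNReal.ofReal_lt_top

/-- The mean number of rings of a clock of rate `θ` in the time steps between `s` and `t`, up to
rounding. -/
def ringBound (θ s t : ℝ≥0) (n : ℕ) : ℝ≥0∞ := ENNReal.ofReal (θ * ((t - s) + (2 ^ n)⁻¹))

theorem tendsto_ringBound (s t : ℝ≥0) :
    Tendsto (ringBound θ s t) atTop (𝓝 (ENNReal.ofReal (θ * (t - s)))) := by
  refine (ENNReal.continuous_ofReal.tendsto _).comp ?_
  have h := tendsto_inv_atTop_zero.comp
      (tendsto_pow_atTop_atTop_of_one_lt (one_lt_two (α := ℝ)))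
  simpa using ((h.const_add (t - s : ℝ)).const_mul (θ : ℝ))

theorem tick_sub_mul_ringProb_le {s t : ℝ≥0} (h : s ≤ t) (n : ℕ) :
    ((tick n t - tick n s : ℕ) : ℝ≥0∞) * ENNReal.ofReal (ringProb θ n) ≤ ringBound θ s t n := by
  rw [← ENNReal.ofReal_natCast, ← ENNReal.ofReal_mul (by positivity)]
  refine ENNReal.ofReal_le_ofReal ?_
  rw [Nat.cast_sub (tick_mono n h)]
  have h1 : (tick n t : ℝ) ≤ t * 2 ^ n := Nat.floor_le (by positivity)
  have h2 : (s : ℝ) * 2 ^ n < tick n s + 1 := Nat.lt_floor_add_one _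
  have h3 : (s : ℝ) ≤ t := NNReal.coe_le_coe.2 h
  have h4 := ringProb_le θ n
  have h5 := (ringProb θ n).2.1
  calc ((tick n t : ℝ) - tick n s) * ringProb θ n ≤ ((t - s) * 2 ^ n + 1) * ringProb θ n :=
        mul_le_mul_of_nonneg_right (by linarith) h5
    _ ≤ ((t - s) * 2 ^ n + 1) * (θ / 2 ^ n) :=
        mul_le_mul_of_nonneg_left h4 (by
          have := mul_nonneg (sub_nonneg.2 h3) (by positivity : (0:ℝ) ≤ 2 ^ n)
          linarith)
    _ = _ := by field_simp

variable {ρ} {M : ℝ≥0∞}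

theorem lintegral_dheight_sub_le (hM : ∀ x, ∫⁻ r, ((r.1 x).count : ℝ≥0∞) ∂ρ ≤ M) {s t T : ℝ≥0}
    (hst : s ≤ t) (htT : t ≤ T) (n : ℕ) (x : Site d) :
    ∫⁻ ω, ((dheight ω n t x - dheight ω n s x : ℕ) : ℝ≥0∞) ∂ρ.prod (noiseLaw d θ) ≤
      ringBound θ s t n * growthBound d θ T M := by
  have hm : Measurable fun v : (Config d × InstrField d) × Clocks d =>
      ((tops v (tick n t) x - tops v (tick n s) x : ℕ) : ℝ≥0∞) :=
    (Measurable.of_discrete (f := fun n : ℕ × ℕ => ((n.1 - n.2 : ℕ) : ℝ≥0∞))).comp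
      ((measurable_tops_apply _ x).prodMk (measurable_tops_apply _ x))
  refine ((measurePreserving_atLevel ρ θ n).lintegral_comp hm).trans_le ?_
  refine (lintegral_tops_sub_le ρ (ringProb θ n) hM (tick_mono n hst) (tick_mono n htT) x).trans ?_
  rw [← mul_assoc]
  exact mul_le_mul' (tick_sub_mul_ringProb_le θ hst n) (mul_le_mul_right (growth_pow_le θ n T) _)

theorem measure_dheight_lt_le (hM : ∀ x, ∫⁻ r, ((r.1 x).count : ℝ≥0∞) ∂ρ ≤ M) {s t T : ℝ≥0}
    (hst : s ≤ t) (htT : t ≤ T) (n : ℕ) (x : Site d) (K : ℕ) :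
    ((K + 1 : ℕ) : ℝ≥0∞) * (ρ.prod (noiseLaw d θ)) {ω | dheight ω n s x + K < dheight ω n t x} ≤
      ringBound θ s t n * growthBound d θ T M := by
  refine le_trans ?_ (lintegral_dheight_sub_le θ hM hst htT n x)
  have hm : Measurable fun ω : Omega d => ((dheight ω n t x - dheight ω n s x : ℕ) : ℝ≥0∞) :=
    (Measurable.of_discrete (f := fun n : ℕ × ℕ => ((n.1 - n.2 : ℕ) : ℝ≥0∞))).comp
      ((measurable_dheight n t x).prodMk (measurable_dheight n s x))
  refine le_trans (mul_le_mul_right (measure_mono fun ω hω => ?_) _)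
    (mul_meas_ge_le_lintegral hm _)
  simp only [Set.mem_ofPred_eq] at hω ⊢
  exact Nat.cast_le.2 (by omega)

theorem eventually_dheight_lt {ω : Omega d} {s t : ℝ≥0} {x : Site d}
    (h : height ω s x < height ω t x) : ∀ᶠ n in atTop, dheight ω n s x < dheight ω n t x := by
  obtain ⟨n, hn⟩ := lt_iSup_iff.1 (show height ω s x < ⨆ n, (dheight ω n t x : ℕ∞) from h)
  filter_upwards [eventually_ge_atTop n] with m hm
  exact Nat.cast_lt.1 ((dheight_le_height ω m s x).trans_lt
    (hn.trans_le (Nat.cast_le.2 (dheight_mono_level ω t x hm))))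

theorem measure_height_lt_le (hM : ∀ x, ∫⁻ r, ((r.1 x).count : ℝ≥0∞) ∂ρ ≤ M) (hMt : M < ⊤)
    {s t T : ℝ≥0} (hst : s ≤ t) (htT : t ≤ T) (x : Site d) :
    (ρ.prod (noiseLaw d θ)) {ω | height ω s x < height ω t x} ≤
      ENNReal.ofReal (θ * (t - s)) * growthBound d θ T M :=
  measure_le_of_eventually (E := fun n => {ω | dheight ω n s x < dheight ω n t x})
    (b := fun n => ringBound θ s t n * growthBound d θ T M)
    (fun _ hω => eventually_dheight_lt hω)
    (fun n => by simpa using measure_dheight_lt_le θ hM hst htT n x 0)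
    (ENNReal.Tendsto.mul_const (tendsto_ringBound θ s t) (Or.inr (growthBound_lt_top θ hMt).ne))

theorem ae_height_lt_top (hM : ∀ x, ∫⁻ r, ((r.1 x).count : ℝ≥0∞) ∂ρ ≤ M) (hMt : M < ⊤) :
    ∀ᵐ ω ∂ρ.prod (noiseLaw d θ), ∀ t x, height ω t x < ⊤ := by
  have h : ∀ (T : ℕ) (x : Site d), ∀ᵐ ω ∂ρ.prod (noiseLaw d θ), height ω T x < ⊤ := by
    intro T x
    have hb := growthBound_lt_top (d := d) θ (T := T) hMt
    set c : ℝ≥0∞ := ENNReal.ofReal (θ * ((T : ℝ≥0) - (0 : ℝ≥0) : ℝ)) * growthBound d θ T M with hc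
    have hct : c ≠ ⊤ := (ENNReal.mul_lt_top ENNReal.ofReal_lt_top hb).ne
    rw [ae_iff]
    -- An infinite odometer exceeds every `K` at all fine levels, and Markov's inequality bounds
    -- this by a constant over `K + 1`, uniformly enough in the level.
    have hle : ∀ K : ℕ, (ρ.prod (noiseLaw d θ)) {ω | ¬ height ω T x < ⊤} ≤
        c / ((K + 1 : ℕ) : ℝ≥0∞) := by
      intro K
      refine measure_le_of_eventually (E := fun n => {ω | dheight ω n 0 x + K < dheight ω n T x})
        (b := fun n => ringBound θ 0 T n * growthBound d θ T M / ((K + 1 : ℕ) : ℝ≥0∞))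
        (fun ω hω => ?_) (fun n => ?_) ?_
      · have h1 : (K : ℕ∞) < ⨆ n, (dheight ω n T x : ℕ∞) := by
          have : height ω T x = ⊤ := not_lt_top_iff.1 hω
          rw [height] at this
          rw [this]
          exact ENat.natCast_lt_top K
        obtain ⟨n, hn⟩ := lt_iSup_iff.1 h1
        filter_upwards [eventually_ge_atTop n] with m hm
        have h2 : dheight ω m 0 x = 0 := by simp [dheight, tick, tops, chain]
        have h3 := dheight_mono_level ω T x hm
        have h4 : K < dheight ω n T x := Nat.cast_lt.1 hn
        simp only [h2]
        simp only at h3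
        omega
      · rw [ENNReal.le_div_iff_mul_le (Or.inl (by simp)) (Or.inl (by simp)), mul_comm]
        exact measure_dheight_lt_le θ hM zero_le le_rfl n x K
      · simp only [div_eq_mul_inv]
        exact ENNReal.Tendsto.mul_const (ENNReal.Tendsto.mul_const
          (tendsto_ringBound θ 0 T) (Or.inr hb.ne)) (Or.inr (by simp))
    refine le_antisymm (ge_of_tendsto' (x := atTop) ?_ hle) zero_le
    have h0 := ENNReal.Tendsto.const_mul (a := c) (ENNReal.tendsto_inv_nat_nhds_zero.comp
      (tendsto_add_atTop_nat 1)) (Or.inr hct)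
    rw [mul_zero] at h0
    simpa only [div_eq_mul_inv, Function.comp_def] using h0
  filter_upwards [ae_all_iff.2 fun T => ae_all_iff.2 (h T)] with ω hω t x
  obtain ⟨T, hT⟩ := exists_nat_ge t
  exact (height_mono ω hT x).trans_lt (hω T x)

/-- No jump at a fixed time: a toppling between `t` and `t + 2⁻ᵏ` has probability `O(2⁻ᵏ)`. The
exceptional null set depends on `t`. -/
theorem ae_rheight_eq (hM : ∀ x, ∫⁻ r, ((r.1 x).count : ℝ≥0∞) ∂ρ ≤ M) (hMt : M < ⊤) (t : ℝ≥0) :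
    ∀ᵐ ω ∂ρ.prod (noiseLaw d θ), ∀ x, rheight ω t x = height ω t x := by
  refine ae_all_iff.2 fun x => ?_
  rw [ae_iff]
  have hb := growthBound_lt_top (d := d) θ (T := t + 1) hMt
  have hle : ∀ k : ℕ, (ρ.prod (noiseLaw d θ)) {ω | ¬ rheight ω t x = height ω t x} ≤
      ENNReal.ofReal (θ * (((2 : ℝ≥0) ^ k)⁻¹ : ℝ≥0)) * growthBound d θ (t + 1) M := by
    intro k
    have h1 : ((2 : ℝ≥0) ^ k)⁻¹ ≤ 1 := inv_le_one_of_one_le₀ (one_le_pow₀ one_le_two)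
    have h2 := measure_height_lt_le θ hM hMt (s := t) (t := t + (2 ^ k)⁻¹) (T := t + 1)
      le_self_add (add_le_add_right h1 t) x
    rw [NNReal.coe_add, add_sub_cancel_left] at h2
    refine (measure_mono fun ω hω => ?_).trans h2
    exact lt_of_lt_of_le (lt_of_le_of_ne (height_le_rheight ω t x) (Ne.symm hω)) (iInf_le _ k)
  refine le_antisymm (ge_of_tendsto' (x := atTop) ?_ hle) zero_le
  have h0 : Tendsto (fun k : ℕ => ENNReal.ofReal (θ * (((2 : ℝ≥0) ^ k)⁻¹ : ℝ≥0))) atTop (𝓝 0) := by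
    have h := ((NNReal.tendsto_coe.2 tendsto_inv_two_pow).const_mul (θ : ℝ))
    rw [NNReal.coe_zero, mul_zero] at h
    have h' := (ENNReal.continuous_ofReal.tendsto _).comp h
    rw [ENNReal.ofReal_zero] at h'
    exact h'
  simpa using ENNReal.Tendsto.mul_const h0 (Or.inr hb.ne)

/-- A stable site is unlikely to topple within a short time. -/
theorem measure_stable_height_lt_le (hM : ∀ x, ∫⁻ r, ((r.1 x).count : ℝ≥0∞) ∂ρ ≤ M) (hMt : M < ⊤)
    {s t T : ℝ≥0} (hst : s ≤ t) (htT : t ≤ T) (x : Site d) :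
    (ρ.prod (noiseLaw d θ)) {ω | (∀ y, height ω s y < ⊤) ∧ (stateAt ω s x).Stable ∧
      height ω s x < height ω t x} ≤
      ENNReal.ofReal (θ * (t - s)) * (2 * ((nbs d).card *
        (ENNReal.ofReal (θ * (t - s)) * growthBound d θ T M))) := by
  have hb := growthBound_lt_top (d := d) θ (T := T) hMt
  refine measure_le_of_eventually
    (E := fun n => {ω | (walk (atLevel n ω) (tick n s) x).Stable ∧
      dheight ω n s x < dheight ω n t x})
    (b := fun n => ringBound θ s t n * (2 * ((nbs d).card *
        (ringBound θ s t n * growthBound d θ T M))))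
    (fun ω hω => ?_) (fun n => ?_) ?_
  · filter_upwards [eventually_walk_eq hω.1 x, eventually_dheight_lt hω.2.2] with n h1 h2
    exact ⟨h1 ▸ hω.2.1, h2⟩
  · have hm : MeasurableSet {v : (Config d × InstrField d) × Clocks d |
        (walk v (tick n s) x).Stable ∧ tops v (tick n s) x < tops v (tick n t) x} :=
      ((measurable_walk_apply _ x).setOf_discrete Occ.Stable).inter
        (measurableSet_lt (measurable_tops_apply _ x) (measurable_tops_apply _ x))
    refine ((measurePreserving_atLevel ρ θ n).measure_preimage hm.nullMeasurableSet).trans_le ?_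
    refine (measure_stable_topple_le ρ (ringProb θ n) hM (tick_mono n hst)
      (tick_mono n htT) x).trans ?_
    rw [← mul_assoc, ← mul_assoc ((tick n t - tick n s : ℕ) : ℝ≥0∞) (ENNReal.ofReal _) (M * _)]
    have h1 := tick_sub_mul_ringProb_le θ hst n
    exact mul_le_mul' h1 (mul_le_mul_right (mul_le_mul_right (mul_le_mul' h1
      (mul_le_mul_right (growth_pow_le θ n T) _)) _) _)
  · have h1 := tendsto_ringBound θ s t
    have hf : ENNReal.ofReal (θ * (t - s)) ≠ ⊤ := ENNReal.ofReal_ne_top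
    have h2 := ENNReal.Tendsto.mul_const h1 (b := growthBound d θ T M) (Or.inr hb.ne)
    have h3 := ENNReal.Tendsto.const_mul (a := 2) (ENNReal.Tendsto.const_mul
      (a := ((nbs d).card : ℝ≥0∞)) h2 (Or.inr (by simp))) (Or.inr (by simp))
    refine ENNReal.Tendsto.mul h1 (Or.inr ?_) h3 (Or.inr hf)
    exact ENNReal.mul_ne_top (by simp) (ENNReal.mul_ne_top (by simp)
      (ENNReal.mul_ne_top hf hb.ne))

end Bounds

/-! ### Truncation of the initial configuration -/

theorem IsLocal.measurableSet {A : Set (Config d)} (hA : IsLocal A) : MeasurableSet A := by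
  obtain ⟨B, hB⟩ := hA
  have h : A = (fun (ξ : Config d) (x : B) => ξ x) ⁻¹' ((fun (ξ : Config d) (x : B) => ξ x) '' A) := by
    ext ξ
    refine ⟨fun h => ⟨ξ, h, rfl⟩, ?_⟩
    rintro ⟨ζ, hζ, he⟩
    have : (ζ ∈ A) = (ξ ∈ A) := hB fun x hx => congrFun he ⟨x, hx⟩
    exact this ▸ hζ
  rw [h]
  have hm : Measurable fun (ξ : Config d) (x : B) => ξ x :=
    measurable_pi_lambda _ fun x => measurable_pi_apply (x : Site d)
  exact hm (Set.to_countable _).measurableSet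

theorem IsLocal.eventually_mem_iff {A : Set (Config d)} (hA : IsLocal A) {ι : Type*} {l : Filter ι}
    {γ : ι → Config d} {ξ : Config d} (h : ∀ x, ∀ᶠ i in l, γ i x = ξ x) :
    ∀ᶠ i in l, (γ i ∈ A ↔ ξ ∈ A) := by
  obtain ⟨B, hB⟩ := hA
  filter_upwards [B.eventually_all.2 fun x _ => h x] with i hi
  exact iff_of_eq (hB hi)

theorem measurable_truncate (V : Finset (Site d)) : Measurable (truncate (d := d) V) :=
  measurable_pi_lambda _ fun x => by
    by_cases hx : x ∈ V
    · simpa only [truncate, if_pos hx] using measurable_pi_apply x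
    · simp only [truncate, if_neg hx, measurable_const]

/-- Truncation of the initial configuration. -/
def truncOmega (V : Finset (Site d)) (ω : Omega d) : Omega d :=
  ((truncate V ω.1.1, ω.1.2), ω.2)

theorem measurable_truncOmega (V : Finset (Site d)) : Measurable (truncOmega (d := d) V) :=
  (((measurable_truncate V).comp (measurable_fst.comp measurable_fst)).prodMk
    (measurable_snd.comp measurable_fst)).prodMk measurable_snd

theorem rank_truncate_le (V : Finset (Site d)) (η : Config d) (x : Site d) :
    (truncate V η x).rank ≤ (η x).rank := by
  rw [truncate]
  split_ifs
  · rfl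
  · exact rank_active_zero_le _

theorem height_truncOmega_le (V : Finset (Site d)) (ω : Omega d) (t : ℝ≥0) (x : Site d) :
    height (truncOmega V ω) t x ≤ height ω t x :=
  iSup_mono fun n => Nat.cast_le.2
    (chain_mono_init (rank_truncate_le V ω.1.1) ω.1.2 (clocks ω.2 n) (tick n t) x)

/-- The value is attained at a finite level, where the chain sees only finitely many initial sites;
once `V` contains them nothing is lost, and nothing can be gained by monotonicity. -/
theorem eventually_height_truncOmega {ω : Omega d} {t : ℝ≥0} {x : Site d}
    (h : height ω t x < ⊤) :
    ∀ᶠ V in atTop, height (truncOmega V ω) t x = height ω t x := by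
  obtain ⟨n, hn⟩ := (eventually_dheight_eq h).exists
  obtain ⟨F, hF⟩ := exists_finset_chain_congr (d := d) (tick n t) x
  filter_upwards [eventually_ge_atTop F] with V hV
  refine (height_truncOmega_le V ω t x).antisymm ?_
  rw [← hn]
  refine le_trans (Nat.cast_le.2 (le_of_eq ?_)) (dheight_le_height (truncOmega V ω) n t x)
  exact hF _ _ _ _ fun y hy => (if_pos (hV hy)).symm

theorem eventually_stateAt_truncOmega {ω : Omega d} {t : ℝ≥0} (h : ∀ x, height ω t x < ⊤)
    (x : Site d) : ∀ᶠ V in atTop, stateAt (truncOmega V ω) t x = stateAt ω t x := by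
  filter_upwards [eventually_height_truncOmega (h x), (nbs d).eventually_all.2 fun z _ =>
    eventually_height_truncOmega (h (x - z)), eventually_ge_atTop {x}] with V h1 h2 h3
  have h4 : x ∈ V := h3 (Finset.mem_singleton_self x)
  exact (cfg_congr_left (by simp [truncOmega, truncate, h4])).trans
    (cfg_congr (by rw [h1]) fun z hz => by rw [h2 z hz])

theorem eventually_follows_iff {ι : Type*} {f : Filter ι} {γ : ι → ℝ≥0 → Config d}
    {γ' : ℝ≥0 → Config d} (h : ∀ t x, ∀ᶠ i in f, γ i t x = γ' t x)
    {l : List (ℝ≥0 × Set (Config d))} (hl : ∀ e ∈ l, IsLocal e.2) (t : ℝ≥0) :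
    ∀ᶠ i in f, (Follows (γ i) t l ↔ Follows γ' t l) := by
  induction l generalizing t with
  | nil => exact Eventually.of_forall fun _ => Iff.rfl
  | cons e l ih =>
    filter_upwards [(hl e List.mem_cons_self).eventually_mem_iff (h (t + e.1)),
      ih (fun e he => hl e (List.mem_cons_of_mem _ he)) (t + e.1)] with i h1 h2
    exact and_congr h1 h2

/-- `discretize` takes differences of rounded times, not rounded differences, so that the increments
add up exactly to the rounded observation times. -/
theorem visits_discretize_iff (γ : ℕ → Config d) (n : ℕ) (t : ℝ≥0)
    (l : List (ℝ≥0 × Set (Config d))) :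
    Visits γ (tick n t) (discretize n t l) ↔ Follows (fun s => γ (tick n s)) t l := by
  induction l generalizing t with
  | nil => exact Iff.rfl
  | cons e l ih =>
    rw [discretize, Visits, Follows, Nat.add_sub_cancel' (tick_mono n le_self_add), ih]

theorem tick_zero (n : ℕ) : tick n 0 = 0 := by simp [tick]

theorem measurableSet_follows {X : Type*} [MeasurableSpace X] {γ : X → ℝ≥0 → Config d}
    (hγ : ∀ t, Measurable fun ω => γ ω t) (t : ℝ≥0) {l : List (ℝ≥0 × Set (Config d))}
    (hl : ∀ e ∈ l, MeasurableSet e.2) : MeasurableSet {ω | Follows (γ ω) t l} := by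
  induction l generalizing t with
  | nil => simp [Follows]
  | cons e l ih =>
    exact ((hγ _) (hl e List.mem_cons_self)).inter
      (ih _ fun e he => hl e (List.mem_cons_of_mem _ he))

/-- The times at which the path is observed. -/
def times : ℝ≥0 → List (ℝ≥0 × Set (Config d)) → List ℝ≥0
  | _, [] => []
  | t, e :: l => (t + e.1) :: times (t + e.1) l

theorem follows_congr_times {γ γ' : ℝ≥0 → Config d} {t : ℝ≥0} {l : List (ℝ≥0 × Set (Config d))}
    (h : ∀ s ∈ times t l, γ s = γ' s) : Follows γ t l ↔ Follows γ' t l := by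
  induction l generalizing t with
  | nil => exact Iff.rfl
  | cons e l ih =>
    rw [times, List.forall_mem_cons] at h
    rw [Follows, Follows, h.1, ih h.2]

/-! ### Existence of the process -/

section Existence

variable {lam : ℝ≥0} {p : PMF (Site d)} {ν : Measure (Config d)}

instance (lam : ℝ≥0) (p : PMF (Site d)) (ν : Measure (Config d)) [IsProbabilityMeasure ν] :
    IsProbabilityMeasure (sitewise lam p ν) :=
  inferInstanceAs (IsProbabilityMeasure (ν.prod (fieldLaw lam p)))

/-- The joint law of the initial configuration, the instructions and the clocks. -/
abbrev omegaLaw (lam : ℝ≥0) (p : PMF (Site d)) (ν : Measure (Config d)) : Measure (Omega d) :=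
  (sitewise lam p ν).prod (noiseLaw d (1 + lam))

theorem lintegral_count_sitewise {M : ℝ≥0∞} (hM : ∀ x, ∫⁻ ξ, ((ξ x).count : ℝ≥0∞) ∂ν ≤ M)
    (x : Site d) : ∫⁻ r, ((r.1 x).count : ℝ≥0∞) ∂sitewise lam p ν ≤ M := by
  have hm : Measurable fun ξ : Config d => ((ξ x).count : ℝ≥0∞) :=
    (Measurable.of_discrete (f := fun o : Occ => (o.count : ℝ≥0∞))).comp
      (f := fun ξ : Config d => ξ x) (measurable_pi_apply x)
  exact (measurePreserving_fst (μ := ν) (ν := fieldLaw lam p)).lintegral_comp hm |>.trans_le (hM x)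

variable [IsProbabilityMeasure ν]

/-- Conditioning on the initial configuration leaves independent instructions and level-`n` clocks,
which is the randomness of the discrete chain. -/
theorem measure_visits_eq (V : Finset (Site d)) (n : ℕ) (l : List (ℝ≥0 × Set (Config d)))
    (hl : ∀ e ∈ l, MeasurableSet e.2) :
    (omegaLaw lam p ν) {ω | Follows (fun t => walk (atLevel n (truncOmega V ω)) (tick n t)) 0 l} =
      ∫⁻ ξ, chainProb lam p (ringProb (1 + lam) n) (discretize n 0 l) (truncate V ξ) ∂ν := by
  have hE : MeasurableSet {v : Config d × (InstrField d × Clocks d) |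
      Visits (path (truncate V v.1) v.2) 0 (discretize n 0 l)} := by
    have h := measurableSet_visits (measurable_path (d := d)) 0 _
      (measurableSet_of_mem_discretize (n := n) hl 0)
    exact (((measurable_truncate V).comp measurable_fst).prodMk measurable_snd) h
  have h1 : {ω : Omega d | Follows (fun t => walk (atLevel n (truncOmega V ω)) (tick n t)) 0 l} =
      (fun ω => MeasurableEquiv.prodAssoc (atLevel n ω)) ⁻¹'
        {v : Config d × (InstrField d × Clocks d) |
          Visits (path (truncate V v.1) v.2) 0 (discretize n 0 l)} := by
    ext ω
    simp only [Set.mem_preimage, Set.mem_ofPred_eq]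
    rw [← visits_discretize_iff, tick_zero]
    rfl
  have h2 : MeasurePreserving (fun ω : Omega d => MeasurableEquiv.prodAssoc (atLevel n ω))
      (omegaLaw lam p ν) (ν.prod (stepLaw lam p (ringProb (1 + lam) n))) :=
    (measurePreserving_prodAssoc ν (fieldLaw lam p) _).comp
      (measurePreserving_atLevel (sitewise lam p ν) (1 + lam) n)
  rw [h1, h2.measure_preimage hE.nullMeasurableSet, Measure.prod_apply hE]
  rfl

theorem measurable_chainProb (q : unitInterval) (l : List (ℕ × Set (Config d)))
    (hl : ∀ e ∈ l, MeasurableSet e.2) : Measurable (chainProb lam p q l) :=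
  measurable_measure_prodMk_left (measurableSet_visits measurable_path 0 l hl)

theorem tendsto_measureReal_of_eventually_iff {X ι : Type*} [MeasurableSpace X] {μ : Measure X}
    [IsFiniteMeasure μ] {f : Filter ι} [f.IsCountablyGenerated] {A : Set X} {As : ι → Set X}
    (hA : MeasurableSet A) (hAs : ∀ i, MeasurableSet (As i))
    (h : ∀ᵐ ω ∂μ, ∀ᶠ i in f, ω ∈ As i ↔ ω ∈ A) :
    Tendsto (fun i => μ.real (As i)) f (𝓝 (μ.real A)) :=
  (ENNReal.tendsto_toReal (measure_ne_top _ _)).comp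
    (tendsto_measure_of_ae_tendsto_indicator_of_isFiniteMeasure f hA hAs h)

variable {M : ℝ≥0∞}

/-- Both sides are limits, as `n` tends to infinity, of the same probabilities for the chain of
level `n`: one by the semigroup convergence, the other by pathwise convergence under the coupling.
-/
theorem integral_finiteProb_eq (hp : p.support ⊆ neighbors d)
    (hM : ∀ x, ∫⁻ ξ, ((ξ x).count : ℝ≥0∞) ∂ν ≤ M) (hMt : M < ⊤) (V : Finset (Site d))
    {l : List (ℝ≥0 × Set (Config d))} (hl : ∀ e ∈ l, IsLocal e.2) :
    ∫ ξ, finiteProb lam p l (truncate V ξ) ∂ν =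
      (omegaLaw lam p ν).real {ω | Follows (stateAt (truncOmega V ω)) 0 l} := by
  have hl' : ∀ e ∈ l, MeasurableSet e.2 := fun e he => (hl e he).measurableSet
  have hmT := measurable_truncOmega (d := d) V
  have h1 : Tendsto (fun n => (omegaLaw lam p ν).real
      {ω | Follows (fun t => walk (atLevel n (truncOmega V ω)) (tick n t)) 0 l}) atTop
      (𝓝 ((omegaLaw lam p ν).real {ω | Follows (stateAt (truncOmega V ω)) 0 l})) := by
    refine tendsto_measureReal_of_eventually_iff
      (measurableSet_follows (fun t => (measurable_stateAt t).comp hmT) 0 hl')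
      (fun n => measurableSet_follows (fun t => (measurable_walk _).comp
        ((measurable_atLevel n).comp hmT)) 0 hl') ?_
    filter_upwards [ae_height_lt_top (1 + lam) (lintegral_count_sitewise hM) hMt] with ω hω
    exact eventually_follows_iff (fun t x => eventually_walk_eq
      (fun y => (height_truncOmega_le V ω t y).trans_lt (hω t y)) x) hl 0
  have h2 : Tendsto (fun n => ∫ ξ, (chainProb lam p (ringProb (1 + lam) n) (discretize n 0 l)
      (truncate V ξ)).toReal ∂ν) atTop (𝓝 (∫ ξ, finiteProb lam p l (truncate V ξ) ∂ν)) := by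
    refine tendsto_integral_of_dominated_convergence (fun _ => 1) (fun n => ?_)
      (integrable_const _) (fun n => ae_of_all _ fun ξ => ?_) (ae_of_all _ fun ξ => ?_)
    · exact ((measurable_chainProb _ _ (measurableSet_of_mem_discretize hl' 0)).comp
        (measurable_truncate V)).ennreal_toReal.aestronglyMeasurable
    · rw [Real.norm_of_nonneg ENNReal.toReal_nonneg]
      exact ENNReal.toReal_le_of_le_ofReal zero_le_one (by simpa using chainProb_le_one _ _ _ _ _)
    · exact tendsto_chainProb hp hl' (finCfg_truncate V ξ)
  refine tendsto_nhds_unique h2 (h1.congr fun n => ?_)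
  rw [measureReal_def, measure_visits_eq V n l hl']
  refine (integral_toReal ?_ (ae_of_all _ fun ξ =>
    (chainProb_le_one _ _ _ _ _).trans_lt ENNReal.one_lt_top)).symm
  exact ((measurable_chainProb _ _ (measurableSet_of_mem_discretize hl' 0)).comp
    (measurable_truncate V)).aemeasurable

theorem isProcess_procAt (hp : p.support ⊆ neighbors d)
    (hM : ∀ x, ∫⁻ ξ, ((ξ x).count : ℝ≥0∞) ∂ν ≤ M) (hMt : M < ⊤) :
    IsProcess lam p ν (omegaLaw lam p ν) (fun t ω => procAt ω t) where
  measurable := measurable_procAt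
  rightCont := ae_of_all _ eventually_procAt_eq
  initial := by
    have h1 : (fun ω : Omega d => procAt ω 0) =ᵐ[omegaLaw lam p ν] fun ω => ω.1.1 := by
      filter_upwards [ae_rheight_eq (1 + lam) (lintegral_count_sitewise hM) hMt 0] with ω hω
      have h0 : (fun x => (rheight ω 0 x).toNat) = 0 := by
        ext x
        have : ∀ n, dheight ω n 0 x = 0 := fun n => by simp [dheight, tick, tops, chain]
        simp [hω x, height, this]
      rw [procAt, h0, cfg_zero]
    rw [Measure.map_congr h1]
    exact (measurePreserving_fst.comp measurePreserving_fst).map_eq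
  approx := by
    intro l hl
    have hl' : ∀ e ∈ l, MeasurableSet e.2 := fun e he => (hl e he).measurableSet
    have h1 : (omegaLaw lam p ν).real {ω | Follows (fun t => procAt ω t) 0 l} =
        (omegaLaw lam p ν).real {ω | Follows (stateAt ω) 0 l} := by
      refine measureReal_congr ?_
      -- Only finitely many times are observed, so the null sets on which `procAt` and `stateAt`
      -- differ can be discarded together.
      have h : ∀ᵐ ω ∂omegaLaw lam p ν, ∀ t ∈ times 0 l, ∀ x, rheight ω t x = height ω t x := by
        have : ∀ᵐ ω ∂omegaLaw lam p ν, ∀ t ∈ {t | t ∈ times 0 l}, ∀ x,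
            rheight ω t x = height ω t x :=
          (ae_ball_iff (List.finite_toSet _).countable).2 fun t _ =>
            ae_rheight_eq (1 + lam) (lintegral_count_sitewise hM) hMt t
        exact this
      filter_upwards [h] with ω hω
      refine propext (follows_congr_times fun t ht => ?_)
      rw [procAt, stateAt]
      congr 1
      ext x
      rw [hω t ht]
    rw [h1]
    simp only [integral_finiteProb_eq hp hM hMt _ hl]
    refine tendsto_measureReal_of_eventually_iff
      (measurableSet_follows measurable_stateAt 0 hl')
      (fun V => measurableSet_follows (fun t => (measurable_stateAt t).comp
        (measurable_truncOmega V)) 0 hl') ?_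
    filter_upwards [ae_height_lt_top (1 + lam) (lintegral_count_sitewise hM) hMt] with ω hω
    exact eventually_follows_iff (fun t x => eventually_stateAt_truncOmega (hω t) x) hl 0

end Existence

/-! ### Independence and recurrence in product spaces -/

section Product

variable {ι X : Type*} [MeasurableSpace X]

/-- Events that depend on disjoint sets of coordinates are independent. -/
theorem infinitePi_inter_of_dependsOn (μ : ι → Measure X) [∀ i, IsProbabilityMeasure (μ i)]
    {E E' : Set (ι → X)} (hE : MeasurableSet E) (hE' : MeasurableSet E') (s : Set ι)
    (hs : ∀ ω ω' : ι → X, (∀ i ∈ s, ω i = ω' i) → (ω ∈ E ↔ ω' ∈ E))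
    (hs' : ∀ ω ω' : ι → X, (∀ i ∉ s, ω i = ω' i) → (ω ∈ E' ↔ ω' ∈ E')) :
    Measure.infinitePi μ (E ∩ E') = Measure.infinitePi μ E * Measure.infinitePi μ E' := by
  classical
  have h := map_mix μ μ μ (fun i => i ∈ s) (a := id) (b := id) Function.injective_id.injOn
    Function.injective_id.injOn (fun _ _ => rfl) fun _ _ => rfl
  rw [← h.measure_preimage (hE.inter hE').nullMeasurableSet, ← Measure.prod_prod]
  congr 1
  ext w
  simp only [Set.mem_preimage, Set.mem_inter_iff, Set.mem_prod]
  exact and_congr (hs _ _ fun i hi => by simp [hi]) (hs' _ _ fun i hi => by simp [hi])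

/-- An event of positive probability occurs at infinitely many coordinates of any sequence. -/
theorem ae_frequently_mem (μ : Measure X) [IsProbabilityMeasure μ] {a : ℕ → ι}
    (ha : Function.Injective a) {S : Set X} (hS : MeasurableSet S) (hpos : μ S ≠ 0) :
    ∀ᵐ ω ∂Measure.infinitePi fun _ : ι => μ, ∀ i₀, ∃ i ≥ i₀, ω (a i) ∈ S := by
  refine ae_all_iff.2 fun i₀ => ?_
  rw [ae_iff]
  have hlt : μ Sᶜ < 1 := by
    rw [prob_compl_eq_one_sub hS]
    exact ENNReal.sub_lt_self ENNReal.one_ne_top one_ne_zero hpos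
  have hle : ∀ k : ℕ, (Measure.infinitePi fun _ : ι => μ) {ω | ¬ ∃ i ≥ i₀, ω (a i) ∈ S} ≤
      μ Sᶜ ^ k := by
    intro k
    have h := infinitePi_forall_mem (fun _ : ι => μ) (s := Finset.Ico i₀ (i₀ + k))
      ha.injOn (t := fun _ => Sᶜ) fun _ => hS.compl
    rw [Finset.prod_const, Nat.card_Ico, Nat.add_sub_cancel_left] at h
    rw [← h]
    refine measure_mono fun ω hω i hi => ?_
    simp only [Set.mem_ofPred_eq, not_exists, not_and] at hω
    exact hω i (Finset.mem_Ico.1 hi).1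
  exact le_antisymm (ge_of_tendsto' (x := atTop)
    (ENNReal.tendsto_pow_atTop_nhds_zero_of_lt_one hlt) hle) zero_le

end Product

/-! ### Translation invariance -/

section Sitewise

variable {lam : ℝ≥0} {p : PMF (Site d)} {ν : Measure (Config d)}

/-- An instance of `map_mix` with the always true predicate; the second field is a dummy and is
projected away. -/
theorem measurePreserving_translate (lam : ℝ≥0) (p : PMF (Site d)) (z : Site d) :
    MeasurePreserving (translate z) (fieldLaw lam p) (fieldLaw lam p) := by
  have h := map_mix (fun _ : Site d × ℕ => (instrPMF lam p).toMeasure)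
    (fun _ : Site d × ℕ => (instrPMF lam p).toMeasure)
    (fun _ : Site d × ℕ => (instrPMF lam p).toMeasure) (fun _ => True)
    (a := fun q : Site d × ℕ => (q.1 + z, q.2)) (b := id)
    (fun q _ r _ hqr => by
      simp only [Prod.mk.injEq, add_left_inj] at hqr
      exact Prod.ext hqr.1 hqr.2) Function.injective_id.injOn (fun _ _ => rfl) fun _ _ => rfl
  simp only [if_true] at h
  have hm : Measurable (translate (d := d) z) :=
    measurable_pi_lambda _ fun q => measurable_pi_apply _
  refine ⟨hm, ?_⟩
  have h2 := h.map_eq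
  rw [show (fun w : InstrField d × InstrField d => fun q : Site d × ℕ => w.1 (q.1 + z, q.2)) =
    translate z ∘ Prod.fst from rfl, ← Measure.map_map hm measurable_fst,
    measurePreserving_fst.map_eq] at h2
  exact h2

/-- Joint translation of the configuration and of the instructions. -/
def translatePair (z : Site d) (r : Config d × InstrField d) : Config d × InstrField d :=
  (shift z r.1, translate z r.2)

theorem measurePreserving_translatePair [SFinite ν] (lam : ℝ≥0) (p : PMF (Site d))
    (hν : TranslationErgodic ν) (z : Site d) :
    MeasurePreserving (translatePair z) (sitewise lam p ν) (sitewise lam p ν) :=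
  (hν.invariant z).prod (measurePreserving_translate lam p z)

theorem nbField_translate_iff {z : Site d} {I : InstrField d} :
    NbField (translate z I) ↔ NbField I := by
  refine ⟨fun h q w hq => h (q.1 - z, q.2) w ?_, fun h => h.translate z⟩
  simpa [translate] using hq

theorem ae_sitewise_nbField (lam : ℝ≥0) (hp : p.support ⊆ neighbors d) :
    ∀ᵐ r ∂sitewise lam p ν, NbField r.2 :=
  Measure.quasiMeasurePreserving_snd.ae (ae_nbField lam hp)

/-- Given `η`, the event and its translate read disjoint sets of instructions. The configuration
need not decorrelate, so the factors remain under the integral. -/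
theorem measure_inter_translate_eq {E : Set (Config d × InstrField d)} (hE : MeasurableSet E)
    {F : Finset (Site d × ℕ)}
    (hF : ∀ η I I', (∀ c ∈ F, I c = I' c) → ((η, I) ∈ E ↔ (η, I') ∈ E)) {z : Site d}
    (hz : ∀ c ∈ F, (c.1 + z, c.2) ∉ F) :
    sitewise lam p ν (E ∩ translatePair z ⁻¹' E) =
      ∫⁻ η, fieldLaw lam p (Prod.mk η ⁻¹' E) * fieldLaw lam p (Prod.mk (shift z η) ⁻¹' E) ∂ν := by
  have hmT : Measurable (translatePair (d := d) z) :=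
    (measurable_pi_lambda _ fun x => measurable_pi_apply (x + z)).prodMap
      (measurable_pi_lambda _ fun q => measurable_pi_apply (q.1 + z, q.2))
  rw [sitewise, Measure.prod_apply (hE.inter (hmT hE))]
  refine lintegral_congr fun η => ?_
  have hm : ∀ η, MeasurableSet (Prod.mk η ⁻¹' E) := fun η => measurable_prodMk_left hE
  rw [← (measurePreserving_translate lam p z).measure_preimage (hm (shift z η)).nullMeasurableSet]
  refine infinitePi_inter_of_dependsOn _ (hm η)
    ((measurePreserving_translate lam p z).measurable (hm (shift z η))) (F : Set (Site d × ℕ))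
    (fun I I' h => hF η I I' fun c hc => h c hc) fun I I' h => hF _ _ _ fun c hc => ?_
  exact h _ fun hc' => hz c hc hc'

theorem ae_infinite_jump (lam : ℝ≥0) (p : PMF (Site d)) {z : Site d} (hz : z ∈ p.support)
    (x : Site d) : ∀ᵐ r ∂sitewise lam p ν, {j | r.2 (x, j) = .jump z}.Infinite := by
  refine Measure.quasiMeasurePreserving_snd.ae (p := fun I : InstrField d =>
    {j | I (x, j) = .jump z}.Infinite) ?_
  have h : (instrPMF lam p).toMeasure {Instr.jump z} ≠ 0 := by
    rw [PMF.toMeasure_apply_singleton _ _ (measurableSet_singleton _), instrPMF_jump]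
    exact (ENNReal.div_pos ((PMF.mem_support_iff p z).1 hz) (by simp)).ne'
  filter_upwards [ae_frequently_mem (instrPMF lam p).toMeasure (a := fun j => (x, j))
    (fun i j hij => (Prod.mk.inj hij).2) (measurableSet_singleton _) h] with I hI
  refine Set.infinite_of_forall_exists_gt fun j => ?_
  obtain ⟨k, hk, hI⟩ := hI (j + 1)
  exact ⟨k, hI, hk⟩

variable [IsProbabilityMeasure ν]

theorem measurableSet_odometer_eq_top (x : Site d) :
    MeasurableSet {r : Config d × InstrField d | NbField r.2 ∧ odometer r.2 r.1 x = ⊤} := by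
  have h : {r : Config d × InstrField d | NbField r.2 ∧ odometer r.2 r.1 x = ⊤} =
      {r | NbField r.2} \ {r | NbField r.2 ∧ odometer r.2 r.1 x < ⊤} := by
    ext r
    simp only [Set.mem_ofPred_eq, Set.mem_sdiff, lt_top_iff_ne_top]
    tauto
  rw [h]
  exact (measurable_snd measurableSet_nbField).diff (measurableSet_odometer_lt_top x)

/-- Only one implication is a direct consequence of the dynamics, as the reverse jump may be
impossible. By translation invariance the two events have the same probability, so the inclusion is
an almost sure equality. -/
theorem ae_odometer_eq_top_add (hp : p.support ⊆ neighbors d) (hν : TranslationErgodic ν)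
    {z : Site d} (hz : z ∈ p.support) (x : Site d) : ∀ᵐ r ∂sitewise lam p ν,
      (odometer r.2 r.1 x = ⊤ ↔ odometer r.2 r.1 (x + z) = ⊤) := by
  set A : Site d → Set (Config d × InstrField d) := fun y =>
    {r | NbField r.2 ∧ odometer r.2 r.1 y = ⊤} with hA
  have h1 : A x ≤ᵐ[sitewise lam p ν] A (x + z) := by
    filter_upwards [ae_infinite_jump (ν := ν) lam p hz x] with r hr hrA
    exact ⟨hrA.1, odometer_eq_top_of_neighbor hrA.1 (mem_nbs.2 (hp hz)) hr hrA.2⟩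
  have h2 : sitewise lam p ν (A (x + z)) = sitewise lam p ν (A x) := by
    rw [← (measurePreserving_translatePair lam p hν z).measure_preimage
      (measurableSet_odometer_eq_top x).nullMeasurableSet]
    congr 1
    ext r
    simp only [hA, Set.mem_preimage, Set.mem_ofPred_eq, translatePair, nbField_translate_iff]
    refine and_congr_right fun h => ?_
    rw [odometer_translate h]
  have h3 : A x =ᵐ[sitewise lam p ν] A (x + z) :=
    ae_eq_of_ae_subset_of_measure_ge h1 h2.le
      (measurableSet_odometer_eq_top x).nullMeasurableSet (measure_ne_top _ _)
  filter_upwards [h3, ae_sitewise_nbField lam hp] with r hr hN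
  have h4 : (NbField r.2 ∧ odometer r.2 r.1 x = ⊤) = (NbField r.2 ∧ odometer r.2 r.1 (x + z) = ⊤) :=
    hr
  simpa only [hN, true_and, eq_iff_iff] using h4

/-- The sites along which the property propagates in both directions form a subgroup containing the
support of `p`. -/
theorem ae_odometer_eq_top_iff (hp : p.support ⊆ neighbors d)
    (hp_gen : AddSubgroup.closure p.support = ⊤) (hν : TranslationErgodic ν) :
    ∀ᵐ r ∂sitewise lam p ν, ∀ x, (odometer r.2 r.1 x = ⊤ ↔ odometer r.2 r.1 0 = ⊤) := by
  have h : ∀ᵐ r ∂sitewise lam p ν, ∀ z ∈ p.support, ∀ x,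
      (odometer r.2 r.1 x = ⊤ ↔ odometer r.2 r.1 (x + z) = ⊤) :=
    (ae_ball_iff (Set.to_countable _)).2 fun z hz =>
      ae_all_iff.2 fun x => ae_odometer_eq_top_add hp hν hz x
  filter_upwards [h] with r hr x
  have hx : x ∈ AddSubgroup.closure p.support := hp_gen ▸ AddSubgroup.mem_top x
  suffices ∀ y, (odometer r.2 r.1 (y + x) = ⊤ ↔ odometer r.2 r.1 y = ⊤) by
    simpa using this 0
  induction hx using AddSubgroup.closure_induction with
  | mem z hz => exact fun y => (hr z hz y).symm
  | zero => simp
  | add a b _ _ iha ihb => exact fun y => by rw [← add_assoc, ihb, iha]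
  | neg a _ ih =>
    intro y
    have := ih (y + -a)
    rw [neg_add_cancel_right] at this
    exact this.symm

/-! ### The zero-one law -/

/-- Events that depend on finitely many instructions. -/
def finiteEvents (d : ℕ) : Set (Set (Config d × InstrField d)) :=
  {E | MeasurableSet E ∧ ∃ F : Finset (Site d × ℕ), ∀ η I I', (∀ c ∈ F, I c = I' c) →
    ((η, I) ∈ E ↔ (η, I') ∈ E)}

theorem isSetRing_finiteEvents : IsSetRing (finiteEvents d) where
  empty_mem := ⟨MeasurableSet.empty, ∅, fun _ _ _ _ => Iff.rfl⟩
  union_mem := by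
    classical
    rintro E E' ⟨hE, F, hF⟩ ⟨hE', F', hF'⟩
    refine ⟨hE.union hE', F ∪ F', fun η I I' h => or_congr ?_ ?_⟩
    · exact hF η I I' fun c hc => h c (Finset.mem_union_left _ hc)
    · exact hF' η I I' fun c hc => h c (Finset.mem_union_right _ hc)
  sdiff_mem := by
    classical
    rintro E E' ⟨hE, F, hF⟩ ⟨hE', F', hF'⟩
    refine ⟨hE.diff hE', F ∪ F', fun η I I' h => and_congr ?_ (not_congr ?_)⟩
    · exact hF η I I' fun c hc => h c (Finset.mem_union_left _ hc)
    · exact hF' η I I' fun c hc => h c (Finset.mem_union_right _ hc)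

theorem generateFrom_finiteEvents :
    (inferInstance : MeasurableSpace (Config d × InstrField d)) =
      MeasurableSpace.generateFrom (finiteEvents d) := by
  refine le_antisymm ?_ (MeasurableSpace.generateFrom_le fun E hE => hE.1)
  refine sup_le ?_ ?_
  · rintro _ ⟨S, hS, rfl⟩
    exact MeasurableSpace.measurableSet_generateFrom
      ⟨measurable_fst hS, ∅, fun _ _ _ _ => Iff.rfl⟩
  · rw [MeasurableSpace.pi, MeasurableSpace.comap_iSup]
    refine iSup_le fun c => ?_
    rw [MeasurableSpace.comap_comp]
    rintro _ ⟨S, hS, rfl⟩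
    refine MeasurableSpace.measurableSet_generateFrom
      ⟨((measurable_pi_apply c).comp measurable_snd) hS, {c}, fun η I I' h => ?_⟩
    simp [h c (Finset.mem_singleton_self c)]

theorem exists_const_of_shift_invariant (hν : TranslationErgodic ν) {f : Config d → ℝ≥0∞}
    (hf : Measurable f) (hinv : ∀ z η, f (shift z η) = f η) : ∃ c, f =ᵐ[ν] fun _ => c := by
  refine Filter.exists_eventuallyEq_const_of_forall_separating MeasurableSet fun U hU => ?_
  have hm : MeasurableSet (f ⁻¹' U) := hf hU
  rcases hν.zero_one (f ⁻¹' U) hm fun z => by ext η; simp [hinv] with h | h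
  · right
    exact measure_eq_zero_iff_ae_notMem.1 h
  · left
    exact (prob_compl_eq_zero_iff hm).2 h

/-- It suffices that `z` is not one of the finitely many differences of sites occurring in `F`; for
`d ≥ 1` the lattice is infinite. -/
theorem exists_forall_notMem_add [Nonempty (Fin d)] (F : Finset (Site d × ℕ)) :
    ∃ z : Site d, ∀ c ∈ F, (c.1 + z, c.2) ∉ F := by
  classical
  obtain ⟨z, hz⟩ := Infinite.exists_notMem_finset
    ((F ×ˢ F).image fun c => c.2.1 - c.1.1)
  refine ⟨z, fun c hc hc' => hz (Finset.mem_image.2 ⟨(c, (c.1 + z, c.2)),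
    Finset.mem_product.2 ⟨hc, hc'⟩, by simp⟩)⟩

/-- The conditional probability of `A` given `η` is shift invariant, hence a constant `c` by
ergodicity of `ν`. Approximating `A` by an event `E` that reads finitely many instructions, and
translating so far that these are disjoint, gives `c ≤ c²` in the limit, so `c` is `0` or `1`. -/
theorem sitewise_zero_one [Nonempty (Fin d)] (hν : TranslationErgodic ν)
    {A : Set (Config d × InstrField d)} (hA : MeasurableSet A)
    (hinv : ∀ z, translatePair z ⁻¹' A = A) :
    sitewise lam p ν A = 0 ∨ sitewise lam p ν A = 1 := by
  obtain ⟨c, hc⟩ := exists_const_of_shift_invariant hν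
    (f := fun η => fieldLaw lam p (Prod.mk η ⁻¹' A)) (measurable_measure_prodMk_left hA)
    fun z η => by
      rw [← (measurePreserving_translate lam p z).measure_preimage
        (measurable_prodMk_left hA).nullMeasurableSet]
      congr 1
      exact congrArg (Prod.mk η ⁻¹' ·) (hinv z)
  have hAc : sitewise lam p ν A = c := by
    rw [sitewise, Measure.prod_apply hA, lintegral_congr_ae hc]
    simp
  have hc1 : c ≤ 1 := hAc ▸ prob_le_one
  suffices h : c ≤ c * c by
    rw [hAc]
    rcases eq_or_ne c 0 with h0 | h0
    · exact Or.inl h0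
    · refine Or.inr (hc1.antisymm ?_)
      have hct : c ≠ ⊤ := (hc1.trans_lt ENNReal.one_lt_top).ne
      rw [← ENNReal.mul_le_mul_iff_right h0 hct, mul_one]
      exact h
  -- The four errors: replacing `A` by `E` and by the translate of `E`, replacing the conditional
  -- probability of `E` by `c` in one factor, and replacing the probability of `E` by `c` in the
  -- other, where `c ≤ 1`.
  have hε : ∀ ε : ℝ≥0∞, 0 < ε → c ≤ c * c + 4 * ε := by
    intro ε hε
    obtain ⟨E, ⟨hE, F, hF⟩, hEA⟩ := exists_measure_symmDiff_lt_of_generateFrom_isSetRing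
      (μ := sitewise lam p ν) isSetRing_finiteEvents
      ⟨{Set.univ}, Set.countable_singleton _, 
        Set.singleton_subset_iff.2 ⟨MeasurableSet.univ, ∅, fun _ _ _ _ => Iff.rfl⟩, by simp⟩
      generateFrom_finiteEvents hA hε
    obtain ⟨z, hz⟩ := exists_forall_notMem_add F
    have hmp := measurePreserving_translatePair lam p hν z
    have hd1 : sitewise lam p ν (A \ E) ≤ ε :=
      (measure_mono Set.subset_union_right).trans hEA.le
    have hd2 : sitewise lam p ν (E \ A) ≤ ε :=
      (measure_mono Set.subset_union_left).trans hEA.le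
    have h1 : c ≤ sitewise lam p ν (E ∩ translatePair z ⁻¹' E) + ε + ε := by
      have hsub : A ⊆ (E ∩ translatePair z ⁻¹' E) ∪ (A \ E) ∪ translatePair z ⁻¹' (A \ E) := by
        intro r hr
        have hr' : translatePair z r ∈ A := by
          have : r ∈ translatePair z ⁻¹' A := (hinv z).symm ▸ hr
          exact this
        by_cases h1 : r ∈ E <;> by_cases h2 : translatePair z r ∈ E <;>
          simp [h1, h2, hr, hr']
      rw [← hAc]
      refine (measure_mono hsub).trans ((measure_union_le _ _).trans (add_le_add
        ((measure_union_le _ _).trans (add_le_add le_rfl hd1)) ?_))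
      rw [hmp.measure_preimage (hA.diff hE).nullMeasurableSet]
      exact hd1
    have h2 : sitewise lam p ν E ≤ c + ε := by
      rw [← hAc]
      exact (measure_mono fun r hr => by
        by_cases h : r ∈ A
        · exact Or.inl h
        · exact Or.inr ⟨hr, h⟩).trans ((measure_union_le A (E \ A)).trans (add_le_add le_rfl hd2))
    have hgm : Measurable fun η => fieldLaw lam p (Prod.mk (shift z η) ⁻¹' E) :=
      (measurable_measure_prodMk_left hE).comp (hν.invariant z).measurable
    have h3 : sitewise lam p ν (E ∩ translatePair z ⁻¹' E) ≤ c * sitewise lam p ν E + ε := by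
      rw [measure_inter_translate_eq hE hF hz]
      have hpt : ∀ᵐ η ∂ν, fieldLaw lam p (Prod.mk η ⁻¹' E) *
          fieldLaw lam p (Prod.mk (shift z η) ⁻¹' E) ≤
          c * fieldLaw lam p (Prod.mk (shift z η) ⁻¹' E) +
            fieldLaw lam p (Prod.mk η ⁻¹' (E \ A)) := by
        filter_upwards [hc] with η hη
        have h4 : fieldLaw lam p (Prod.mk η ⁻¹' E) ≤ c + fieldLaw lam p (Prod.mk η ⁻¹' (E \ A)) := by
          rw [← hη]
          exact (measure_mono fun I hI => by
            by_cases h : (η, I) ∈ A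
            · exact Or.inl h
            · exact Or.inr ⟨hI, h⟩).trans (measure_union_le _ _)
        refine (mul_le_mul_left h4 _).trans ?_
        rw [add_mul]
        exact add_le_add le_rfl (mul_le_of_le_one_right' prob_le_one)
      refine (lintegral_mono_ae hpt).trans ?_
      rw [lintegral_add_left (hgm.const_mul c), lintegral_const_mul c hgm]
      refine add_le_add (mul_le_mul_right (le_of_eq ?_) _) ?_
      · rw [sitewise, Measure.prod_apply hE]
        exact (hν.invariant z).lintegral_comp (measurable_measure_prodMk_left hE)
      · refine le_trans (le_of_eq ?_) hd2
        rw [sitewise, Measure.prod_apply (hE.diff hA)]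
    calc c ≤ c * sitewise lam p ν E + ε + ε + ε := h1.trans (by gcongr)
      _ ≤ c * (c + ε) + ε + ε + ε := by gcongr
      _ ≤ c * c + 1 * ε + ε + ε + ε := by rw [mul_add]; gcongr
      _ = _ := by ring
  refine ENNReal.le_of_forall_pos_le_add fun δ hδ _ => ?_
  have h := hε (δ / 4) (ENNReal.div_pos (by exact_mod_cast hδ.ne') (by simp))
  rwa [ENNReal.mul_div_cancel (by simp) (by simp)] at h

/-- The event that all sites topple infinitely often has probability zero or one. -/
theorem sitewise_odometer_zero_one (hp : p.support ⊆ neighbors d)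
    (hp_gen : AddSubgroup.closure p.support = ⊤) (hν : TranslationErgodic ν) :
    sitewise lam p ν {q | odometer q.2 q.1 0 < ⊤} = 0 ∨
      sitewise lam p ν {q | odometer q.2 q.1 0 < ⊤} = 1 := by
  -- The support of `p` is nonempty and there are no unit vectors in dimension zero.
  have hd : Nonempty (Fin d) := by
    obtain ⟨z, hz⟩ := p.support_nonempty
    obtain ⟨i, -⟩ := hp hz
    exact ⟨i⟩
  -- Asking for infinite odometers at all sites makes the event exactly invariant; it agrees with
  -- the one at the origin up to a null set.
  set A : Set (Config d × InstrField d) := {q | ∀ x, NbField q.2 ∧ odometer q.2 q.1 x = ⊤} with hA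
  have hAm : MeasurableSet A := by
    have : A = ⋂ x, {q | NbField q.2 ∧ odometer q.2 q.1 x = ⊤} := by
      ext q; simp [hA]
    rw [this]
    exact MeasurableSet.iInter measurableSet_odometer_eq_top
  have hinv : ∀ z, translatePair z ⁻¹' A = A := by
    intro z
    ext q
    simp only [hA, Set.mem_preimage, Set.mem_ofPred_eq, translatePair, nbField_translate_iff]
    constructor
    · intro h x
      have h1 := h (x - z)
      rw [odometer_translate h1.1, sub_add_cancel] at h1
      exact h1
    · intro h x
      have h1 := h (x + z)
      rw [odometer_translate h1.1]
      exact h1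
  have he : {q : Config d × InstrField d | odometer q.2 q.1 0 < ⊤} =ᵐ[sitewise lam p ν] Aᶜ := by
    filter_upwards [ae_odometer_eq_top_iff hp hp_gen hν, ae_sitewise_nbField lam hp] with q hq hN
    refine propext (show odometer q.2 q.1 0 < ⊤ ↔ ¬ ∀ x, NbField q.2 ∧ odometer q.2 q.1 x = ⊤ from ?_)
    rw [lt_top_iff_ne_top, not_iff_not]
    exact ⟨fun h x => ⟨hN, (hq x).2 h⟩, fun h => (h 0).2⟩
  rw [measure_congr he]
  rcases sitewise_zero_one (lam := lam) (p := p) hν hAm hinv with h | h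
  · exact Or.inr ((prob_compl_eq_one_iff hAm).2 h)
  · exact Or.inl ((prob_compl_eq_zero_iff hAm).2 h)

end Sitewise

/-! ### The limit odometer -/

/-- The odometer of the limit process at time infinity. -/
def total (ω : Omega d) (x : Site d) : ℕ∞ := ⨆ T : ℕ, height ω T x

theorem height_le_total (ω : Omega d) (t : ℝ≥0) (x : Site d) : height ω t x ≤ total ω x := by
  obtain ⟨T, hT⟩ := exists_nat_ge t
  exact (height_mono ω hT x).trans (le_iSup (fun T : ℕ => height ω T x) T)

theorem rheight_le_total (ω : Omega d) (t : ℝ≥0) (x : Site d) : rheight ω t x ≤ total ω x :=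
  (iInf_le _ 0).trans (height_le_total ω _ x)

theorem total_le_odometer {ω : Omega d} (hI : NbField ω.1.2) (x : Site d) :
    total ω x ≤ odometer ω.1.2 ω.1.1 x :=
  iSup_le fun _ => iSup_le fun _ => chain_le_odometer hI _ _ _ x

theorem eventually_le_height {ω : Omega d} {x : Site d} {k : ℕ} (h : (k : ℕ∞) ≤ total ω x) :
    ∀ᶠ T : ℕ in atTop, (k : ℕ∞) ≤ height ω T x := by
  rcases k with _ | k
  · simp
  · have h1 : (k : ℕ∞) < ⨆ T : ℕ, height ω T x :=
      lt_of_lt_of_le (Nat.cast_lt.2 (Nat.lt_succ_self k)) h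
    obtain ⟨T, hT⟩ := lt_iSup_iff.1 h1
    filter_upwards [eventually_ge_atTop T] with T' hT'
    push_cast
    exact Order.add_one_le_of_lt (hT.trans_le (height_mono ω (Nat.cast_le.2 hT') x))

/-- Every clock rings infinitely often. -/
def RingsForever (ω : Omega d) : Prop :=
  ∀ n x i₀, ∃ i ≥ i₀, clocks ω.2 n (x, 0, i) = true

theorem le_tick_natCast (n i : ℕ) : i ≤ tick n (i : ℝ≥0) := by
  refine Nat.le_floor ?_
  have : (1 : ℝ) ≤ 2 ^ n := one_le_pow₀ one_le_two
  push_cast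
  nlinarith [(Nat.cast_nonneg i : (0 : ℝ) ≤ i)]

/-- The limit field satisfies the criterion of `odometer_le_of_forall`: a site left unstable after
its last toppling would see its clock number `0` ring later, and would topple once more. -/
theorem odometer_le_total {ω : Omega d} (hI : NbField ω.1.2) (hfin : ∀ t x, height ω t x < ⊤)
    (hring : RingsForever ω) (x : Site d) : odometer ω.1.2 ω.1.1 x ≤ total ω x := by
  refine odometer_le_of_forall hI (fun α hα hle x hx => ?_) x
  by_contra hne
  have h1 : 1 ≤ (cfg ω.1.1 ω.1.2 (cnt α) x).activeCount := Nat.one_le_iff_ne_zero.2 hne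
  -- One time and one level at which the chain has already toppled at least as often as `α` at `x`
  -- and around it. From then on the odometer of this chain at `x` is pinned to `cnt α x`, while its
  -- state there is at least the active one left by `α`.
  obtain ⟨T, hT, hT'⟩ := ((eventually_le_height (hle x)).and ((nbs d).eventually_all.2 fun z _ =>
    eventually_le_height (hle (x - z)))).exists
  obtain ⟨n, hn, hn'⟩ := ((eventually_dheight_eq (hfin T x)).and ((nbs d).eventually_all.2
    fun z _ => eventually_dheight_eq (hfin T (x - z)))).exists
  obtain ⟨i, hi, hb⟩ := hring n x (tick n T)
  set v := atLevel n ω with hv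
  have hup : ∀ j, (tops v j x : ℕ∞) ≤ cnt α x := fun j => by
    rw [← hx]
    refine le_trans ?_ (height_le_total ω (j : ℕ) x)
    refine le_trans (Nat.cast_le.2 ?_) (dheight_le_height ω n (j : ℕ) x)
    exact tops_mono v x (le_tick_natCast n j)
  have hlo : ∀ j, tick n T ≤ j → cnt α x ≤ tops v j x := fun j hj =>
    (Nat.cast_le.1 (hT.trans hn.symm.le)).trans (tops_mono v x hj)
  have heq : tops v i x = cnt α x :=
    (Nat.cast_le.1 (hup i)).antisymm (hlo i hi)
  have hr : (cfg ω.1.1 ω.1.2 (cnt α) x).rank ≤ (walk v i x).rank :=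
    rank_cfg_mono ((LegalSeq.foldl_eq hI hα).1 x) le_rfl heq.symm fun z hz =>
      (Nat.cast_le.1 ((hT' z hz).trans (hn' z hz).symm.le)).trans (tops_mono v (x - z) hi)
  have hrings : Rings (walk v i x) fun m => v.2 (x, m, i) :=
    ⟨0, h1.trans (activeCount_mono hr), hb⟩
  have h2 : tops v (i + 1) x = tops v i x + 1 := chain_succ_eq hrings
  have h3 : tops v (i + 1) x ≤ cnt α x := Nat.cast_le.1 (hup (i + 1))
  omega

/-- If every site topples finitely often, then the process fixates. -/
theorem fixates_of_odometer_lt_top {ω : Omega d} (hI : NbField ω.1.2)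
    (htot : ∀ x, total ω x = odometer ω.1.2 ω.1.1 x) (h : ∀ x, odometer ω.1.2 ω.1.1 x < ⊤) :
    Fixates (procAt ω) := by
  intro x
  have hcoe : ∀ y, ((total ω y).toNat : ℕ∞) = total ω y := fun y =>
    ENat.natCast_toNat ((htot y).trans_lt (h y)).ne
  have hev : ∀ y, ∀ᶠ T : ℕ in atTop, total ω y ≤ height ω T y := fun y => by
    have := eventually_le_height (hcoe y).le
    rwa [hcoe] at this
  obtain ⟨T, hT, hT'⟩ := ((hev x).and ((nbs d).eventually_all.2 fun z _ => hev (x - z))).exists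
  refine ⟨T, fun t ht => ?_⟩
  have hr : ∀ y, total ω y ≤ height ω T y → rheight ω t y = total ω y := fun y hy =>
    (rheight_le_total ω t y).antisymm
      (hy.trans ((height_mono ω ht y).trans (height_le_rheight ω t y)))
  -- A legal sequence that realises the full odometer at `x` and at its neighbours leaves `x`
  -- stable; after time `T` the process has the same odometers there, hence the same state at `x`.
  obtain ⟨α, hα, hge⟩ := exists_legalSeq_ge_on hI (η := ω.1.1) (h := fun y => (total ω y).toNat)
    (insert x ((nbs d).image fun z => x - z)) fun y _ => by rw [hcoe, htot]
  have hc : ∀ y, (total ω y).toNat ≤ cnt α y → cnt α y = (total ω y).toNat := fun y hy => by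
    refine le_antisymm (Nat.cast_le (α := ℕ∞).1 ?_) hy
    rw [hcoe, htot]
    exact hα.le_odometer y
  have hcx := hc x (hge x (Finset.mem_insert_self _ _))
  have hcz : ∀ z ∈ nbs d, cnt α (x - z) = (total ω (x - z)).toNat := fun z hz =>
    hc _ (hge _ (Finset.mem_insert_of_mem (Finset.mem_image_of_mem _ hz)))
  have h0 : (cfg ω.1.1 ω.1.2 (cnt α) x).activeCount = 0 := by
    refine hα.activeCount_eq_zero hI ?_
    rw [hcx, hcoe, htot]
  rw [stable_iff_activeCount, ← h0, procAt]
  congr 1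
  exact cfg_congr (by rw [hr x hT, hcx]) fun z hz => by rw [hr _ (hT' z hz), hcz z hz]

/-! ### Almost sure properties -/

section Fixation

variable {lam : ℝ≥0} {p : PMF (Site d)} {ν : Measure (Config d)} [IsProbabilityMeasure ν]
  {M : ℝ≥0∞}

theorem ae_ringsForever (θ : ℝ≥0) (hθ : 0 < θ) (ρ : Measure (Config d × InstrField d))
    [IsProbabilityMeasure ρ] : ∀ᵐ ω ∂ρ.prod (noiseLaw d θ), RingsForever ω := by
  refine ae_all_iff.2 fun n => ae_all_iff.2 fun x => ?_
  have hpos : bern (ringProb θ n) {true} ≠ 0 := by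
    rw [bern_true]
    exact (ENNReal.ofReal_pos.2 (ringProb_pos hθ n)).ne'
  have h := ae_frequently_mem (bern (ringProb θ n)) (a := fun i => (x, 0, i))
    (fun i j hij => (Prod.mk.inj (Prod.mk.inj hij).2).2) (measurableSet_singleton true) hpos
  have h2 := (measurePreserving_clocks θ n).quasiMeasurePreserving.ae h
  exact Measure.quasiMeasurePreserving_snd.ae (p := fun w : Noise d =>
    ∀ i₀, ∃ i ≥ i₀, clocks w n (x, 0, i) ∈ ({true} : Set Bool)) h2

/-- A site that topples after the time `T` is unstable at some time after `T`. -/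
theorem measure_stable_grid (hM : ∀ x, ∫⁻ ξ, ((ξ x).count : ℝ≥0∞) ∂ν ≤ M) (hMt : M < ⊤)
    (x : Site d) (T D : ℕ) : (omegaLaw lam p ν) {ω | (∀ t x, height ω t x < ⊤) ∧
      (∀ L j : ℕ, (stateAt ω (T + j * (D / (L + 1 : ℕ)))  x).Stable) ∧
      height ω T x < height ω (T + D : ℝ≥0) x} = 0 := by
  set θ : ℝ≥0 := 1 + lam
  obtain ⟨G, hG⟩ : ∃ G, G = growthBound d θ (T + D) M := ⟨_, rfl⟩
  have hGt : G < ⊤ := hG ▸ growthBound_lt_top θ hMt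
  obtain ⟨a, ha⟩ : ∃ a, a = ENNReal.ofReal (θ * D) := ⟨_, rfl⟩
  have hat : a < ⊤ := ha ▸ ENNReal.ofReal_lt_top
  -- The interval of length `D` is cut into `L + 1` pieces. In one of them the site goes from stable
  -- at the left end to a toppling, which has probability of order `(L + 1)⁻²`; the sum over the
  -- pieces is of order `(L + 1)⁻¹`.
  have hle : ∀ L : ℕ, (omegaLaw lam p ν) {ω | (∀ t x, height ω t x < ⊤) ∧
      (∀ L j : ℕ, (stateAt ω (T + j * (D / (L + 1 : ℕ)))  x).Stable) ∧
      height ω T x < height ω (T + D : ℝ≥0) x} ≤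
      (a * (2 * ((nbs d).card * (a * G)))) / ((L + 1 : ℕ) : ℝ≥0∞) := by
    intro L
    have hL0 : ((L + 1 : ℕ) : ℝ≥0) ≠ 0 := by simp
    obtain ⟨s, hs⟩ : ∃ s : ℕ → ℝ≥0, ∀ j, s j = T + j * (D / (L + 1 : ℕ)) := ⟨_, fun _ => rfl⟩
    have hs0 : s 0 = T := by simp [hs]
    have hsL : s (L + 1) = T + D := by
      rw [hs, mul_div_cancel₀ _ hL0]
    have hsm : Monotone s := fun i j hij => by
      rw [hs, hs]
      gcongr
    have hdiff : ∀ j, (s (j + 1) - s j : ℝ) = D / (L + 1 : ℕ) := fun j => by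
      rw [hs, hs]
      push_cast
      ring
    have hof : ∀ j, ENNReal.ofReal (θ * (s (j + 1) - s j)) = a / ((L + 1 : ℕ) : ℝ≥0∞) := fun j => by
      rw [hdiff, ← mul_div_assoc, ENNReal.ofReal_div_of_pos (by positivity), ENNReal.ofReal_natCast,
        ha]
    have hsub : {ω : Omega d | (∀ t x, height ω t x < ⊤) ∧
        (∀ L j : ℕ, (stateAt ω (T + j * (D / (L + 1 : ℕ)))  x).Stable) ∧
        height ω T x < height ω (T + D : ℝ≥0) x} ⊆ ⋃ j ∈ Finset.range (L + 1),
        {ω | (∀ y, height ω (s j) y < ⊤) ∧ (stateAt ω (s j) x).Stable ∧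
          height ω (s j) x < height ω (s (j + 1)) x} := by
      rintro ω ⟨h1, h2, h3⟩
      by_contra hc
      simp only [Set.mem_iUnion, not_exists, Finset.mem_range] at hc
      have h4 : ∀ j ≤ L + 1, height ω (s j) x ≤ height ω (s 0) x := by
        intro j
        induction j with
        | zero => intro _; rfl
        | succ j ih =>
          intro hj
          refine le_trans ?_ (ih (by omega))
          by_contra hlt
          exact hc j (by omega) ⟨h1 _, by simpa only [hs] using h2 L j, not_le.1 hlt⟩
      have := h4 (L + 1) le_rfl
      rw [hs0, hsL] at this
      exact absurd h3 (not_lt.2 this)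
    have hterm : ∀ j ∈ Finset.range (L + 1), (omegaLaw lam p ν)
        {ω | (∀ y, height ω (s j) y < ⊤) ∧ (stateAt ω (s j) x).Stable ∧
          height ω (s j) x < height ω (s (j + 1)) x} ≤
        a / ((L + 1 : ℕ) : ℝ≥0∞) * (2 * ((nbs d).card * (a / ((L + 1 : ℕ) : ℝ≥0∞) * G))) := by
      intro j hj
      have h := measure_stable_height_lt_le θ (lintegral_count_sitewise (lam := lam) (p := p) hM)
        hMt (hsm (Nat.le_succ j)) (T := T + D)
        (hsL ▸ hsm (Nat.succ_le_of_lt (Finset.mem_range.1 hj))) x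
      rwa [hof, ← hG] at h
    refine (measure_mono hsub).trans ((measure_biUnion_finset_le _ _).trans
      ((Finset.sum_le_card_nsmul _ _ _ hterm).trans_eq ?_))
    rw [Finset.card_range, nsmul_eq_mul, ← mul_assoc,
      ENNReal.mul_div_cancel (by simp) (ENNReal.natCast_ne_top _)]
    simp only [div_eq_mul_inv]
    ring
  refine le_antisymm (ge_of_tendsto' (x := atTop) ?_ hle) zero_le
  have hfin : a * (2 * ((nbs d).card * (a * G))) ≠ ⊤ :=
    ENNReal.mul_ne_top hat.ne (ENNReal.mul_ne_top (by simp) (ENNReal.mul_ne_top (by simp)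
      (ENNReal.mul_ne_top hat.ne hGt.ne)))
  have h0 := ENNReal.Tendsto.const_mul (ENNReal.tendsto_inv_nat_nhds_zero.comp
      (tendsto_add_atTop_nat 1)) (Or.inr hfin)
  rw [mul_zero] at h0
  simpa only [div_eq_mul_inv, Function.comp_def] using h0

/-- All exceptional null sets are indexed by natural numbers, including the grid times, where
`procAt` can be exchanged with `stateAt`. Outside them the equivalence is deterministic. -/
theorem ae_fixates_iff (hp : p.support ⊆ neighbors d)
    (hp_gen : AddSubgroup.closure p.support = ⊤) (hν : TranslationErgodic ν)
    (hM : ∀ x, ∫⁻ ξ, ((ξ x).count : ℝ≥0∞) ∂ν ≤ M) (hMt : M < ⊤) :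
    ∀ᵐ ω ∂omegaLaw lam p ν, (Fixates (procAt ω) ↔ odometer ω.1.2 ω.1.1 0 < ⊤) := by
  have hM' := lintegral_count_sitewise (lam := lam) (p := p) hM
  have h1 : ∀ᵐ ω ∂omegaLaw lam p ν, ∀ T D : ℕ, ¬ ((∀ t x, height ω t x < ⊤) ∧
      (∀ L j : ℕ, (stateAt ω (T + j * (D / (L + 1 : ℕ)))  0).Stable) ∧
      height ω T 0 < height ω (T + D : ℝ≥0) 0) :=
    ae_all_iff.2 fun T => ae_all_iff.2 fun D => by
      rw [ae_iff]
      simp only [not_not]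
      exact measure_stable_grid hM hMt 0 T D
  have h2 : ∀ᵐ ω ∂omegaLaw lam p ν, ∀ T D L j : ℕ, ∀ x,
      rheight ω (T + j * (D / (L + 1 : ℕ))) x = height ω (T + j * (D / (L + 1 : ℕ))) x :=
    ae_all_iff.2 fun T => ae_all_iff.2 fun D => ae_all_iff.2 fun L => ae_all_iff.2 fun j =>
      ae_rheight_eq (1 + lam) hM' hMt _
  have h3 : ∀ᵐ ω ∂omegaLaw lam p ν, NbField ω.1.2 :=
    Measure.quasiMeasurePreserving_fst.ae (ae_sitewise_nbField (ν := ν) lam hp)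
  have h4 : ∀ᵐ ω ∂omegaLaw lam p ν, ∀ x,
      (odometer ω.1.2 ω.1.1 x = ⊤ ↔ odometer ω.1.2 ω.1.1 0 = ⊤) :=
    Measure.quasiMeasurePreserving_fst.ae (p := fun r : Config d × InstrField d => ∀ x,
      (odometer r.2 r.1 x = ⊤ ↔ odometer r.2 r.1 0 = ⊤)) (ae_odometer_eq_top_iff hp hp_gen hν)
  filter_upwards [h1, h2, h3, h4, ae_height_lt_top (1 + lam) hM' hMt,
    ae_ringsForever (1 + lam) (by positivity) (sitewise lam p ν)] with ω h1 h2 h3 h4 hfin hring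
  have htot : ∀ x, total ω x = odometer ω.1.2 ω.1.1 x := fun x =>
    (total_le_odometer h3 x).antisymm (odometer_le_total h3 hfin hring x)
  constructor
  · intro hfix
    by_contra hne
    have htop : total ω 0 = ⊤ := (htot 0).trans (not_lt_top_iff.1 hne)
    obtain ⟨T₀, hT₀⟩ := hfix 0
    obtain ⟨T, hT⟩ := exists_nat_ge T₀
    -- At time `T` the odometer is finite while its limit is infinite, so the origin topples again
    -- after `T`, although it is stable at every grid time.
    have hlt : height ω T 0 < ⨆ T : ℕ, height ω T 0 := (hfin T 0).trans_eq htop.symm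
    obtain ⟨T', hT'⟩ := lt_iSup_iff.1 hlt
    refine h1 T T' ⟨hfin, fun L j => ?_, hT'.trans_le (height_mono ω le_add_self 0)⟩
    have hst := hT₀ (T + j * (T' / (L + 1 : ℕ))) (hT.trans le_self_add)
    rw [procAt] at hst
    rw [stateAt]
    simpa only [h2 T T' L j] using hst
  · intro h
    refine fixates_of_odometer_lt_top h3 htot fun x => lt_top_iff_ne_top.2 fun hx => h.ne ((h4 x).1 hx)

end Fixation

/-! ### The law of a process is determined by its finite-dimensional distributions -/

/-- The list of time increments and events that expresses that the path is in `A s` at each time `s`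
of a list. -/
def increments (A : ℝ≥0 → Set (Config d)) : ℝ≥0 → List ℝ≥0 → List (ℝ≥0 × Set (Config d))
  | _, [] => []
  | t, s :: L => (s - t, A s) :: increments A s L

theorem follows_increments (A : ℝ≥0 → Set (Config d)) (γ : ℝ≥0 → Config d) {t : ℝ≥0}
    {L : List ℝ≥0} (hL : (t :: L).Pairwise (· ≤ ·)) :
    Follows γ t (increments A t L) ↔ ∀ s ∈ L, γ s ∈ A s := by
  induction L generalizing t with
  | nil => simp [increments, Follows]
  | cons s L ih =>
    have h1 : t ≤ s := List.rel_of_pairwise_cons hL List.mem_cons_self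
    rw [increments, Follows, add_tsub_cancel_of_le h1, ih (List.pairwise_cons.1 hL).2,
      List.forall_mem_cons]

theorem mem_increments {A : ℝ≥0 → Set (Config d)} {t : ℝ≥0} {L : List ℝ≥0}
    {e : ℝ≥0 × Set (Config d)} (he : e ∈ increments A t L) : ∃ s, e.2 = A s := by
  induction L generalizing t with
  | nil => simp [increments] at he
  | cons s L ih =>
    rw [increments, List.mem_cons] at he
    rcases he with rfl | he
    · exact ⟨s, rfl⟩
    · exact ih he

/-- A process as a random field on space-time. -/
def field {Ω : Type*} (η : ℝ≥0 → Ω → Config d) (ω : Ω) : ℝ≥0 × Site d → Occ := fun c => η c.1 ω c.2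

section Uniqueness

variable {lam : ℝ≥0} {p : PMF (Site d)} {ν : Measure (Config d)}
  {Ω Ω' : Type*} [MeasurableSpace Ω] [MeasurableSpace Ω'] {P : Measure Ω} {P' : Measure Ω'}
  {η : ℝ≥0 → Ω → Config d} {η' : ℝ≥0 → Ω' → Config d}

theorem IsProcess.measurable_field (h : IsProcess lam p ν P η) : Measurable (field η) :=
  measurable_pi_lambda _ fun c => (measurable_pi_apply c.2).comp (h.measurable c.1)

/-- The constraint at time `t` imposed by constraints at finitely many points of space-time. -/
def timeSlice (S : Finset (ℝ≥0 × Site d)) (B : ℝ≥0 × Site d → Set Occ) (t : ℝ≥0) :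
    Set (Config d) := {ξ | ∀ c ∈ S, c.1 = t → ξ c.2 ∈ B c}

theorem isLocal_timeSlice (S : Finset (ℝ≥0 × Site d)) (B : ℝ≥0 × Site d → Set Occ) (t : ℝ≥0) :
    IsLocal (timeSlice S B t) := by
  classical
  refine ⟨S.image Prod.snd, fun ξ ξ' h => propext ?_⟩
  refine forall₃_congr fun c hc _ => ?_
  rw [h c.2 (Finset.mem_coe.2 (Finset.mem_image_of_mem _ hc))]

/-- Constraints at points of space-time are grouped by time and the times sorted, so that they
become local events at successive nonnegative increments. -/
theorem exists_list_eq (S : Finset (ℝ≥0 × Site d)) (B : ℝ≥0 × Site d → Set Occ) :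
    ∃ l : List (ℝ≥0 × Set (Config d)), (∀ e ∈ l, IsLocal e.2) ∧
      ∀ γ : ℝ≥0 → Config d, Follows γ 0 l ↔ ∀ c ∈ S, γ c.1 c.2 ∈ B c := by
  classical
  refine ⟨increments (timeSlice S B) 0 ((S.image Prod.fst).sort (· ≤ ·)), fun e he => ?_,
    fun γ => ?_⟩
  · obtain ⟨s, hs⟩ := mem_increments he
    exact hs ▸ isLocal_timeSlice S B s
  · rw [follows_increments _ _ (List.pairwise_cons.2 ⟨fun _ _ => zero_le,
      Finset.pairwise_sort _ _⟩)]
    simp only [Finset.mem_sort, timeSlice, Set.mem_ofPred_eq]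
    constructor
    · exact fun h c hc => h c.1 (Finset.mem_image_of_mem _ hc) c hc rfl
    · rintro h _ - c hc rfl
      exact h c hc

/-- Cylinder events form a generating π-system, and on each of them both laws are limits of the same
sequence of truncated probabilities. -/
theorem IsProcess.map_field_eq [IsProbabilityMeasure P] [IsProbabilityMeasure P']
    (h : IsProcess lam p ν P η) (h' : IsProcess lam p ν P' η') :
    P.map (field η) = P'.map (field η') := by
  have := Measure.isProbabilityMeasure_map (μ := P) h.measurable_field.aemeasurable
  have := Measure.isProbabilityMeasure_map (μ := P') h'.measurable_field.aemeasurable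
  refine ext_of_generate_finite _ generateFrom_squareCylinders.symm
    (isPiSystem_squareCylinders (fun _ => MeasurableSpace.isPiSystem_measurableSet)
      fun _ => Set.mem_ofPred_eq ▸ MeasurableSet.univ) ?_ (by simp)
  rintro _ ⟨S, B, hB, rfl⟩
  have hm : MeasurableSet ((S : Set (ℝ≥0 × Site d)).pi B) :=
    MeasurableSet.pi (Finset.countable_toSet S) fun c _ => hB c (Set.mem_univ c)
  rw [Measure.map_apply h.measurable_field hm, Measure.map_apply h'.measurable_field hm]
  obtain ⟨l, hl, hf⟩ := exists_list_eq S B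
  have h1 : field η ⁻¹' (S : Set (ℝ≥0 × Site d)).pi B = {ω | Follows (fun t => η t ω) 0 l} := by
    ext ω
    exact (hf fun t => η t ω).symm
  have h2 : field η' ⁻¹' (S : Set (ℝ≥0 × Site d)).pi B = {ω | Follows (fun t => η' t ω) 0 l} := by
    ext ω
    exact (hf fun t => η' t ω).symm
  rw [h1, h2, ← measureReal_eq_measureReal_iff]
  exact tendsto_nhds_unique (h.approx l hl) (h'.approx l hl)

/-- Each site is stable at all large rational times. -/
def rationallyFixates (d : ℕ) : Set (ℝ≥0 × Site d → Occ) :=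
  {γ | ∀ x, ∃ T : ℕ, ∀ q : ℚ, (T : ℝ≥0) ≤ Real.toNNReal q → (γ (Real.toNNReal q, x)).Stable}

theorem measurableSet_rationallyFixates : MeasurableSet (rationallyFixates d) := by
  have : rationallyFixates d = ⋂ x, ⋃ T : ℕ, ⋂ q : ℚ, ⋂ _ : (T : ℝ≥0) ≤ Real.toNNReal q,
      {γ | (γ (Real.toNNReal q, x)).Stable} := by
    ext γ; simp [rationallyFixates]
  rw [this]
  exact MeasurableSet.iInter fun x => MeasurableSet.iUnion fun T => MeasurableSet.iInter fun q =>
    MeasurableSet.iInter fun _ => Measurable.setOf_discrete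
      (f := fun γ : ℝ≥0 × Site d → Occ => γ (Real.toNNReal q, x)) (measurable_pi_apply _) Occ.Stable

/-- The state at `t` persists on a right neighbourhood, which contains rational times. Fixation, an
event over uncountably many times, is thus reduced to a measurable one. -/
theorem fixates_iff_rational {γ : ℝ≥0 → Config d}
    (hγ : ∀ x t, ∀ᶠ s in 𝓝[>] t, γ s x = γ t x) :
    Fixates γ ↔ (fun c : ℝ≥0 × Site d => γ c.1 c.2) ∈ rationallyFixates d := by
  refine forall_congr' fun x => ⟨fun ⟨T, hT⟩ => ?_, fun ⟨T, hT⟩ => ⟨T, fun t ht => ?_⟩⟩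
  · obtain ⟨n, hn⟩ := exists_nat_ge T
    exact ⟨n, fun _ hq => hT _ (hn.trans hq)⟩
  · obtain ⟨u, hu, hsub⟩ := (mem_nhdsGT_iff_exists_Ioo_subset).1 (hγ x t)
    obtain ⟨q, -, hq1, hq2⟩ := (NNReal.lt_iff_exists_rat_btwn t u).1 hu
    have h1 : γ (Real.toNNReal q) x = γ t x := hsub ⟨hq1, hq2⟩
    rw [← h1]
    exact hT q (ht.trans hq1.le)

theorem IsProcess.measure_fixates (h : IsProcess lam p ν P η) :
    P {ω | Fixates fun t => η t ω} = P.map (field η) (rationallyFixates d) := by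
  rw [Measure.map_apply h.measurable_field measurableSet_rationallyFixates]
  refine measure_congr ?_
  filter_upwards [h.rightCont] with ω hω
  exact propext (fixates_iff_rational hω)

end Uniqueness

end ARW

end

/-! ### The main theorem. -/

theorem theorem2p1 {d : ℕ} (lam : ℝ≥0) (hlam : 0 < lam) (p : PMF (ARW.Site d))
    (hp_nn : p.support ⊆ ARW.neighbors d) (hp_gen : AddSubgroup.closure p.support = ⊤)
    (ν : MeasureTheory.Measure (ARW.Config d)) [MeasureTheory.IsProbabilityMeasure ν]
    (hν : ARW.TranslationErgodic ν) (hmean : ∫⁻ ξ, ((ξ 0).count : ℝ≥0∞) ∂ν < ⊤) :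
    (∃ (Ω : Type) (_ : MeasurableSpace Ω) (P : MeasureTheory.Measure Ω)
      (_ : MeasureTheory.IsProbabilityMeasure P) (η : ℝ≥0 → Ω → ARW.Config d),
      ARW.IsProcess lam p ν P η) ∧
    (∀ (Ω : Type*) [MeasurableSpace Ω] (P : MeasureTheory.Measure Ω)
      [MeasureTheory.IsProbabilityMeasure P] (η : ℝ≥0 → Ω → ARW.Config d),
      ARW.IsProcess lam p ν P η →
      P {ω | ARW.Fixates (fun t => η t ω)} =
        ARW.sitewise lam p ν {q | ARW.odometer q.2 q.1 0 < ⊤}) ∧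
    (ARW.sitewise lam p ν {q | ARW.odometer q.2 q.1 0 < ⊤} = 0 ∨
      ARW.sitewise lam p ν {q | ARW.odometer q.2 q.1 0 < ⊤} = 1) := by
  have hM : ∀ x, ∫⁻ ξ, ((ξ x).count : ℝ≥0∞) ∂ν ≤ ∫⁻ ξ, ((ξ 0).count : ℝ≥0∞) ∂ν := fun x => by
    have hm : Measurable fun ξ : ARW.Config d => ((ξ 0).count : ℝ≥0∞) :=
      (Measurable.of_discrete (f := fun o : ARW.Occ => (o.count : ℝ≥0∞))).comp
        (f := fun ξ : ARW.Config d => ξ 0) (measurable_pi_apply 0)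
    have h := (hν.invariant x).lintegral_comp hm
    simp only [ARW.shift, zero_add] at h
    exact h.le
  have hproc := ARW.isProcess_procAt (lam := lam) hp_nn hM hmean
  refine ⟨⟨ARW.Omega d, inferInstance, ARW.omegaLaw lam p ν, inferInstance, _, hproc⟩, ?_,
    ARW.sitewise_odometer_zero_one hp_nn hp_gen hν⟩
  intro Ω _ P _ η hη
  -- The fixation probability depends only on the law of the field, so an arbitrary process may be
  -- replaced by the constructed one, where instructions are available.
  rw [hη.measure_fixates, hη.map_field_eq hproc, ← hproc.measure_fixates]
  have h1 : {ω : ARW.Omega d | ARW.Fixates fun t => ARW.procAt ω t}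
      =ᵐ[ARW.omegaLaw lam p ν] Prod.fst ⁻¹' {q | ARW.odometer q.2 q.1 0 < ⊤} := by
    filter_upwards [ARW.ae_fixates_iff hp_nn hp_gen hν hM hmean] with ω hω
    exact propext hω
  -- Measurability of the odometer event was shown within `NbField`, which has full measure; this
  -- makes the event null-measurable.
  have h2 : {q : ARW.Config d × ARW.InstrField d | ARW.odometer q.2 q.1 0 < ⊤}
      =ᵐ[ARW.sitewise lam p ν] {q | ARW.NbField q.2 ∧ ARW.odometer q.2 q.1 0 < ⊤} := by
    filter_upwards [ARW.ae_sitewise_nbField (ν := ν) lam hp_nn] with q hq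
    exact propext (and_iff_right hq).symm
  rw [MeasureTheory.measure_congr h1]
  exact MeasureTheory.measurePreserving_fst.measure_preimage
    ((ARW.measurableSet_odometer_lt_top 0).nullMeasurableSet.congr h2.symm)
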